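/- Let $K$ be an algebraically closed field (for instance $K=\mathbb C$), $R=K[[x,y]]$, and let $I\subset R$ be a monomial ideal of finite colength with measuring sequence $m(4,1)$ (respectively $m(3,2)$); here $I$ has measuring sequence $m(\alpha,\beta)$ if $(\alpha,\beta)$ is the smallest pair of positive integers such that every automorphism of $R$ fixing the ideals $(x,y^{\alpha})$ and $(x^{\beta},y)$ also fixes $I$. For $a,b\in K$ let $g(a,b)$ be the automorphism $x\mapsto x+ay^2+by^3$, $y\mapsto y$, and $h(a,b)$ the automorphism $x\mapsto x+ay^2$, $y\mapsto y+bx$. Let $F(I)$ be the orbit of $I$ under the group of automorphisms of $R$ fixing $(x,y^2)$, and $\bar F(I)$ its closure in the Grassmannian of subspaces of $R/(x,y)^N$, where $N$ is least with $(x,y)^N\subseteq I$ (equivalently in the Hilbert scheme). The coordinate functions of $F(I)$ are the Plücker coordinates, with respect to the monomials, of $g(a,b)(I)$ (respectively $h(a,b)(I)$), as polynomials in $a,b$. Let $H\subset\mathbb R^2$ be the convex hull of the exponent vectors $(i,j)$ of the monomials $a^ib^j$ occurring in them. The standard fan $\Delta(I)$ is the fan of outer normal cones of $H$; the torus orbit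 in $\bar F(I)$ corresponding to a cone is the set of points of $\bar F(I)$ whose nonzero Plücker coordinates are exactly those whose coordinate function is nonzero with exponent in the dual face of $H$. For $(m,n)\in\mathbb Z^2\setminus\{0\}$ let $I^+(m,n)$ and $I^-(m,n)$ (respectively $I_+(m,n)$ and $I_-(m,n)$) be the ideals corresponding to the two-dimensional cones of $\Delta(I)$ just clockwise and just counterclockwise of the ray through $(m,n)$. Then, for every $(m,n)\in\mathbb Z^2\setminus\{0\}$: 1. For all $a,b\in K^*$ the limit $I[m,n]=I[m,n](a,b)=\lim_{t\to\infty}g(at^m,bt^n)(I)$ (respectively $\lim_{t\to\infty}h(at^m,bt^n)(I)$) exists and is unique. If $m$ and $n$ are coprime, it depends only on $a^n/b^m$. If the ray through $(m,n)$ is a ray of $\Delta(I)$, then as $a,b$ vary through $K^*$, $I[m,n]$ runs over exactly the torus orbit corresponding to that ray, and this is a single orbit under the torus scaling $x$ and $y$. 2. The ideals $I^{\pm}(m,n)$ (respectively $I_\pm(m,n)$) are well defined monomial ideals and are the further limits of $I[m,n]$: along every curve $(as^i,bs^j)$ with $a,b\in K^*$, $i,j\in\mathbb Z$, $ni\ne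 mj$, the limit of $I[m,n](as^i,bs^j)$ as $s\to\infty$ is $I^+(m,n)$ if $ni>mj$ (so that $a^n/b^m\to\infty$) and $I^-(m,n)$ if $ni<mj$ (so that $a^n/b^m\to 0$), respectively $I_+(m,n)$ and $I_-(m,n)$. In particular, if $m,n>0$, then the limit as $b\to0$ with $a$ fixed is $I^+(m,n)$ and the limit as $a\to0$ with $b$ fixed is $I^-(m,n)$ (respectively $I_+(m,n)$ and $I_-(m,n)$). 3. Give $y$ weight $n-m$ and $x$ weight $2n-3m$ (respectively $y$ weight $m+n$ and $x$ weight $m+2n$). Then for every $k\in\mathbb Z$ the weight-$k$ graded pieces of $I^+(m,n)$ and $I^-(m,n)$ (respectively of $I_+(m,n)$ and $I_-(m,n)$) have the same dimension, and so do the weight-$k$ pieces of the quotients of $R$ by these two ideals. -/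

import Mathlib

noncomputable section

namespace HilbToric

/-- The power series ring `K[[x, y]]`, with `x = X 0` and `y = X 1`. -/
abbrev PS (K : Type*) [Field K] := MvPowerSeries (Fin 2) K

/-- The monomial `x ^ (e 0) * y ^ (e 1)`. -/
abbrev mon (K : Type*) [Field K] (e : Fin 2 →₀ ℕ) : PS K := MvPowerSeries.monomial e 1

/-- The maximal ideal `(x, y)`. -/
def maxIdeal (K : Type*) [Field K] : Ideal (PS K) :=
  Ideal.span {MvPowerSeries.X 0, MvPowerSeries.X 1}

/-- The ideal `(x ^ b, y ^ a)`. -/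
def powIdeal (K : Type*) [Field K] (b a : ℕ) : Ideal (PS K) :=
  Ideal.span {MvPowerSeries.X 0 ^ b, MvPowerSeries.X 1 ^ a}

/-- An ideal generated by monomials. -/
def IsMonomialIdeal {K : Type*} [Field K] (I : Ideal (PS K)) : Prop :=
  ∃ A : Set (Fin 2 →₀ ℕ), I = Ideal.span (mon K '' A)

/-- `I` has measuring sequence `m(a, b)`, that is `(x, y ^ a), (x ^ b, y)`: the pair `(a, b)` is the
smallest pair of positive integers such that every automorphism of `K[[x, y]]` which fixes
`(x, y ^ a)` and `(x ^ b, y)` also fixes `I`. -/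
def HasMeasuringSequence {K : Type*} [Field K] (I : Ideal (PS K)) (a b : ℕ) : Prop :=
  IsLeast {p : ℕ × ℕ | 0 < p.1 ∧ 0 < p.2 ∧ ∀ σ : PS K ≃ₐ[K] PS K,
    (powIdeal K 1 p.1).map σ = powIdeal K 1 p.1 →
    (powIdeal K p.2 1).map σ = powIdeal K p.2 1 → I.map σ = I} (a, b)

/-! ### The two cases and their coset representatives -/

/-- The two cases: measuring sequence `m(4, 1)` with the automorphisms `g(a, b)`, and
measuring sequence `m(3, 2)` with the automorphisms `h(a, b)`. -/
inductive Kind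
  | g
  | h

/-- The first index of the measuring sequence. -/
def Kind.fst : Kind → ℕ
  | .g => 4
  | .h => 3

/-- The second index of the measuring sequence. -/
def Kind.snd : Kind → ℕ
  | .g => 1
  | .h => 2

/-- The images of `x` and `y` under the coordinate change with parameters `a, b`:
`g(a, b)` is `x ↦ x + a y² + b y³`, `y ↦ y`, and `h(a, b)` is `x ↦ x + a y²`, `y ↦ y + b x`.
The parameters live in any commutative ring, so that they may also be indeterminates. -/
def Kind.images {A : Type*} [CommRing A] (c : Kind) (a b : A) : Fin 2 → MvPolynomial (Fin 2) A :=
  match c with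
  | .g => ![MvPolynomial.X 0 + MvPolynomial.C a * MvPolynomial.X 1 ^ 2
              + MvPolynomial.C b * MvPolynomial.X 1 ^ 3,
            MvPolynomial.X 1]
  | .h => ![MvPolynomial.X 0 + MvPolynomial.C a * MvPolynomial.X 1 ^ 2,
            MvPolynomial.X 1 + MvPolynomial.C b * MvPolynomial.X 0]

theorem Kind.hasSubst {K : Type*} [Field K] (c : Kind) (a b : K) :
    MvPowerSeries.HasSubst (fun i => (c.images a b i : PS K)) := by
  apply MvPowerSeries.hasSubst_of_constantCoeff_zero
  intro i
  cases c <;> fin_cases i <;> simp [Kind.images]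

/-- The automorphism `g(a, b)`, respectively `h(a, b)`, of `K[[x, y]]`. -/
def Kind.aut {K : Type*} [Field K] (c : Kind) (a b : K) : PS K →ₐ[K] PS K :=
  MvPowerSeries.substAlgHom (c.hasSubst a b)

/-- The weights of `x` and `y` attached to `(m, n)`: for `g` these are `2n - 3m` and `n - m`,
for `h` they are `m + 2n` and `m + n`. -/
def Kind.weight (c : Kind) (m n : ℤ) : Fin 2 → ℤ :=
  match c with
  | .g => ![2 * n - 3 * m, n - m]
  | .h => ![m + 2 * n, m + n]

/-! ### The orbit `F(I)`, Plücker coordinates and the closure of `F(I)` -/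

/-- The orbit `F(I)` of `I` under the group `G` of the automorphisms fixing `(x, y ^ 2)`. -/
def orbit {K : Type*} [Field K] (I : Ideal (PS K)) : Set (Ideal (PS K)) :=
  {J | ∃ σ : PS K ≃ₐ[K] PS K, (powIdeal K 1 2).map σ = powIdeal K 1 2 ∧ J = I.map σ}

/-- The least `N` with `(x, y) ^ N ≤ I` (for `I` of finite colength). All ideals in the orbit of `I`
lie between `(x, y) ^ N` and the unit ideal, and are seen as subspaces of the quotient
`V = K[[x, y]] / (x, y) ^ N`. -/
def trunc {K : Type*} [Field K] (I : Ideal (PS K)) : ℕ := sInf {N | maxIdeal K ^ N ≤ I}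

/-- The monomial basis of `V`: columns of the matrices below. -/
abbrev Col {K : Type*} [Field K] (I : Ideal (PS K)) : Type :=
  {e : Fin 2 →₀ ℕ // e.degree < trunc I}

/-- The monomials of `V` that lie in the monomial ideal `I`: rows of the matrices below. Their
number is the dimension of `I / (x, y) ^ N`. -/
abbrev Row {K : Type*} [Field K] (I : Ideal (PS K)) : Type :=
  {e : Fin 2 →₀ ℕ // e.degree < trunc I ∧ mon K e ∈ I}

instance {K : Type*} [Field K] (I : Ideal (PS K)) : Finite (Row I) :=
  Set.Finite.to_subtype ((Finsupp.finite_of_degree_le (σ := Fin 2) (trunc I)).subset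
    fun _ he => he.1.le)

instance {K : Type*} [Field K] (I : Ideal (PS K)) : Fintype (Row I) := Fintype.ofFinite _

/-- `p` is a vector of Plücker coordinates of the subspace `J / (x, y) ^ N` of `V`, relative to the
monomial basis: for some basis `v` of `J / (x, y) ^ N`, with as many elements as there are monomials
in a basis of `I / (x, y) ^ N`, the coordinate `p S` is the minor of the coefficient matrix of `v`
in the columns `S`. -/
def IsPlucker {K : Type*} [Field K] (I J : Ideal (PS K)) (p : (Row I → Col I) → K) : Prop :=
  maxIdeal K ^ trunc I ≤ J ∧
  ∃ v : Row I → PS K, (∀ i, v i ∈ J) ∧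
    (∀ f ∈ J, ∃! c : Row I → K, f - ∑ i, c i • v i ∈ maxIdeal K ^ trunc I) ∧
    ∀ S, p S = (Matrix.of fun i j => MvPowerSeries.coeff (S j).1 (v i)).det

/-- The (Zariski) closure of `F(I)` in the Grassmannian of subspaces of `V` (equivalently in the
Hilbert scheme): the ideals `J` such that every homogeneous polynomial in the Plücker coordinates
which vanishes on `F(I)` vanishes at `J`. -/
def orbitClosure {K : Type*} [Field K] (I : Ideal (PS K)) : Set (Ideal (PS K)) :=
  {J | ∃ p, IsPlucker I J p ∧
    ∀ (Q : MvPolynomial (Row I → Col I) K) (k : ℕ), Q.IsHomogeneous k →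
      (∀ J' ∈ orbit I, ∀ p', IsPlucker I J' p' → MvPolynomial.eval p' Q = 0) →
      MvPolynomial.eval p Q = 0}

/-! ### The standard fan -/

/-- The coordinate functions of `F(I)`, as polynomials in the affine coordinates `a = X 0` and
`b = X 1`: the maximal minors of the matrix whose rows are the transforms under `g(a, b)`
(respectively `h(a, b)`) of the monomials in `I`. -/
def coordFun {K : Type*} [Field K] (c : Kind) (I : Ideal (PS K)) (S : Row I → Col I) :
    MvPolynomial (Fin 2) K :=
  (Matrix.of fun i j : Row I => MvPolynomial.coeff (S j).1
    (c.images (MvPolynomial.X 0 : MvPolynomial (Fin 2) K) (MvPolynomial.X 1) 0 ^ (i.1 0)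
      * c.images (MvPolynomial.X 0 : MvPolynomial (Fin 2) K) (MvPolynomial.X 1) 1 ^ (i.1 1))).det

/-- The exponent vector of a monomial in `a, b`, as a point of the plane. -/
def expVec (e : Fin 2 →₀ ℕ) : ℝ × ℝ := ((e 0 : ℝ), (e 1 : ℝ))

/-- The convex hull of the exponent vectors of the coordinate functions of `F(I)`. -/
def polygon {K : Type*} [Field K] (c : Kind) (I : Ideal (PS K)) : Set (ℝ × ℝ) :=
  convexHull ℝ {u | ∃ S, ∃ e ∈ (coordFun c I S).support, u = expVec e}

/-- The standard pairing of directions with exponent vectors. -/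
def pair (w u : ℝ × ℝ) : ℝ := w.1 * u.1 + w.2 * u.2

/-- The face of `H` on which the functional `w` is largest. -/
def face (H : Set (ℝ × ℝ)) (w : ℝ × ℝ) : Set (ℝ × ℝ) := {u ∈ H | ∀ v ∈ H, pair w v ≤ pair w u}

/-- The cone of outer normals of `H` along the face `Φ`. -/
def normalCone (H Φ : Set (ℝ × ℝ)) : Set (ℝ × ℝ) := {w | Φ ⊆ face H w}

/-- The standard fan `Δ(I)`: the set of outer normal cones of the nonempty faces of the polygon.
Its rays are the outer normals of the edges. -/
def standardFan {K : Type*} [Field K] (c : Kind) (I : Ideal (PS K)) : Set (Set (ℝ × ℝ)) :=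
  {σ | ∃ w, σ = normalCone (polygon c I) (face (polygon c I) w)}

/-- The ray through `w`. -/
def ray (w : ℝ × ℝ) : Set (ℝ × ℝ) := {u | ∃ r : ℝ, 0 ≤ r ∧ u = r • w}

/-- The face of `H` dual to the cone `σ`. -/
def dualFace (H σ : Set (ℝ × ℝ)) : Set (ℝ × ℝ) := {u ∈ H | ∀ w ∈ σ, u ∈ face H w}

/-- The torus orbit in the closure of `F(I)` attached to a cone `σ` of the standard fan: the points
whose nonzero Plücker coordinates are exactly those where the coordinate function is nonzero with
exponent vector in the face dual to `σ`. -/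
def torusOrbit {K : Type*} [Field K] (c : Kind) (I : Ideal (PS K)) (σ : Set (ℝ × ℝ)) :
    Set (Ideal (PS K)) :=
  {J ∈ orbitClosure I | ∃ p, IsPlucker I J p ∧
    ∀ S, p S ≠ 0 ↔ ∃ e ∈ (coordFun c I S).support, expVec e ∈ dualFace (polygon c I) σ}

/-- The set of translates of `J` under the torus that scales `x` and `y`. -/
def scalingOrbit {K : Type*} [Field K] (J : Ideal (PS K)) : Set (Ideal (PS K)) :=
  Set.range fun s : Fin 2 → Kˣ => J.map (MvPowerSeries.rescale fun i => (s i : K))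

/-- `J` is the ideal `I⁺(m, n)` (respectively `I₊(m, n)`): the point corresponding to the
two-dimensional cone of the standard fan that lies just clockwise of the ray through `(m, n)`. -/
def IsPlus {K : Type*} [Field K] (c : Kind) (I : Ideal (PS K)) (m n : ℤ) (J : Ideal (PS K)) :
    Prop :=
  ∃ σ ∈ standardFan c I, (interior σ).Nonempty ∧
    (∀ᶠ ε : ℝ in nhdsWithin 0 (Set.Ioi 0), ((m : ℝ) + ε * n, (n : ℝ) - ε * m) ∈ σ) ∧
    J ∈ torusOrbit c I σ

/-- `J` is the ideal `I⁻(m, n)` (respectively `I₋(m, n)`): the point corresponding to the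
two-dimensional cone of the standard fan that lies just counterclockwise of the ray through
`(m, n)`. -/
def IsMinus {K : Type*} [Field K] (c : Kind) (I : Ideal (PS K)) (m n : ℤ) (J : Ideal (PS K)) :
    Prop :=
  ∃ σ ∈ standardFan c I, (interior σ).Nonempty ∧
    (∀ᶠ ε : ℝ in nhdsWithin 0 (Set.Ioi 0), ((m : ℝ) - ε * n, (n : ℝ) + ε * m) ∈ σ) ∧
    J ∈ torusOrbit c I σ

/-! ### Limits of families of ideals -/

/-- `J` is the limit as `t → ∞` of the algebraic family of ideals `F t`, in the Grassmannian of
subspaces of `V`: the Plücker coordinates of `F t` are given, for all but finitely many `t`, by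
polynomials `P S` in `t`, and the coefficients of the highest power of `t` that occurs in
`(P S)_S` are Plücker coordinates of `J`. -/
def IsLimitAtInfinity {K : Type*} [Field K] (I : Ideal (PS K)) (F : Kˣ → Ideal (PS K))
    (J : Ideal (PS K)) : Prop :=
  ∃ (P : (Row I → Col I) → Polynomial K) (d : ℕ), (∀ S, (P S).natDegree ≤ d) ∧
    (∀ᶠ t : Kˣ in Filter.cofinite, IsPlucker I (F t) fun S => (P S).eval (t : K)) ∧
    IsPlucker I J fun S => (P S).coeff d

/-- `J` is the limit of `F t` as `t → 0`. -/
def IsLimitAtZero {K : Type*} [Field K] (I : Ideal (PS K)) (F : Kˣ → Ideal (PS K))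
    (J : Ideal (PS K)) : Prop :=
  IsLimitAtInfinity I (fun t => F t⁻¹) J

/-! ### Graded pieces -/

/-- The power series that are homogeneous of weight `k`, when `x` and `y` have weights
`w 0` and `w 1`. -/
def weightPiece (K : Type*) [Field K] (w : Fin 2 → ℤ) (k : ℤ) : Submodule K (PS K) :=
  ⨅ (e : Fin 2 →₀ ℕ) (_ : (e 0 : ℤ) * w 0 + (e 1 : ℤ) * w 1 ≠ k),
    LinearMap.ker (MvPowerSeries.coeff (R := K) e)

/-- The graded piece of weight `k` of the ideal `J`. -/
def gradedPiece {K : Type*} [Field K] (J : Ideal (PS K)) (w : Fin 2 → ℤ) (k : ℤ) :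
    Submodule K (PS K) :=
  J.restrictScalars K ⊓ weightPiece K w k

/-- The graded piece of weight `k` of the quotient by `J`. -/
abbrev quotPiece {K : Type*} [Field K] (J : Ideal (PS K)) (w : Fin 2 → ℤ) (k : ℤ) :=
  weightPiece K w k ⧸ (gradedPiece J w k).comap (weightPiece K w k).subtype

end HilbToric

end

/-! Everything rests on a bigrading. Give $x,y$ the two weights `c.axis 0`, `c.axis 1`. Replacing a
monomial by a term of its image under $g(a,b)$ or $h(a,b)$ raises these weights by exactly the
exponents of $a$ and $b$ in that term (`HasBiExp.images`). Hence every maximal minor is a single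
monomial $\kappa_S a^{e_0}b^{e_1}$, and $(e_0,e_1)$ is the total biweight of the columns $S$ minus
that of the rows (`hasExp_coordFun`). Inserting $(at^m,bt^n)$ multiplies the coordinate $S$ by
$t^{me_0+ne_1}$, and $me_0+ne_1$ is, up to a constant, the total weight of $S$ for the weights in
part 3 (`colWt_weight`).

The limit therefore keeps the coordinates on the face of the polygon where $(m,n)$ is largest. That
these are the Plücker coordinates of an ideal is a Gröbner degeneration: they describe the initial
ideal for that weight (`IsPlucker.exists_initial`). A further limit inside the face maximises a
second functional. It ends at a vertex, where all exponents agree; since the biweight separates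
monomials, the resulting ideal is monomial (`spannedBy_of_expo_eq`). Rescaling $x,y$ is the same as
rescaling $(a,b)$, because the two weights form a unimodular matrix (`Kind.exists_units`,
`map_rescale_eq`).

To identify torus orbits in the closure, the measuring sequence first shows that every point of
$F(I)$ is $g(a,b)(I)$ or $h(a,b)(I)$ (`exists_map_eq_aut`). So the closure satisfies the binomial
relations among the $\kappa_S a^{e_0}b^{e_1}$. A point with support a given set of columns then
determines a character on the lattice spanned by the vectors $(1,e_0,e_1)$; it extends because $K^*$
is divisible. Thus the point has the same coordinates as a limit with some parameters $(a,b)$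
(`exists_eq_facePoint`).

For the dimensions, both adjacent vertices have maximal $(m,n)$-weight on the ideal with parameters
$(1,1)$. For each $k$, the elements of that ideal of weight at most $k$, modulo $(x,y)^N$, form a
space whose dimension is the number of columns of weight at most $k$ at either vertex
(`finrank_lowPart`). So the two monomial ideals have equally many monomials of each weight below
degree $N$, and contain all monomials of higher degree. -/

noncomputable section

namespace HilbToric

/-! ### Powers of the maximal ideal and monomial ideals of finite colength -/

section

open MvPowerSeries

variable {K : Type*} [Field K]

/-- The power series with given coefficients. -/
def ofCoeff (c : (Fin 2 →₀ ℕ) → K) : PS K := c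

@[simp] theorem coeff_ofCoeff (c : (Fin 2 →₀ ℕ) → K) (e : Fin 2 →₀ ℕ) :
    coeff e (ofCoeff c) = c e := rfl

/-- The power series without terms of degree `< n`. -/
def orderIdeal (K : Type*) [Field K] (n : ℕ) : Ideal (PS K) where
  carrier := {f | ∀ e : Fin 2 →₀ ℕ, e.degree < n → coeff e f = 0}
  zero_mem' := by intro e _; simp
  add_mem' := by
    intro f g hf hg e he
    rw [map_add, hf e he, hg e he, add_zero]
  smul_mem' := by
    intro c f hf e he
    classical
    rw [smul_eq_mul, coeff_mul]
    refine Finset.sum_eq_zero fun p hp => ?_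
    have : p.1 + p.2 = e := Finset.HasAntidiagonal.mem_antidiagonal.1 hp
    rw [hf p.2, mul_zero]
    rw [← this, map_add] at he
    omega

theorem maxIdeal_le_orderIdeal : maxIdeal K ≤ orderIdeal K 1 := by
  rw [maxIdeal, Ideal.span_le]
  rintro _ (rfl | rfl) e he <;>
  · have : e = 0 := by
      rw [← Finsupp.degree_eq_zero_iff]; omega
    rw [this, coeff_zero_X]

theorem orderIdeal_mul_le (a b : ℕ) :
    orderIdeal K a * orderIdeal K b ≤ orderIdeal K (a + b) := by
  rw [Ideal.mul_le]
  intro f hf g hg e he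
  classical
  rw [coeff_mul]
  refine Finset.sum_eq_zero fun p hp => ?_
  have h : p.1 + p.2 = e := Finset.HasAntidiagonal.mem_antidiagonal.1 hp
  rw [← h, map_add] at he
  by_cases h1 : p.1.degree < a
  · rw [hf p.1 h1, zero_mul]
  · rw [hg p.2 (by omega), mul_zero]

/-- All terms divisible by $x$ go into `g₀`, the pure powers of $y$ into `g₁`; there is no constant
term because the order is at least one. -/
theorem exists_eq_X_mul_add {n : ℕ} {f : PS K} (hf : f ∈ orderIdeal K (n + 1)) :
    ∃ g₀ ∈ orderIdeal K n, ∃ g₁ ∈ orderIdeal K n, f = X 0 * g₀ + X 1 * g₁ := by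
  classical
  refine ⟨ofCoeff fun e => coeff (e + Finsupp.single 0 1) f, ?_,
    ofCoeff fun e => if e 0 = 0 then coeff (e + Finsupp.single 1 1) f else 0, ?_, ?_⟩
  · intro e he
    rw [coeff_ofCoeff]
    exact hf _ (by rw [map_add]; simpa using he)
  · intro e he
    rw [coeff_ofCoeff, hf _ (by rw [map_add]; simpa using he), ite_self]
  · ext e
    rw [map_add, X, X, coeff_monomial_mul, coeff_monomial_mul, one_mul, one_mul,
      coeff_ofCoeff, coeff_ofCoeff]
    have h0 : (Finsupp.single 0 1 ≤ e) ↔ e 0 ≠ 0 := by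
      rw [Finsupp.single_le_iff]; omega
    have h1 : (Finsupp.single 1 1 ≤ e) ↔ e 1 ≠ 0 := by
      rw [Finsupp.single_le_iff]; omega
    by_cases he : e 0 = 0
    · rw [if_neg (by rw [h0]; simpa using he)]
      by_cases he1 : e 1 = 0
      · rw [if_neg (by rw [h1]; simpa using he1), hf e, zero_add]
        have : e = 0 := by ext i; fin_cases i <;> simpa
        simp [this]
      · rw [if_pos (h1.2 he1), if_pos (by simpa using he), zero_add,
          tsub_add_cancel_of_le (h1.2 he1)]
    · rw [if_pos (h0.2 he), tsub_add_cancel_of_le (h0.2 he)]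
      have : (e - Finsupp.single 1 1 : Fin 2 →₀ ℕ) 0 ≠ 0 := by simpa using he
      rw [if_neg this, ite_self, add_zero]

theorem X_mem_maxIdeal (i : Fin 2) : (X i : PS K) ∈ maxIdeal K :=
  Ideal.subset_span (by fin_cases i <;> simp)

theorem maxIdeal_pow_eq (n : ℕ) : maxIdeal K ^ n = orderIdeal K n := by
  induction n with
  | zero =>
    rw [pow_zero, Ideal.one_eq_top, eq_comm, eq_top_iff]
    intro f _ e he
    omega
  | succ n ih =>
    apply le_antisymm
    · rw [pow_succ, ih]
      exact (Ideal.mul_mono_right maxIdeal_le_orderIdeal).trans (orderIdeal_mul_le n 1)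
    · intro f hf
      obtain ⟨g₀, h₀, g₁, h₁, rfl⟩ := exists_eq_X_mul_add hf
      rw [pow_succ', ih]
      exact add_mem (Ideal.mul_mem_mul (X_mem_maxIdeal 0) h₀)
        (Ideal.mul_mem_mul (X_mem_maxIdeal 1) h₁)

theorem mem_maxIdeal_pow {n : ℕ} {f : PS K} :
    f ∈ maxIdeal K ^ n ↔ ∀ e : Fin 2 →₀ ℕ, e.degree < n → coeff e f = 0 := by
  rw [maxIdeal_pow_eq]; rfl

theorem mem_maxIdeal {f : PS K} : f ∈ maxIdeal K ↔ coeff 0 f = 0 := by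
  rw [← pow_one (maxIdeal K), mem_maxIdeal_pow]
  constructor
  · intro h; exact h 0 (by simp)
  · intro h e he
    have : e = 0 := by
      rw [← Finsupp.degree_eq_zero_iff]; omega
    rw [this, h]

theorem eq_of_sub_mem_maxIdeal_pow {f g : PS K} (h : ∀ n, f - g ∈ maxIdeal K ^ n) : f = g := by
  rw [← sub_eq_zero]
  ext e
  exact mem_maxIdeal_pow.1 (h (e.degree + 1)) e (by omega)

theorem degree_fin_two (e : Fin 2 →₀ ℕ) : e.degree = e 0 + e 1 := by
  rw [Finsupp.degree_eq_sum, Fin.sum_univ_two]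

/-- A finite set of monomials containing those of degree `< n`. -/
def lowMonomials (n : ℕ) : Finset (Fin 2 →₀ ℕ) :=
  (Finsupp.finite_of_degree_le (σ := Fin 2) n).toFinset.filter fun e => e.degree < n

theorem mem_lowMonomials {n : ℕ} {e : Fin 2 →₀ ℕ} : e ∈ lowMonomials n ↔ e.degree < n := by
  simp only [lowMonomials, Finset.mem_filter, Set.Finite.mem_toFinset, Set.mem_ofPred_eq]
  exact ⟨fun h => h.2, fun h => ⟨h.le, h⟩⟩

theorem coeff_mon [DecidableEq (Fin 2 →₀ ℕ)] (e d : Fin 2 →₀ ℕ) :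
    coeff e (mon K d) = if e = d then 1 else 0 := by
  rw [mon, coeff_monomial]; congr

theorem sub_sum_mem_maxIdeal_pow (f : PS K) (n : ℕ) :
    f - ∑ e ∈ lowMonomials n, coeff e f • mon K e ∈ maxIdeal K ^ n := by
  classical
  rw [mem_maxIdeal_pow]
  intro e he
  rw [map_sub, map_sum, sub_eq_zero]
  simp_rw [coeff_smul, coeff_mon]
  simp [mem_lowMonomials, he]

theorem smul_mem_ideal {J : Ideal (PS K)} (c : K) {f : PS K} (h : f ∈ J) : c • f ∈ J := by
  rw [smul_eq_C_mul]; exact J.mul_mem_left _ h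

theorem mem_of_forall_mon_mem {J : Ideal (PS K)} {n : ℕ} (hJ : maxIdeal K ^ n ≤ J) {f : PS K}
    (h : ∀ e : Fin 2 →₀ ℕ, e.degree < n → coeff e f ≠ 0 → mon K e ∈ J) : f ∈ J := by
  rw [← sub_add_cancel f (∑ e ∈ lowMonomials n, coeff e f • mon K e)]
  refine add_mem (hJ (sub_sum_mem_maxIdeal_pow f n)) (sum_mem fun e he => ?_)
  by_cases h0 : coeff e f = 0
  · rw [h0, zero_smul]; exact zero_mem _
  · exact smul_mem_ideal _ (h e (mem_lowMonomials.1 he) h0)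

theorem mon_mem_of_le {J : Ideal (PS K)} {d e : Fin 2 →₀ ℕ} (hde : d ≤ e) (h : mon K d ∈ J) :
    mon K e ∈ J := by
  have : mon K e = mon K (e - d) * mon K d := by
    rw [mon, mon, mon, monomial_mul_monomial, tsub_add_cancel_of_le hde, one_mul]
  rw [this]
  exact J.mul_mem_left _ h

theorem mon_eq (e : Fin 2 →₀ ℕ) : mon K e = X 0 ^ e 0 * X 1 ^ e 1 := by
  rw [X_pow_eq, X_pow_eq, monomial_mul_monomial, one_mul]
  congr 1
  ext i
  fin_cases i <;> simp

/-- The monomials of an element of a monomial ideal are multiples of the generators. -/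
theorem exists_le_of_mem_span {A : Set (Fin 2 →₀ ℕ)} {f : PS K}
    (hf : f ∈ Ideal.span (mon K '' A)) {e : Fin 2 →₀ ℕ} (he : coeff e f ≠ 0) :
    ∃ d ∈ A, d ≤ e := by
  classical
  contrapose! he
  induction hf using Submodule.span_induction generalizing e with
  | mem x hx =>
    obtain ⟨d, hd, rfl⟩ := hx
    rw [coeff_mon, if_neg]
    rintro rfl
    exact he _ hd le_rfl
  | zero => simp
  | add x y _ _ hx hy => rw [map_add, hx he, hy he, add_zero]
  | smul a x _ hx =>
    rw [smul_eq_mul, coeff_mul]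
    refine Finset.sum_eq_zero fun p hp => ?_
    have h : p.1 + p.2 = e := Finset.HasAntidiagonal.mem_antidiagonal.1 hp
    rw [hx fun d hd hle => he d hd (hle.trans (h ▸ le_add_self)), mul_zero]

theorem IsMonomialIdeal.mon_mem {I : Ideal (PS K)} (hI : IsMonomialIdeal I) {f : PS K}
    (hf : f ∈ I) {e : Fin 2 →₀ ℕ} (he : coeff e f ≠ 0) : mon K e ∈ I := by
  obtain ⟨A, rfl⟩ := hI
  obtain ⟨d, hd, hde⟩ := exists_le_of_mem_span hf he
  exact mon_mem_of_le hde (Ideal.subset_span ⟨d, hd, rfl⟩)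

theorem X_mul_mem_span {n : ℕ} (i : Fin 2) {f : PS K}
    (hf : f ∈ Ideal.span (mon K '' {e | e.degree = n})) :
    X i * f ∈ Ideal.span (mon K '' {e | e.degree = n + 1}) := by
  induction hf using Submodule.span_induction with
  | mem x hx =>
    obtain ⟨d, hd, rfl⟩ := hx
    refine Ideal.subset_span ⟨Finsupp.single i 1 + d, ?_, ?_⟩
    · have : d.degree = n := hd
      change (_ + _ : Fin 2 →₀ ℕ).degree = _
      rw [map_add, this, Finsupp.degree_single, add_comm]
    · rw [mon, mon, X, monomial_mul_monomial, one_mul]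
  | zero => simp
  | add x y _ _ hx hy => rw [mul_add]; exact add_mem hx hy
  | smul a x _ hx => rw [smul_eq_mul, mul_left_comm]; exact Ideal.mul_mem_left _ _ hx

theorem maxIdeal_pow_le_span (n : ℕ) :
    maxIdeal K ^ n ≤ Ideal.span (mon K '' {e | e.degree = n}) := by
  rw [maxIdeal_pow_eq]
  induction n with
  | zero =>
    intro f _
    rw [← mul_one f]
    refine Ideal.mul_mem_left _ _ (Ideal.subset_span ⟨0, by simp, ?_⟩)
    rw [mon, monomial_zero_one]
  | succ n ih =>
    intro f hf
    obtain ⟨g₀, h₀, g₁, h₁, rfl⟩ := exists_eq_X_mul_add hf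
    exact add_mem (X_mul_mem_span 0 (ih h₀)) (X_mul_mem_span 1 (ih h₁))

theorem mon_mem_maxIdeal_pow {n : ℕ} {e : Fin 2 →₀ ℕ} (h : n ≤ e.degree) :
    mon K e ∈ maxIdeal K ^ n := by
  classical
  rw [mem_maxIdeal_pow]
  intro d hd
  rw [coeff_mon, if_neg]
  rintro rfl
  omega

theorem maxIdeal_pow_le_of_mon_mem {n : ℕ} {J : Ideal (PS K)}
    (h : ∀ e : Fin 2 →₀ ℕ, e.degree = n → mon K e ∈ J) : maxIdeal K ^ n ≤ J := by
  refine (maxIdeal_pow_le_span n).trans (Ideal.span_le.2 ?_)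
  rintro _ ⟨e, he, rfl⟩
  exact h e he

/-- An ideal of finite colength that contains the monomials of its elements is monomial. -/
theorem isMonomialIdeal_of_mon_mem {J : Ideal (PS K)} {n : ℕ} (hJ : maxIdeal K ^ n ≤ J)
    (h : ∀ f ∈ J, ∀ e : Fin 2 →₀ ℕ, e.degree < n → coeff e f ≠ 0 → mon K e ∈ J) :
    IsMonomialIdeal J := by
  refine ⟨{e | mon K e ∈ J}, le_antisymm (fun f hf => ?_) ?_⟩
  · have hle : maxIdeal K ^ n ≤ Ideal.span (mon K '' {e | mon K e ∈ J}) :=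
      maxIdeal_pow_le_of_mon_mem fun e he =>
        Ideal.subset_span ⟨e, hJ (mon_mem_maxIdeal_pow he.ge), rfl⟩
    exact mem_of_forall_mon_mem hle fun e he h0 => Ideal.subset_span ⟨e, h f hf e he h0, rfl⟩
  · rw [Ideal.span_le]
    rintro _ ⟨e, he, rfl⟩
    exact he

/-- If no power of the variable were in `I`, these powers would stay linearly independent in the
finite-dimensional quotient, since a monomial ideal contains every monomial occurring in one of its
elements. -/
theorem exists_single_mem {I : Ideal (PS K)} (hI : IsMonomialIdeal I)
    [Module.Finite K (PS K ⧸ I)] (i : Fin 2) : ∃ n, mon K (Finsupp.single i n) ∈ I := by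
  classical
  by_contra! hn
  have hli : LinearIndependent K
      fun n : ℕ => Ideal.Quotient.mkₐ K I (mon K (Finsupp.single i n)) := by
    rw [linearIndependent_iff']
    intro s g hg n hns
    by_contra h0
    have hmem : ∑ k ∈ s, g k • mon K (Finsupp.single i k) ∈ I := by
      rw [← Ideal.Quotient.eq_zero_iff_mem, ← Ideal.Quotient.mkₐ_eq_mk K, map_sum]
      simpa only [map_smul] using hg
    refine hn n (hI.mon_mem hmem ?_)
    rw [map_sum, Finset.sum_eq_single n]
    · rwa [coeff_smul, coeff_mon, if_pos rfl, mul_one]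
    · intro b _ hb
      rw [coeff_smul, coeff_mon, if_neg, mul_zero]
      intro h
      exact hb (Finsupp.single_injective i h).symm
    · exact fun h => absurd hns h
  exact Module.Finite.not_linearIndependent_of_infinite _ hli

theorem exists_maxIdeal_pow_le {I : Ideal (PS K)} (hI : IsMonomialIdeal I)
    [Module.Finite K (PS K ⧸ I)] : ∃ n, maxIdeal K ^ n ≤ I := by
  obtain ⟨p, hp⟩ := exists_single_mem hI 0
  obtain ⟨q, hq⟩ := exists_single_mem hI 1
  refine ⟨p + q, maxIdeal_pow_le_of_mon_mem fun e he => ?_⟩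
  rw [degree_fin_two] at he
  by_cases h : p ≤ e 0
  · exact mon_mem_of_le (Finsupp.single_le_iff.2 h) hp
  · exact mon_mem_of_le (Finsupp.single_le_iff.2 (by omega)) hq

theorem maxIdeal_pow_trunc_le {I : Ideal (PS K)} (hI : IsMonomialIdeal I)
    [Module.Finite K (PS K ⧸ I)] : maxIdeal K ^ trunc I ≤ I :=
  Nat.sInf_mem (s := {N | maxIdeal K ^ N ≤ I}) (exists_maxIdeal_pow_le hI)

end

section

open MvPowerSeries

variable {K : Type*} [Field K]

/-! ### Automorphisms of the power series ring -/

theorem map_mem_maxIdeal_pow {σ : PS K →ₐ[K] PS K} (hσ : ∀ i, σ (X i) ∈ maxIdeal K) {n : ℕ}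
    {f : PS K} (hf : f ∈ maxIdeal K ^ n) : σ f ∈ maxIdeal K ^ n := by
  have h : (maxIdeal K).map σ ≤ maxIdeal K := by
    rw [maxIdeal, Ideal.map_span, Ideal.span_le]
    rintro _ ⟨_, (rfl | rfl), rfl⟩
    exacts [hσ 0, hσ 1]
  have h' := Ideal.pow_right_mono h n
  rw [← Ideal.map_pow] at h'
  exact h' (Ideal.mem_map_of_mem σ hf)

/-- Surjectivity on the cotangent space propagates to each graded piece $\mathfrak m^n/\mathfrak
m^{n+1}$, because that piece is generated by products of linear forms. -/
theorem exists_sub_mem_maxIdeal_pow_succ {σ : PS K →ₐ[K] PS K}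
    (h : ∀ i, ∃ f ∈ maxIdeal K, σ f - X i ∈ maxIdeal K ^ 2) (hσ : ∀ i, σ (X i) ∈ maxIdeal K)
    {n : ℕ} {g : PS K} (hg : g ∈ maxIdeal K ^ n) :
    ∃ f ∈ maxIdeal K ^ n, σ f - g ∈ maxIdeal K ^ (n + 1) := by
  induction n generalizing g with
  | zero =>
    refine ⟨algebraMap K _ (coeff 0 g), by simp, ?_⟩
    rw [σ.commutes, zero_add, pow_one, mem_maxIdeal, map_sub, sub_eq_zero,
      MvPowerSeries.algebraMap_apply]
    simp
  | succ n ih =>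
    choose ℓ hℓ hℓ' using h
    rw [maxIdeal_pow_eq] at hg
    obtain ⟨g₀, h₀, g₁, h₁, rfl⟩ := exists_eq_X_mul_add hg
    rw [← maxIdeal_pow_eq] at h₀ h₁
    obtain ⟨f₀, hf₀, hf₀'⟩ := ih h₀
    obtain ⟨f₁, hf₁, hf₁'⟩ := ih h₁
    have key : ∀ (i : Fin 2) {f g : PS K}, f ∈ maxIdeal K ^ n →
        σ f - g ∈ maxIdeal K ^ (n + 1) → σ (ℓ i) * σ f - X i * g ∈ maxIdeal K ^ (n + 1 + 1) := by
      intro i f g hf hfg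
      have e : σ (ℓ i) * σ f - X i * g = (σ (ℓ i) - X i) * σ f + X i * (σ f - g) := by ring
      rw [e]
      refine add_mem ?_ ?_
      · have := Ideal.mul_mem_mul (hℓ' i) (map_mem_maxIdeal_pow hσ hf)
        rwa [← pow_add, add_comm 2 n] at this
      · rw [pow_succ']
        exact Ideal.mul_mem_mul (X_mem_maxIdeal i) hfg
    refine ⟨ℓ 0 * f₀ + ℓ 1 * f₁, ?_, ?_⟩
    · rw [pow_succ']
      exact add_mem (Ideal.mul_mem_mul (hℓ 0) hf₀) (Ideal.mul_mem_mul (hℓ 1) hf₁)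
    · have e : σ (ℓ 0 * f₀ + ℓ 1 * f₁) - (X 0 * g₀ + X 1 * g₁) =
        (σ (ℓ 0) * σ f₀ - X 0 * g₀) + (σ (ℓ 1) * σ f₁ - X 1 * g₁) := by
        rw [map_add, map_mul, map_mul]; ring
      rw [e]
      exact add_mem (key 0 hf₀ hf₀') (key 1 hf₁ hf₁')

/-- Successive approximation: each remainder is corrected one order higher, and the corrections sum
up by completeness. -/
theorem surjective_of_cotangent {σ : PS K →ₐ[K] PS K} (hσ : ∀ i, σ (X i) ∈ maxIdeal K)
    (h : ∀ i, ∃ f ∈ maxIdeal K, σ f - X i ∈ maxIdeal K ^ 2) : Function.Surjective σ := by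
  intro g
  choose φ hφ hφ' using fun (n : ℕ) (g : PS K) (hg : g ∈ maxIdeal K ^ n) =>
    exists_sub_mem_maxIdeal_pow_succ h hσ hg
  -- `r n` is what remains of `g` after `n` corrections, and `f n` is the next correction.
  let r : (n : ℕ) → {g : PS K // g ∈ maxIdeal K ^ n} := fun n =>
    Nat.rec ⟨g, by simp⟩ (fun n g => ⟨g.1 - σ (φ n g.1 g.2), by
      have := neg_mem (hφ' n g.1 g.2); rwa [neg_sub] at this⟩) n
  let f : ℕ → PS K := fun n => φ n (r n).1 (r n).2
  have hf : ∀ n, f n ∈ maxIdeal K ^ n := fun n => hφ _ _ _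
  have hr : ∀ n, σ (∑ k ∈ Finset.range n, f k) - g = - (r n).1 := by
    intro n
    induction n with
    | zero => rw [Finset.sum_range_zero, map_zero, zero_sub]; rfl
    | succ n ih =>
      rw [Finset.sum_range_succ, map_add, add_sub_right_comm, ih]
      change _ = -((r n).1 - σ (f n))
      ring
  -- Since `f k` has order at least `k`, only the corrections with `k ≤ e.degree` reach the
  -- coefficient at `e`.
  refine ⟨ofCoeff fun e => ∑ k ∈ Finset.range (e.degree + 1), coeff e (f k),
    eq_of_sub_mem_maxIdeal_pow fun n => ?_⟩
  set F : PS K := ofCoeff fun e => ∑ k ∈ Finset.range (e.degree + 1), coeff e (f k)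
  have hF : F - ∑ k ∈ Finset.range n, f k ∈ maxIdeal K ^ n := by
    rw [mem_maxIdeal_pow]
    intro e he
    rw [map_sub, map_sum, coeff_ofCoeff, sub_eq_zero]
    refine Finset.sum_subset (Finset.range_subset_range.2 (by omega)) fun k _ hk => ?_
    exact mem_maxIdeal_pow.1 (hf k) e (by simpa using hk)
  have e : σ F - g = σ (F - ∑ k ∈ Finset.range n, f k)
      + (σ (∑ k ∈ Finset.range n, f k) - g) := by rw [map_sub]; ring
  rw [e, hr]
  exact add_mem (map_mem_maxIdeal_pow hσ hF) (neg_mem (r n).2)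

/-- The kernels of the iterates stabilise. Writing a kernel element as $\sigma^n y$ puts $y$ in
$\ker\sigma^{n+1}=\ker\sigma^n$, so the element is zero. -/
theorem injective_of_surjective_of_noetherian {R : Type*} [CommRing R] [IsNoetherianRing R]
    (σ : R →+* R) (hσ : Function.Surjective σ) : Function.Injective σ := by
  rw [injective_iff_map_eq_zero]
  intro x hx
  let s : ℕ →o Ideal R := ⟨fun n => RingHom.ker (σ ^ n), monotone_nat_of_le_succ fun n y hy => by
    rw [RingHom.mem_ker] at hy ⊢
    rw [pow_succ', RingHom.mul_def, RingHom.comp_apply, hy, map_zero]⟩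
  obtain ⟨n, hn⟩ := monotone_stabilizes_iff_noetherian.2 ‹IsNoetherianRing R› s
  have hsurj : Function.Surjective (σ ^ n) := by
    rw [RingHom.coe_pow]; exact hσ.iterate n
  obtain ⟨y, rfl⟩ := hsurj x
  have hy : y ∈ s (n + 1) := by
    change y ∈ RingHom.ker (σ ^ (n + 1))
    rw [RingHom.mem_ker, pow_succ', RingHom.mul_def, RingHom.comp_apply, hx]
  rw [← hn (n + 1) (by omega)] at hy
  exact hy

/-- The iterated preimages of `J` form an ascending chain, which stabilises; cancelling the
injective operation of taking preimages gives $J=\tau^{-1}J$. One inclusion thus suffices to show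
that an automorphism fixes an ideal. -/
theorem map_eq_of_map_le {R A : Type*} [CommSemiring R] [CommRing A] [Algebra R A]
    [IsNoetherianRing A] (τ : A ≃ₐ[R] A) {J : Ideal A} (h : J.map τ ≤ J) : J.map τ = J := by
  refine le_antisymm h ?_
  let s : ℕ → Ideal A := fun n => (Ideal.comap τ)^[n] J
  have hs : ∀ n, s (n + 1) = Ideal.comap τ (s n) := fun n => Function.iterate_succ_apply' _ _ _
  have hmono : Monotone s := monotone_nat_of_le_succ fun n => by
    induction n with
    | zero => exact Ideal.map_le_iff_le_comap.1 h
    | succ n ih => rw [hs (n + 1), hs n]; exact Ideal.comap_mono (by rwa [hs n] at ih)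
  obtain ⟨n, hn⟩ := monotone_stabilizes_iff_noetherian.2 ‹IsNoetherianRing A› ⟨s, hmono⟩
  have hinj : Function.Injective (Ideal.comap τ) :=
    Ideal.comap_injective_of_surjective τ τ.surjective
  have hn1 : s n = s (n + 1) := hn (n + 1) (by omega)
  have : J = Ideal.comap τ J := by
    apply hinj.iterate n
    rw [← Function.iterate_succ_apply]
    exact hn1
  intro x hx
  obtain ⟨y, rfl⟩ := τ.surjective x
  refine Ideal.mem_map_of_mem τ ?_
  rw [this]
  exact hx

theorem maxIdeal_eq : maxIdeal K = IsLocalRing.maximalIdeal (PS K) := by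
  ext f
  rw [mem_maxIdeal, IsLocalRing.mem_maximalIdeal, mem_nonunits_iff, isUnit_iff_constantCoeff,
    isUnit_iff_ne_zero, not_not]
  rfl

theorem algEquiv_map_mem (σ : PS K ≃ₐ[K] PS K) {f : PS K} (hf : f ∈ maxIdeal K) :
    σ f ∈ maxIdeal K := by
  rw [maxIdeal_eq, IsLocalRing.mem_maximalIdeal, mem_nonunits_iff] at *
  exact fun h => hf ((MulEquiv.isUnit_map σ).1 h)

theorem algEquiv_map_mem_pow (σ : PS K ≃ₐ[K] PS K) {n : ℕ} {f : PS K}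
    (hf : f ∈ maxIdeal K ^ n) : σ f ∈ maxIdeal K ^ n :=
  map_mem_maxIdeal_pow (σ := (σ : PS K →ₐ[K] PS K))
    (fun i => algEquiv_map_mem σ (X_mem_maxIdeal i)) hf

theorem algEquiv_map_maxIdeal_pow (σ : PS K ≃ₐ[K] PS K) (n : ℕ) :
    (maxIdeal K ^ n).map σ = maxIdeal K ^ n := by
  refine map_eq_of_map_le σ (Ideal.map_le_iff_le_comap.2 fun f hf => algEquiv_map_mem_pow σ hf)

/-! ### The automorphisms `g(a, b)` and `h(a, b)` -/

theorem Kind.aut_mon (c : Kind) (a b : K) (e : Fin 2 →₀ ℕ) :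
    c.aut a b (mon K e) =
      ((c.images a b 0 ^ e 0 * c.images a b 1 ^ e 1 : MvPolynomial (Fin 2) K) : PS K) := by
  rw [mon_eq, map_mul, map_pow, map_pow, Kind.aut, substAlgHom_X, substAlgHom_X]
  push_cast
  rfl

theorem Kind.aut_g_X0 (a b : K) : Kind.g.aut a b (X 0) = X 0 + C a * X 1 ^ 2 + C b * X 1 ^ 3 := by
  rw [Kind.aut, substAlgHom_X]; simp [Kind.images]

theorem Kind.aut_g_X1 (a b : K) : Kind.g.aut a b (X 1) = X 1 := by
  rw [Kind.aut, substAlgHom_X]; simp [Kind.images]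

theorem Kind.aut_h_X0 (a b : K) : Kind.h.aut a b (X 0) = X 0 + C a * X 1 ^ 2 := by
  rw [Kind.aut, substAlgHom_X]; simp [Kind.images]

theorem Kind.aut_h_X1 (a b : K) : Kind.h.aut a b (X 1) = X 1 + C b * X 0 := by
  rw [Kind.aut, substAlgHom_X]; simp [Kind.images]

theorem Kind.aut_X_mem (c : Kind) (a b : K) (i : Fin 2) : c.aut a b (X i) ∈ maxIdeal K := by
  rw [mem_maxIdeal]
  cases c <;> fin_cases i <;>
    simp [Kind.aut_g_X0, Kind.aut_g_X1, Kind.aut_h_X0, Kind.aut_h_X1]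

theorem C_mul_mem {J : Ideal (PS K)} (a : K) {f : PS K} (h : f ∈ J) : C a * f ∈ J :=
  J.mul_mem_left _ h

theorem X_pow_mem_maxIdeal_pow {n k : ℕ} (h : n ≤ k) (i : Fin 2) :
    (X i : PS K) ^ k ∈ maxIdeal K ^ n :=
  Ideal.pow_le_pow_right h (Ideal.pow_mem_pow (X_mem_maxIdeal i) k)

theorem Kind.aut_bijective (c : Kind) (a b : K) : Function.Bijective (c.aut a b) := by
  have hs : Function.Surjective (c.aut a b) := by
    refine surjective_of_cotangent (c.aut_X_mem a b) fun i => ?_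
    cases c
    · refine ⟨X i, X_mem_maxIdeal i, ?_⟩
      fin_cases i
      · have e : (X 0 + C a * X 1 ^ 2 + C b * X 1 ^ 3 : PS K) - X 0
          = C a * X 1 ^ 2 + C b * X 1 ^ 3 := by ring
        change Kind.g.aut a b (X 0) - X 0 ∈ _
        rw [Kind.aut_g_X0, e]
        exact add_mem (C_mul_mem _ (X_pow_mem_maxIdeal_pow le_rfl 1))
          (C_mul_mem _ (X_pow_mem_maxIdeal_pow (by norm_num) 1))
      · change Kind.g.aut a b (X 1) - X 1 ∈ _
        rw [Kind.aut_g_X1, sub_self]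
        exact zero_mem _
    · fin_cases i
      · refine ⟨X 0, X_mem_maxIdeal 0, ?_⟩
        have e : (X 0 + C a * X 1 ^ 2 : PS K) - X 0 = C a * X 1 ^ 2 := by ring
        change Kind.h.aut a b (X 0) - X 0 ∈ _
        rw [Kind.aut_h_X0, e]
        exact C_mul_mem _ (X_pow_mem_maxIdeal_pow le_rfl 1)
      -- The linear part of $h$ is $x\mapsto x$, $y\mapsto y+bx$, which sends $y-bx$ to $y$.
      · refine ⟨X 1 - b • X 0, sub_mem (X_mem_maxIdeal 1)
          (smul_mem_ideal _ (X_mem_maxIdeal 0)), ?_⟩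
        change Kind.h.aut a b (X 1 - b • X 0) - X 1 ∈ _
        have e : (X 1 + C b * X 0 - C b * (X 0 + C a * X 1 ^ 2) : PS K) - X 1
          = C (-b) * (C a * X 1 ^ 2) := by rw [map_neg]; ring
        rw [map_sub, map_smul, Kind.aut_h_X0, Kind.aut_h_X1, smul_eq_C_mul, e]
        exact C_mul_mem _ (C_mul_mem _ (X_pow_mem_maxIdeal_pow le_rfl 1))
  exact ⟨injective_of_surjective_of_noetherian (c.aut a b : PS K →+* PS K) hs, hs⟩

/-- `g(a, b)`, respectively `h(a, b)`, as an automorphism. -/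
def Kind.equiv (c : Kind) (a b : K) : PS K ≃ₐ[K] PS K :=
  AlgEquiv.ofBijective (c.aut a b) (c.aut_bijective a b)

theorem Kind.equiv_apply (c : Kind) (a b : K) (f : PS K) : c.equiv a b f = c.aut a b f := rfl

theorem Kind.map_equiv (c : Kind) (a b : K) (J : Ideal (PS K)) :
    J.map (c.equiv a b) = J.map (c.aut a b) := rfl

end

section

open MvPowerSeries

variable {K : Type*} [Field K]

/-! ### The orbit of a monomial ideal -/

/-- The exponent vector `(p, q)`. -/
def bi (p q : ℕ) : Fin 2 →₀ ℕ := Finsupp.single 0 p + Finsupp.single 1 q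

@[simp] theorem bi_zero (p q : ℕ) : bi p q 0 = p := by simp [bi]

@[simp] theorem bi_one (p q : ℕ) : bi p q 1 = q := by simp [bi]

theorem eq_bi (e : Fin 2 →₀ ℕ) : e = bi (e 0) (e 1) := by
  ext i; fin_cases i <;> simp

theorem bi_inj {p q p' q' : ℕ} : bi p q = bi p' q' ↔ p = p' ∧ q = q' :=
  ⟨fun h => ⟨by simpa using DFunLike.congr_fun h 0, by simpa using DFunLike.congr_fun h 1⟩,
    fun h => by rw [h.1, h.2]⟩

theorem bi_le {p q : ℕ} {e : Fin 2 →₀ ℕ} : bi p q ≤ e ↔ p ≤ e 0 ∧ q ≤ e 1 := by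
  rw [Finsupp.le_def, Fin.forall_fin_two, bi_zero, bi_one]

theorem mon_bi (p q : ℕ) : mon K (bi p q) = X 0 ^ p * X 1 ^ q := by
  rw [mon_eq, bi_zero, bi_one]

theorem coeff_mon_bi (p q p' q' : ℕ) :
    coeff (bi p q) (mon K (bi p' q')) = if p = p' ∧ q = q' then 1 else 0 := by
  classical
  rw [coeff_mon, if_congr bi_inj rfl rfl]

theorem powIdeal_eq_span (p q : ℕ) : powIdeal K p q = Ideal.span (mon K '' {bi p 0, bi 0 q}) := by
  rw [Set.image_pair, mon_bi, mon_bi, pow_zero, pow_zero, mul_one, one_mul, powIdeal]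

theorem coeff_eq_zero_of_mem_powIdeal {p q : ℕ} {f : PS K} (hf : f ∈ powIdeal K p q)
    {e : Fin 2 →₀ ℕ} (h0 : e 0 < p) (h1 : e 1 < q) : coeff e f = 0 := by
  by_contra h
  rw [powIdeal_eq_span] at hf
  obtain ⟨d, (rfl | rfl), hle⟩ := exists_le_of_mem_span hf h <;> rw [bi_le] at hle <;> omega

theorem maxIdeal_pow_le_powIdeal {p q n : ℕ} (h : p + q ≤ n + 1) :
    maxIdeal K ^ n ≤ powIdeal K p q := by
  refine maxIdeal_pow_le_of_mon_mem fun e he => ?_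
  rw [degree_fin_two] at he
  rw [powIdeal_eq_span]
  by_cases hp : p ≤ e 0
  · exact mon_mem_of_le (d := bi p 0) (bi_le.2 ⟨hp, Nat.zero_le _⟩)
      (Ideal.subset_span ⟨_, by simp, rfl⟩)
  · exact mon_mem_of_le (d := bi 0 q) (bi_le.2 ⟨Nat.zero_le _, by omega⟩)
      (Ideal.subset_span ⟨_, by simp, rfl⟩)

theorem X_not_mem_maxIdeal_sq (i : Fin 2) : (X i : PS K) ∉ maxIdeal K ^ 2 := by
  classical
  intro h
  have := mem_maxIdeal_pow.1 h (Finsupp.single i 1) (by simp)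
  rw [coeff_index_single_X, if_pos rfl] at this
  exact one_ne_zero this

theorem algEquiv_mem_of_map_mem (σ : PS K ≃ₐ[K] PS K) {J : Ideal (PS K)} {f : PS K}
    (h : σ f ∈ J.map σ) : f ∈ J := by
  obtain ⟨g, hg, hgf⟩ := (Ideal.mem_map_iff_of_surjective σ σ.surjective).1 h
  rwa [← σ.injective hgf]

theorem eq_bi_zero {e : Fin 2 →₀ ℕ} (h0 : e 0 = 0) (h1 : e 1 = 0) : e = 0 := by
  ext i; fin_cases i <;> simpa

section Coset

variable {σ : PS K ≃ₐ[K] PS K} (hσ : (powIdeal K 1 2).map σ = powIdeal K 1 2)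

include hσ

theorem coeff_map_X0_y : coeff (bi 0 1) (σ (X 0)) = 0 := by
  refine coeff_eq_zero_of_mem_powIdeal (p := 1) (q := 2) ?_ (by simp) (by simp)
  rw [← hσ]
  exact Ideal.mem_map_of_mem σ (Ideal.subset_span (by simp))

/-- Otherwise $\sigma(x)$ would have no linear term, and $x$ itself would lie in $\mathfrak m^2$. -/
theorem coeff_map_X0_x_ne : coeff (bi 1 0) (σ (X 0)) ≠ 0 := by
  intro h
  refine X_not_mem_maxIdeal_sq (K := K) 0 (algEquiv_mem_of_map_mem σ ?_)
  rw [algEquiv_map_maxIdeal_pow, mem_maxIdeal_pow]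
  intro e he
  rw [degree_fin_two] at he
  have h0 := mem_maxIdeal.1 (algEquiv_map_mem σ (X_mem_maxIdeal 0))
  rcases (by omega : (e 0 = 0 ∧ e 1 = 0) ∨ (e 0 = 0 ∧ e 1 = 1) ∨ (e 0 = 1 ∧ e 1 = 0))
    with ⟨h1, h2⟩ | ⟨h1, h2⟩ | ⟨h1, h2⟩
  · rwa [eq_bi_zero h1 h2]
  · rw [eq_bi e, h1, h2]; exact coeff_map_X0_y hσ
  · rwa [eq_bi e, h1, h2]

/-- Otherwise $\sigma(y)$ would lie in the fixed ideal $(x,y^2)$, and so would $y$. -/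
theorem coeff_map_X1_y_ne : coeff (bi 0 1) (σ (X 1)) ≠ 0 := by
  intro h
  have hX : (X 1 : PS K) ∈ powIdeal K 1 2 := by
    refine algEquiv_mem_of_map_mem σ ?_
    rw [hσ]
    refine mem_of_forall_mon_mem (maxIdeal_pow_le_powIdeal (n := 2) (by decide)) fun e he hne => ?_
    rw [degree_fin_two] at he
    have h0 := mem_maxIdeal.1 (algEquiv_map_mem σ (X_mem_maxIdeal 1))
    rcases (by omega : (e 0 = 0 ∧ e 1 = 0) ∨ (e 0 = 0 ∧ e 1 = 1) ∨ (e 0 = 1 ∧ e 1 = 0))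
      with ⟨h1, h2⟩ | ⟨h1, h2⟩ | ⟨h1, h2⟩
    · rw [eq_bi_zero h1 h2] at hne; exact absurd h0 hne
    · rw [eq_bi e, h1, h2] at hne; exact absurd h hne
    · rw [eq_bi e, h1, h2, powIdeal_eq_span]
      exact Ideal.subset_span ⟨_, by simp, rfl⟩
  have := coeff_eq_zero_of_mem_powIdeal hX (e := bi 0 1) (by simp) (by simp)
  rw [show (X 1 : PS K) = mon K (bi 0 1) by rw [mon_bi]; ring, coeff_mon_bi] at this
  simp at this

/-- The image of $(x,y^4)$ contains $xy^2$, $x^2$ and $\mathfrak m^4$, so only the coefficients of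
$x,xy,y^2,y^3$ of $f=\sigma(x)$ matter. With $c_{10},c_{11}$ the coefficients of $x$ and $xy$, the
parameters are solved from $f\equiv(c_{10}+c_{11}y)(x+ay^2+by^3)$. -/
theorem map_X0_mem_g : ∃ a b : K,
    σ (X 0) ∈ (powIdeal K 1 4).map (Kind.g.equiv a b) := by
  set f := σ (X 0) with hf
  have hx := coeff_map_X0_x_ne hσ
  have hy := coeff_map_X0_y hσ
  have h0 := mem_maxIdeal.1 (algEquiv_map_mem σ (X_mem_maxIdeal 0))
  rw [← hf] at hx hy h0
  set a := coeff (bi 0 2) f / coeff (bi 1 0) f with ha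
  set b := (coeff (bi 0 3) f - coeff (bi 1 1) f * a) / coeff (bi 1 0) f with hb
  refine ⟨a, b, ?_⟩
  set J := (powIdeal K 1 4).map (Kind.g.equiv a b) with hJ
  have hle : maxIdeal K ^ 4 ≤ J := by
    rw [← algEquiv_map_maxIdeal_pow (Kind.g.equiv a b) 4]
    exact Ideal.map_mono (maxIdeal_pow_le_powIdeal (by decide))
  have hu : (X 0 + C a * X 1 ^ 2 + C b * X 1 ^ 3 : PS K) ∈ J := by
    rw [← Kind.aut_g_X0, ← Kind.equiv_apply]
    exact Ideal.mem_map_of_mem _ (Ideal.subset_span (by simp))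
  have hy4 : (X 1 : PS K) ^ 4 ∈ J := hle (X_pow_mem_maxIdeal_pow le_rfl 1)
  have hxy : mon K (bi 1 2) ∈ J := by
    rw [mon_bi, show (X 0 ^ 1 * X 1 ^ 2 : PS K) = X 1 ^ 2 * (X 0 + C a * X 1 ^ 2 + C b * X 1 ^ 3)
      - (C a + C b * X 1) * X 1 ^ 4 by ring]
    exact sub_mem (J.mul_mem_left _ hu) (J.mul_mem_left _ hy4)
  have hx2 : mon K (bi 2 0) ∈ J := by
    rw [mon_bi, show (X 0 ^ 2 * X 1 ^ 0 : PS K) = X 0 * (X 0 + C a * X 1 ^ 2 + C b * X 1 ^ 3)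
      - (C a + C b * X 1) * (X 0 ^ 1 * X 1 ^ 2) by ring, ← mon_bi]
    exact sub_mem (J.mul_mem_left _ hu) (J.mul_mem_left _ hxy)
  rw [← sub_add_cancel f ((C (coeff (bi 1 0) f) + C (coeff (bi 1 1) f) * X 1) *
    (X 0 + C a * X 1 ^ 2 + C b * X 1 ^ 3))]
  refine add_mem (mem_of_forall_mon_mem hle fun e he hne => ?_) (J.mul_mem_left _ hu)
  have hexp : (C (coeff (bi 1 0) f) + C (coeff (bi 1 1) f) * X 1) *
      (X 0 + C a * X 1 ^ 2 + C b * X 1 ^ 3) =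
      C (coeff (bi 1 0) f) * mon K (bi 1 0) + C (coeff (bi 1 1) f) * mon K (bi 1 1)
      + C (coeff (bi 1 0) f * a) * mon K (bi 0 2)
      + C (coeff (bi 1 0) f * b + coeff (bi 1 1) f * a) * mon K (bi 0 3)
      + C (coeff (bi 1 1) f * b) * mon K (bi 0 4) := by
    simp only [mon_bi, map_add, map_mul]; ring
  have e1 : coeff (bi 1 0) f * a = coeff (bi 0 2) f := by rw [ha]; field_simp
  have e2 : coeff (bi 1 0) f * b + coeff (bi 1 1) f * a = coeff (bi 0 3) f := by
    rw [hb]; field_simp; ring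
  rw [hexp, e1, e2] at hne
  by_cases h2 : 2 ≤ e 0
  · exact mon_mem_of_le (bi_le.2 ⟨h2, Nat.zero_le _⟩) hx2
  rw [degree_fin_two] at he
  have h00 : coeff (bi 0 0) f = 0 := by rwa [eq_bi_zero (e := bi 0 0) (by simp) (by simp)]
  by_cases h12 : e 0 = 1 ∧ 2 ≤ e 1
  · exact mon_mem_of_le (bi_le.2 ⟨h12.1.ge, h12.2⟩) hxy
  exfalso
  apply hne
  rcases (by omega : (e 0 = 0 ∧ e 1 = 0) ∨ (e 0 = 0 ∧ e 1 = 1) ∨ (e 0 = 0 ∧ e 1 = 2) ∨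
    (e 0 = 0 ∧ e 1 = 3) ∨ (e 0 = 1 ∧ e 1 = 0) ∨ (e 0 = 1 ∧ e 1 = 1))
    with ⟨h1, h2⟩ | ⟨h1, h2⟩ | ⟨h1, h2⟩ | ⟨h1, h2⟩ | ⟨h1, h2⟩ | ⟨h1, h2⟩ <;>
  · rw [eq_bi e, h1, h2]
    simp only [map_sub, map_add, coeff_C_mul, coeff_mon_bi]
    simp [h00, hy]

/-- Here the image of $(x,y^3)$ contains $xy$, $x^2$ and $\mathfrak m^3$, and comparing $\sigma(x)$
with a multiple of $x+ay^2$ fixes $a$. The choice does not involve `b`, so it can be combined with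
the independent choice of `b` made from $\sigma(y)$. -/
theorem map_X0_mem_h : ∃ a : K, ∀ b : K,
    σ (X 0) ∈ (powIdeal K 1 3).map (Kind.h.equiv a b) := by
  set f := σ (X 0) with hf
  have hx := coeff_map_X0_x_ne hσ
  have hy := coeff_map_X0_y hσ
  have h0 := mem_maxIdeal.1 (algEquiv_map_mem σ (X_mem_maxIdeal 0))
  rw [← hf] at hx hy h0
  set a := coeff (bi 0 2) f / coeff (bi 1 0) f with ha
  refine ⟨a, fun b => ?_⟩
  set J := (powIdeal K 1 3).map (Kind.h.equiv a b) with hJ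
  have hle : maxIdeal K ^ 3 ≤ J := by
    rw [← algEquiv_map_maxIdeal_pow (Kind.h.equiv a b) 3]
    exact Ideal.map_mono (maxIdeal_pow_le_powIdeal (by decide))
  have hu : (X 0 + C a * X 1 ^ 2 : PS K) ∈ J := by
    rw [← Kind.aut_h_X0 a b, ← Kind.equiv_apply]
    exact Ideal.mem_map_of_mem _ (Ideal.subset_span (by simp))
  have hy3 : (X 1 : PS K) ^ 3 ∈ J := hle (X_pow_mem_maxIdeal_pow le_rfl 1)
  have hxy : mon K (bi 1 1) ∈ J := by
    rw [mon_bi, show (X 0 ^ 1 * X 1 ^ 1 : PS K) = X 1 * (X 0 + C a * X 1 ^ 2)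
      - C a * X 1 ^ 3 by ring]
    exact sub_mem (J.mul_mem_left _ hu) (J.mul_mem_left _ hy3)
  have hx2 : mon K (bi 2 0) ∈ J := by
    rw [mon_bi, show (X 0 ^ 2 * X 1 ^ 0 : PS K) = X 0 * (X 0 + C a * X 1 ^ 2)
      - (C a * X 1) * (X 0 ^ 1 * X 1 ^ 1) by ring, ← mon_bi]
    exact sub_mem (J.mul_mem_left _ hu) (J.mul_mem_left _ hxy)
  rw [← sub_add_cancel f (C (coeff (bi 1 0) f) * (X 0 + C a * X 1 ^ 2))]
  refine add_mem (mem_of_forall_mon_mem hle fun e he hne => ?_) (J.mul_mem_left _ hu)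
  have hexp : C (coeff (bi 1 0) f) * (X 0 + C a * X 1 ^ 2) =
      C (coeff (bi 1 0) f) * mon K (bi 1 0) + C (coeff (bi 1 0) f * a) * mon K (bi 0 2) := by
    simp only [mon_bi, map_mul]; ring
  have e1 : coeff (bi 1 0) f * a = coeff (bi 0 2) f := by rw [ha]; field_simp
  rw [hexp, e1] at hne
  by_cases h2 : 2 ≤ e 0
  · exact mon_mem_of_le (bi_le.2 ⟨h2, Nat.zero_le _⟩) hx2
  rw [degree_fin_two] at he
  have h00 : coeff (bi 0 0) f = 0 := by rwa [eq_bi_zero (e := bi 0 0) (by simp) (by simp)]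
  by_cases h12 : e 0 = 1 ∧ 1 ≤ e 1
  · exact mon_mem_of_le (bi_le.2 ⟨h12.1.ge, h12.2⟩) hxy
  exfalso
  apply hne
  rcases (by omega : (e 0 = 0 ∧ e 1 = 0) ∨ (e 0 = 0 ∧ e 1 = 1) ∨ (e 0 = 0 ∧ e 1 = 2) ∨
    (e 0 = 1 ∧ e 1 = 0)) with ⟨h1, h2⟩ | ⟨h1, h2⟩ | ⟨h1, h2⟩ | ⟨h1, h2⟩ <;>
  · rw [eq_bi e, h1, h2]
    simp only [map_sub, map_add, coeff_C_mul, coeff_mon_bi]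
    simp [h00, hy]

theorem map_X1_mem_h : ∃ b : K, ∀ a : K,
    σ (X 1) ∈ (powIdeal K 2 1).map (Kind.h.equiv a b) := by
  set f := σ (X 1) with hf
  have hy := coeff_map_X1_y_ne hσ
  have h0 := mem_maxIdeal.1 (algEquiv_map_mem σ (X_mem_maxIdeal 1))
  rw [← hf] at hy h0
  set b := coeff (bi 1 0) f / coeff (bi 0 1) f with hb
  refine ⟨b, fun a => ?_⟩
  set J := (powIdeal K 2 1).map (Kind.h.equiv a b) with hJ
  have hle : maxIdeal K ^ 2 ≤ J := by
    rw [← algEquiv_map_maxIdeal_pow (Kind.h.equiv a b) 2]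
    exact Ideal.map_mono (maxIdeal_pow_le_powIdeal (by decide))
  have hu : (X 1 + C b * X 0 : PS K) ∈ J := by
    rw [← Kind.aut_h_X1 a b, ← Kind.equiv_apply]
    exact Ideal.mem_map_of_mem _ (Ideal.subset_span (by simp))
  rw [← sub_add_cancel f (C (coeff (bi 0 1) f) * (X 1 + C b * X 0))]
  refine add_mem (mem_of_forall_mon_mem hle fun e he hne => ?_) (J.mul_mem_left _ hu)
  have hexp : C (coeff (bi 0 1) f) * (X 1 + C b * X 0) =
      C (coeff (bi 0 1) f) * mon K (bi 0 1) + C (coeff (bi 0 1) f * b) * mon K (bi 1 0) := by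
    simp only [mon_bi, map_mul]; ring
  have e1 : coeff (bi 0 1) f * b = coeff (bi 1 0) f := by rw [hb]; field_simp
  rw [hexp, e1] at hne
  rw [degree_fin_two] at he
  have h00 : coeff (bi 0 0) f = 0 := by rwa [eq_bi_zero (e := bi 0 0) (by simp) (by simp)]
  exfalso
  apply hne
  rcases (by omega : (e 0 = 0 ∧ e 1 = 0) ∨ (e 0 = 0 ∧ e 1 = 1) ∨ (e 0 = 1 ∧ e 1 = 0))
    with ⟨h1, h2⟩ | ⟨h1, h2⟩ | ⟨h1, h2⟩ <;>
  · rw [eq_bi e, h1, h2]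
    simp only [map_sub, map_add, coeff_C_mul, coeff_mon_bi]
    simp [h00]

end Coset

theorem algEquiv_pow_mem (σ : PS K ≃ₐ[K] PS K) (τ : PS K ≃ₐ[K] PS K) {J : Ideal (PS K)} {n : ℕ}
    (hJ : maxIdeal K ^ n ≤ J) (i : Fin 2) : σ (X i ^ n) ∈ J.map τ := by
  have : (maxIdeal K ^ n).map τ ≤ J.map τ := Ideal.map_mono hJ
  rw [algEquiv_map_maxIdeal_pow] at this
  exact this (algEquiv_map_mem_pow σ (X_pow_mem_maxIdeal_pow le_rfl i))

theorem map_powIdeal_le {σ : PS K ≃ₐ[K] PS K} {p q : ℕ} {J : Ideal (PS K)}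
    (h0 : σ (X 0 ^ p) ∈ J) (h1 : σ (X 1 ^ q) ∈ J) : (powIdeal K p q).map σ ≤ J := by
  rw [powIdeal, Ideal.map_span, Ideal.span_le]
  rintro _ ⟨_, (rfl | rfl), rfl⟩
  exacts [h0, h1]

theorem map_trans_symm_eq {σ τ : PS K ≃ₐ[K] PS K} {J : Ideal (PS K)} (h : J.map σ ≤ J.map τ) :
    J.map (σ.trans τ.symm) = J := by
  refine map_eq_of_map_le _ (Ideal.map_le_iff_le_comap.2 fun f hf => ?_)
  rw [Ideal.mem_comap]
  apply algEquiv_mem_of_map_mem τ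
  change τ (τ.symm (σ f)) ∈ _
  rw [AlgEquiv.apply_symm_apply]
  exact h (Ideal.mem_map_of_mem σ hf)

theorem map_map_trans_symm (σ τ : PS K ≃ₐ[K] PS K) (J : Ideal (PS K)) :
    (J.map (σ.trans τ.symm)).map τ = J.map σ := by
  have hτ : ∀ f, τ ((σ.trans τ.symm) f) = σ f := fun f => τ.apply_symm_apply _
  apply le_antisymm <;> rw [Ideal.map_le_iff_le_comap]
  · rw [Ideal.map_le_iff_le_comap]
    intro f hf
    rw [Ideal.mem_comap, Ideal.mem_comap, hτ]
    exact Ideal.mem_map_of_mem σ hf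
  · intro f hf
    rw [Ideal.mem_comap, ← hτ]
    exact Ideal.mem_map_of_mem τ (Ideal.mem_map_of_mem _ hf)

/-- Choose $\tau=g(a,b)$ or $h(a,b)$ so that $\sigma$ and $\tau$ have the same effect on both ideals
of the measuring sequence. Then $\tau^{-1}\sigma$ fixes these two ideals, hence `I`. -/
theorem exists_map_eq_aut {c : Kind} {I : Ideal (PS K)} (hI : HasMeasuringSequence I c.fst c.snd)
    {σ : PS K ≃ₐ[K] PS K} (hσ : (powIdeal K 1 2).map σ = powIdeal K 1 2) :
    ∃ a b : K, I.map σ = I.map (c.aut a b) := by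
  obtain ⟨a, b, h1, h2⟩ : ∃ a b : K,
      (powIdeal K 1 c.fst).map σ ≤ (powIdeal K 1 c.fst).map (c.equiv a b) ∧
      (powIdeal K c.snd 1).map σ ≤ (powIdeal K c.snd 1).map (c.equiv a b) := by
    cases c
    · obtain ⟨a, b, h⟩ := map_X0_mem_g hσ
      refine ⟨a, b, map_powIdeal_le (by rwa [pow_one])
        (algEquiv_pow_mem _ _ (maxIdeal_pow_le_powIdeal (by decide)) _), map_powIdeal_le ?_ ?_⟩ <;>
      exact algEquiv_pow_mem _ _ (n := 1) (maxIdeal_pow_le_powIdeal (by decide)) _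
    · obtain ⟨a, ha⟩ := map_X0_mem_h hσ
      obtain ⟨b, hb⟩ := map_X1_mem_h hσ
      exact ⟨a, b, map_powIdeal_le (by rw [pow_one]; exact ha b)
        (algEquiv_pow_mem _ _ (maxIdeal_pow_le_powIdeal (by decide)) _), map_powIdeal_le
        (algEquiv_pow_mem _ _ (maxIdeal_pow_le_powIdeal (by decide)) _)
        (by rw [pow_one]; exact hb a)⟩
  refine ⟨a, b, ?_⟩
  have hfix := hI.1.2.2 (σ.trans (c.equiv a b).symm) (map_trans_symm_eq h1) (map_trans_symm_eq h2)
  rw [← Kind.map_equiv]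
  have := congrArg (Ideal.map (c.equiv a b)) hfix
  rw [← this, map_map_trans_symm]

/-- The transforms of `I` by `g(a, b)`, respectively `h(a, b)`, lie in the orbit. -/
theorem map_aut_mem_orbit (c : Kind) (I : Ideal (PS K)) (a b : K) :
    I.map (c.aut a b) ∈ orbit I := by
  refine ⟨c.equiv a b, map_eq_of_map_le _ (map_powIdeal_le ?_ ?_), rfl⟩
  · have hx : (X 0 : PS K) ∈ powIdeal K 1 2 := Ideal.subset_span (by simp)
    have hy : (X 1 : PS K) ^ 2 ∈ powIdeal K 1 2 := Ideal.subset_span (by simp)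
    rw [pow_one, Kind.equiv_apply]
    cases c
    · rw [Kind.aut_g_X0, pow_succ (X 1 : PS K) 2]
      exact add_mem (add_mem hx (C_mul_mem _ hy)) (C_mul_mem _ (Ideal.mul_mem_right _ _ hy))
    · rw [Kind.aut_h_X0]
      exact add_mem hx (C_mul_mem _ hy)
  · exact maxIdeal_pow_le_powIdeal (n := 2) (by decide)
      (algEquiv_map_mem_pow _ (X_pow_mem_maxIdeal_pow le_rfl 1))

/-- Without rows `I` would be a power of $\mathfrak m$, fixed by every automorphism, and its
measuring sequence would be $m(1,1)$. A row is needed to rescale Plücker vectors: an empty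
determinant is always 1. -/
theorem nonempty_row {c : Kind} {I : Ideal (PS K)} (hmon : IsMonomialIdeal I)
    [Module.Finite K (PS K ⧸ I)] (hI : HasMeasuringSequence I c.fst c.snd) : Nonempty (Row I) := by
  by_contra hne
  rw [not_nonempty_iff] at hne
  have hIm : I = maxIdeal K ^ trunc I := by
    refine le_antisymm (fun f hf => mem_maxIdeal_pow.2 fun e he => ?_) (maxIdeal_pow_trunc_le hmon)
    by_contra h0
    exact hne.false ⟨e, he, hmon.mon_mem hf h0⟩
  have h11 := hI.2 (show (1, 1) ∈ {p : ℕ × ℕ | 0 < p.1 ∧ 0 < p.2 ∧ ∀ σ : PS K ≃ₐ[K] PS K,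
    (powIdeal K 1 p.1).map σ = powIdeal K 1 p.1 →
    (powIdeal K p.2 1).map σ = powIdeal K p.2 1 → I.map σ = I} from
    ⟨one_pos, one_pos, fun σ _ _ => by rw [hIm]; exact algEquiv_map_maxIdeal_pow σ _⟩)
  have h1 := h11.1
  cases c <;> simp [Kind.fst] at h1

end

section

open MvPowerSeries

variable {K : Type*} [Field K]

/-! ### Plücker coordinates -/

/-- Row rank equals column rank, so the columns span and some of them form a basis. -/
theorem exists_det_ne_zero {ι κ : Type*} [Fintype ι] [DecidableEq ι] [Finite κ]
    (A : Matrix ι κ K) (hA : LinearIndependent K A.row) :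
    ∃ S : ι → κ, (Matrix.of fun i j => A i (S j)).det ≠ 0 := by
  have := Fintype.ofFinite κ
  have htop : Submodule.span K (Set.range A.col) = ⊤ := by
    apply Submodule.eq_top_of_finrank_eq
    rw [← Matrix.rank_eq_finrank_span_cols, hA.rank_matrix, Module.finrank_fintype_fun_eq_card]
  obtain ⟨κ', a, -, hspan, hli⟩ := exists_linearIndependent' K A.col
  let B : Module.Basis κ' K (ι → K) := Module.Basis.mk hli (by rw [hspan, htop])
  let e := B.indexEquiv (Pi.basisFun K ι)
  refine ⟨a ∘ e.symm, ?_⟩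
  have hu : IsUnit (Matrix.of fun i j => A i ((a ∘ e.symm) j)) := by
    rw [← Matrix.linearIndependent_cols_iff_isUnit]
    exact hli.comp e.symm e.symm.injective
  exact ((Matrix.isUnit_iff_isUnit_det _).1 hu).ne_zero

instance (I : Ideal (PS K)) : Finite (Col I) :=
  Set.Finite.to_subtype ((Finsupp.finite_of_degree_le (σ := Fin 2) (trunc I)).subset
    fun e (he : e.degree < trunc I) => he.le)

/-- The matrix of coefficients of the power series `v i` in the columns `S`. -/
def minor {I : Ideal (PS K)} (v : Row I → PS K) (S : Row I → Col I) : Matrix (Row I) (Row I) K :=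
  Matrix.of fun i j => coeff (S j).1 (v i)

theorem minor_apply {I : Ideal (PS K)} (v : Row I → PS K) (S : Row I → Col I) (i j : Row I) :
    minor v S i j = coeff (S j).1 (v i) := rfl

/-- A basis of `J / (x, y) ^ N` dual to the coordinates `S₀`. -/
structure IsReducedBasis (I J : Ideal (PS K)) (S₀ : Row I → Col I) (v : Row I → PS K) : Prop where
  mem : ∀ i, v i ∈ J
  minor_eq : minor v S₀ = 1
  sub_mem : ∀ f ∈ J, f - ∑ i, coeff (S₀ i).1 f • v i ∈ maxIdeal K ^ trunc I

variable {I J J' : Ideal (PS K)} {S₀ : Row I → Col I} {v : Row I → PS K}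
  {p p' : (Row I → Col I) → K}

theorem coeff_sum_smul {ι : Type*} [Fintype ι] (e : Fin 2 →₀ ℕ) (c : ι → K) (v : ι → PS K) :
    coeff e (∑ i, c i • v i) = ∑ i, c i * coeff e (v i) := by
  rw [map_sum]; rfl

theorem coeff_eq_of_sub_mem {n : ℕ} {f g : PS K} (h : f - g ∈ maxIdeal K ^ n) {e : Fin 2 →₀ ℕ}
    (he : e.degree < n) : coeff e f = coeff e g := by
  have := mem_maxIdeal_pow.1 h e he
  rwa [map_sub, sub_eq_zero] at this

namespace IsReducedBasis

theorem coeff_eq (h : IsReducedBasis I J S₀ v) (i j : Row I) :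
    coeff (S₀ j).1 (v i) = if i = j then 1 else 0 := by
  have := congrFun (congrFun h.minor_eq i) j
  rwa [minor_apply, Matrix.one_apply] at this

theorem isPlucker (h : IsReducedBasis I J S₀ v) (hJ : maxIdeal K ^ trunc I ≤ J) :
    IsPlucker I J fun S => (minor v S).det := by
  refine ⟨hJ, v, h.mem, fun f hf => ⟨_, h.sub_mem f hf, fun c hc => ?_⟩, fun S => rfl⟩
  ext k
  have := coeff_eq_of_sub_mem hc (S₀ k).2
  rw [coeff_sum_smul] at this
  simp only [h.coeff_eq, mul_ite, mul_one, mul_zero, Finset.sum_ite_eq', Finset.mem_univ,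
    if_true] at this
  exact this.symm

theorem coeff_of_mem (h : IsReducedBasis I J S₀ v) {f : PS K} (hf : f ∈ J) {e : Fin 2 →₀ ℕ}
    (he : e.degree < trunc I) : coeff e f = ∑ i, coeff (S₀ i).1 f * coeff e (v i) := by
  rw [coeff_eq_of_sub_mem (h.sub_mem f hf) he, coeff_sum_smul]

/-- The entries of a reduced basis are themselves Plücker coordinates: the minor is the identity
matrix with one column replaced. -/
theorem det_update (h : IsReducedBasis I J S₀ v) (i : Row I) (j : Col I) :
    (minor v (Function.update S₀ i j)).det = coeff j.1 (v i) := by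
  have e : minor v (Function.update S₀ i j) =
      (1 : Matrix (Row I) (Row I) K).updateCol i fun k => coeff j.1 (v k) := by
    rw [← h.minor_eq]
    ext k l
    rw [minor_apply, Matrix.updateCol_apply, Function.update_apply]
    split_ifs <;> rfl
  rw [e, ← Matrix.cramer_apply, Matrix.cramer_one]
  rfl

end IsReducedBasis

/-- Multiply a basis by the inverse of its minor at `S₀`; all minors get divided by `p S₀`. -/
theorem IsPlucker.exists_reduced (h : IsPlucker I J p) (h0 : p S₀ ≠ 0) :
    ∃ v, IsReducedBasis I J S₀ v ∧ ∀ S, p S = p S₀ * (minor v S).det := by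
  obtain ⟨hJ, u, hu, hspan, hp⟩ := h
  have hp' : ∀ S, p S = (minor u S).det := hp
  set A := minor u S₀ with hA
  have hdet : IsUnit A.det := by rw [← hp']; exact isUnit_iff_ne_zero.2 h0
  let v : Row I → PS K := fun i => ∑ k, A⁻¹ i k • u k
  have hv : ∀ S, minor v S = A⁻¹ * minor u S := by
    intro S
    ext i j
    rw [minor_apply, coeff_sum_smul, Matrix.mul_apply]
    rfl
  have hvA : minor v S₀ = 1 := by rw [hv, ← hA, Matrix.nonsing_inv_mul _ hdet]
  refine ⟨v, ⟨fun i => sum_mem fun k _ => smul_mem_ideal _ (hu k), hvA, fun f hf => ?_⟩,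
    fun S => ?_⟩
  · obtain ⟨c, hc, -⟩ := hspan f hf
    have hcoef : (fun i => coeff (S₀ i).1 f) = Matrix.vecMul c A := by
      ext i
      rw [coeff_eq_of_sub_mem hc (S₀ i).2, coeff_sum_smul]
      rfl
    have hsum : ∑ i, coeff (S₀ i).1 f • v i = ∑ i, c i • u i := by
      have : ∀ i, coeff (S₀ i).1 f = Matrix.vecMul c A i := fun i => congrFun hcoef i
      simp_rw [this, v, Finset.smul_sum, smul_smul]
      rw [Finset.sum_comm]
      refine Finset.sum_congr rfl fun k _ => ?_
      rw [← Finset.sum_smul]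
      congr 1
      change (Matrix.vecMul (Matrix.vecMul c A) A⁻¹) k = c k
      rw [Matrix.vecMul_vecMul, Matrix.mul_nonsing_inv _ hdet, Matrix.vecMul_one]
    rwa [hsum]
  · rw [hv, Matrix.det_mul, hp' S, hp' S₀, Matrix.det_nonsing_inv, ← mul_assoc,
      Ring.mul_inverse_cancel _ hdet, one_mul]

theorem IsPlucker.exists_ne_zero (h : IsPlucker I J p) : ∃ S, p S ≠ 0 := by
  obtain ⟨hJ, u, hu, hspan, hp⟩ := h
  obtain ⟨S, hS⟩ := exists_det_ne_zero
    (Matrix.of fun (i : Row I) (j : Col I) => coeff j.1 (u i)) (by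
      rw [Fintype.linearIndependent_iff]
      intro c hc i
      obtain ⟨c₀, -, hc₀⟩ := hspan 0 J.zero_mem
      have h1 : c = c₀ := hc₀ c (by
        change 0 - ∑ i, c i • u i ∈ _
        rw [zero_sub]
        refine neg_mem (mem_maxIdeal_pow.2 fun e he => ?_)
        rw [coeff_sum_smul]
        have := congrFun hc ⟨e, he⟩
        rw [Finset.sum_apply] at this
        exact this)
      have h2 : 0 = c₀ := hc₀ 0 (by simp)
      rw [h1, ← h2]; rfl)
  exact ⟨S, by rw [hp]; exact hS⟩

theorem IsPlucker.coeff_eq_div (hv : IsReducedBasis I J S₀ v)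
    (hp : ∀ S, p S = p S₀ * (minor v S).det) (h0 : p S₀ ≠ 0) (i : Row I) (j : Col I) :
    coeff j.1 (v i) = p (Function.update S₀ i j) / p S₀ := by
  rw [hp (Function.update S₀ i j), hv.det_update, mul_div_cancel_left₀ _ h0]

theorem IsPlucker.le_of_smul (h : IsPlucker I J p) (h' : IsPlucker I J' p')
    {c : K} (hc : c ≠ 0) (hcp : ∀ S, p' S = c * p S) : J ≤ J' := by
  obtain ⟨S₀, h0⟩ := h.exists_ne_zero
  have h0' : p' S₀ ≠ 0 := by rw [hcp]; exact mul_ne_zero hc h0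
  obtain ⟨v, hv, hp⟩ := h.exists_reduced h0
  obtain ⟨v', hv', hp'⟩ := h'.exists_reduced h0'
  have hvv : ∀ i, v i ∈ J' := by
    intro i
    rw [← sub_add_cancel (v i) (v' i)]
    refine add_mem (h'.1 (mem_maxIdeal_pow.2 fun e he => ?_)) (hv'.mem i)
    have e1 := IsPlucker.coeff_eq_div hv hp h0 i ⟨e, he⟩
    have e2 := IsPlucker.coeff_eq_div hv' hp' h0' i ⟨e, he⟩
    rw [hcp, hcp, mul_div_mul_left _ _ hc, ← e1] at e2
    rw [map_sub, sub_eq_zero]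
    exact e2.symm
  intro f hf
  rw [← sub_add_cancel f (∑ i, coeff (S₀ i).1 f • v i)]
  exact add_mem (h'.1 (hv.sub_mem f hf)) (sum_mem fun i _ => smul_mem_ideal _ (hvv i))

/-- The Plücker coordinates determine the ideal. -/
theorem IsPlucker.eq_of_smul (h : IsPlucker I J p) (h' : IsPlucker I J' p')
    {c : K} (hc : c ≠ 0) (hcp : ∀ S, p' S = c * p S) : J = J' :=
  le_antisymm (h.le_of_smul h' hc hcp) (h'.le_of_smul h (inv_ne_zero hc) fun S => by
    rw [hcp, inv_mul_cancel_left₀ hc])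

/-- The Plücker coordinates are unique up to a scalar. -/
theorem IsPlucker.exists_smul (h : IsPlucker I J p) (h' : IsPlucker I J p') :
    ∃ c : K, c ≠ 0 ∧ ∀ S, p' S = c * p S := by
  obtain ⟨S₀, h0⟩ := h.exists_ne_zero
  obtain ⟨S₁, h1⟩ := h'.exists_ne_zero
  obtain ⟨v, hv, hp⟩ := h.exists_reduced h0
  obtain ⟨-, u, hu, -, hp'⟩ := h'
  have hp' : ∀ S, p' S = (minor u S).det := hp'
  have hu' : ∀ S, minor u S = minor u S₀ * minor v S := by
    intro S
    ext i j
    rw [Matrix.mul_apply, minor_apply, hv.coeff_of_mem (hu i) (S j).2]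
    rfl
  have hS : ∀ S, p' S = (minor u S₀).det / p S₀ * p S := by
    intro S
    rw [hp', hu', Matrix.det_mul, hp S]
    field_simp
  refine ⟨_, fun hc => h1 ?_, hS⟩
  rw [hS, hc, zero_mul]

theorem IsPlucker.smul [Nonempty (Row I)] (h : IsPlucker I J p) {c : K} (hc : c ≠ 0) :
    IsPlucker I J fun S => c * p S := by
  obtain ⟨S₀, h0⟩ := h.exists_ne_zero
  obtain ⟨v, hv, hp⟩ := h.exists_reduced h0
  obtain ⟨i₀⟩ := ‹Nonempty (Row I)›
  -- Scaling one basis vector scales every minor once; the factor `p S₀` undoes the normalisation of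
  -- the reduced basis.
  let d : Row I → K := fun i => if i = i₀ then c * p S₀ else 1
  have hd : ∀ i, d i ≠ 0 := by
    intro i; dsimp only [d]; split_ifs
    exacts [mul_ne_zero hc h0, one_ne_zero]
  refine ⟨h.1, fun i => d i • v i, fun i => smul_mem_ideal _ (hv.mem i), fun f hf => ?_,
    fun S => ?_⟩
  · obtain ⟨a, ha, hau⟩ : ∃! c : Row I → K, f - ∑ i, c i • v i ∈ maxIdeal K ^ trunc I := by
      refine ⟨_, hv.sub_mem f hf, fun b hb => ?_⟩
      ext k
      have := coeff_eq_of_sub_mem hb (S₀ k).2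
      rw [coeff_sum_smul] at this
      simp only [hv.coeff_eq, mul_ite, mul_one, mul_zero, Finset.sum_ite_eq', Finset.mem_univ,
        if_true] at this
      exact this.symm
    refine ⟨fun i => a i / d i, ?_, fun b hb => ?_⟩
    · simpa only [smul_smul, div_mul_cancel₀ _ (hd _)] using ha
    · have := hau (fun i => b i * d i) (by simpa only [smul_smul] using hb)
      ext i
      rw [← this, mul_div_cancel_right₀ _ (hd i)]
  · have : (Matrix.of fun i j => coeff (S j).1 (d i • v i)) =
      Matrix.of fun i j => d i * minor v S i j := rfl
    beta_reduce
    rw [this, Matrix.det_mul_column, hp S]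
    simp [d, mul_assoc]

end

section

open MvPowerSeries

variable {K : Type*} [Field K]

/-! ### Initial ideals -/

/-- The weight of an exponent vector. -/
def wt (w : Fin 2 → ℤ) (e : Fin 2 →₀ ℕ) : ℤ := (e 0 : ℤ) * w 0 + (e 1 : ℤ) * w 1

theorem wt_add (w : Fin 2 → ℤ) (d e : Fin 2 →₀ ℕ) : wt w (d + e) = wt w d + wt w e := by
  simp only [wt, Finsupp.add_apply]; push_cast; ring

theorem wt_single (w : Fin 2 → ℤ) (i : Fin 2) : wt w (Finsupp.single i 1) = w i := by
  fin_cases i <;> simp [wt]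

theorem coeff_X_mul (i : Fin 2) (f : PS K) (e : Fin 2 →₀ ℕ) :
    coeff e (X i * f) =
      if Finsupp.single i 1 ≤ e then coeff (e - Finsupp.single i 1) f else 0 := by
  rw [X, coeff_monomial_mul, one_mul]

/-- A subspace containing `(x, y) ^ n` and stable under multiplication by `x` and `y` is an
ideal. -/
theorem mul_mem_of_X_mul_mem {T : Submodule K (PS K)} {n : ℕ}
    (hn : ∀ f ∈ maxIdeal K ^ n, f ∈ T) (hT : ∀ i, ∀ f ∈ T, X i * f ∈ T) (g : PS K) {f : PS K}
    (hf : f ∈ T) : g * f ∈ T := by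
  have hpow : ∀ (i : Fin 2) (k : ℕ), ∀ f ∈ T, X i ^ k * f ∈ T := by
    intro i k
    induction k with
    | zero => intro f hf; rwa [pow_zero, one_mul]
    | succ k ih => intro f hf; rw [pow_succ, mul_assoc]; exact ih _ (hT i f hf)
  have e : g * f = (g - ∑ e ∈ lowMonomials n, coeff e g • mon K e) * f
      + ∑ e ∈ lowMonomials n, coeff e g • (mon K e * f) := by
    rw [sub_mul, Finset.sum_mul]; simp only [smul_mul_assoc, sub_add_cancel]
  rw [e]
  refine add_mem (hn _ (Ideal.mul_mem_right _ _ (sub_sum_mem_maxIdeal_pow g n)))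
    (sum_mem fun e _ => T.smul_mem _ ?_)
  rw [mon_eq, mul_assoc]
  exact hpow 0 _ _ (hpow 1 _ _ hf)

variable {I J : Ideal (PS K)} {S₀ : Row I → Col I} {v : Row I → PS K}
  {p : (Row I → Col I) → K}

/-- The total weight of the columns `S`. -/
def colWt (w : Fin 2 → ℤ) (S : Row I → Col I) : ℤ := ∑ i, wt w (S i).1

theorem colWt_update (w : Fin 2 → ℤ) (S : Row I → Col I) (i : Row I) (j : Col I) :
    colWt w (Function.update S i j) = colWt w S - wt w (S i).1 + wt w j.1 := by
  rw [colWt, colWt, ← Finset.add_sum_erase _ _ (Finset.mem_univ i),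
    ← Finset.add_sum_erase _ (fun i => wt w (S i).1) (Finset.mem_univ i)]
  rw [Function.update_self, Finset.sum_congr rfl fun k hk => by
    rw [Function.update_of_ne (Finset.ne_of_mem_erase hk)]]
  ring

/-- Exchange argument: putting `e` in place of the `i`-th column of `S₀` gives a nonzero Plücker
coordinate, whose total weight cannot exceed that of `S₀`. -/
theorem wt_le_of_coeff_ne_zero (hv : IsReducedBasis I J S₀ v)
    (hp : ∀ S, p S = p S₀ * (minor v S).det) (h0 : p S₀ ≠ 0) {w : Fin 2 → ℤ}
    (hmax : ∀ S, p S ≠ 0 → colWt w S ≤ colWt w S₀) {i : Row I} {e : Fin 2 →₀ ℕ}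
    (he : e.degree < trunc I) (hne : coeff e (v i) ≠ 0) : wt w e ≤ wt w (S₀ i).1 := by
  have h1 := IsPlucker.coeff_eq_div hv hp h0 i ⟨e, he⟩
  rw [h1] at hne
  have h2 := hmax _ (div_ne_zero_iff.1 hne).1
  rw [colWt_update] at h2
  change _ - _ + wt w e ≤ _ at h2
  omega

/-- The part of `f` of weight `k`, truncated to degree `< n`. -/
def weightPart (w : Fin 2 → ℤ) (n : ℕ) (k : ℤ) (f : PS K) : PS K :=
  ofCoeff fun e => if e.degree < n ∧ wt w e = k then coeff e f else 0

theorem coeff_weightPart {w : Fin 2 → ℤ} {n : ℕ} {k : ℤ} {f : PS K} {e : Fin 2 →₀ ℕ}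
    (he : e.degree < n) : coeff e (weightPart w n k f) = if wt w e = k then coeff e f else 0 := by
  rw [weightPart, coeff_ofCoeff, if_congr (and_iff_right he) rfl rfl]

/-- In a nonzero Leibniz term each column weighs at most as much as the leading column of its row.
The total weights agree exactly when all these inequalities are equalities, that is, when every
factor lies in the leading part. -/
theorem det_weightPart {w : Fin 2 → ℤ}
    (hle : ∀ i, ∀ e : Fin 2 →₀ ℕ, e.degree < trunc I → coeff e (v i) ≠ 0 →
      wt w e ≤ wt w (S₀ i).1) (S : Row I → Col I) :
    (minor (fun i => weightPart w (trunc I) (wt w (S₀ i).1) (v i)) S).det =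
      if colWt w S = colWt w S₀ then (minor v S).det else 0 := by
  have hA : ∀ i j, minor (fun i => weightPart w (trunc I) (wt w (S₀ i).1) (v i)) S i j =
      if wt w (S j).1 = wt w (S₀ i).1 then minor v S i j else 0 := fun i j =>
    coeff_weightPart (S j).2
  have hsum : ∀ π : Equiv.Perm (Row I), ∑ i, wt w (S₀ (π i)).1 = colWt w S₀ := fun π =>
    Equiv.sum_comp π fun i => wt w (S₀ i).1
  rw [Matrix.det_apply, Matrix.det_apply]
  split_ifs with h
  · refine Finset.sum_congr rfl fun π _ => ?_
    congr 1
    by_cases hz : ∃ i, minor v S (π i) i = 0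
    · obtain ⟨i, hi⟩ := hz
      have z1 : ∏ i, minor v S (π i) i = 0 := Finset.prod_eq_zero (Finset.mem_univ i) hi
      rw [z1]
      exact Finset.prod_eq_zero (Finset.mem_univ i) (by rw [hA, hi, ite_self])
    · push Not at hz
      have hall : ∀ i ∈ Finset.univ, wt w (S i).1 = wt w (S₀ (π i)).1 := by
        rw [← Finset.sum_eq_sum_iff_of_le fun i _ => hle _ _ (S i).2 (hz i), hsum]
        exact h
      refine Finset.prod_congr rfl fun i hi => ?_
      rw [hA, if_pos (hall i hi)]
  · refine Finset.sum_eq_zero fun π _ => ?_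
    obtain ⟨i, hi⟩ : ∃ i, wt w (S i).1 ≠ wt w (S₀ (π i)).1 := by
      by_contra! hall
      exact h ((Finset.sum_congr rfl fun i _ => hall i).trans (hsum π))
    have z1 : ∏ i, minor (fun i => weightPart w (trunc I) (wt w (S₀ i).1) (v i)) S (π i) i = 0 :=
      Finset.prod_eq_zero (Finset.mem_univ i) (by rw [hA, if_neg hi])
    rw [z1, smul_zero]

/-- This is the part of weight `s` of the expansion of `X i * v k` in the reduced basis. It makes
the span of the initial forms stable under multiplication by the variables. -/
theorem weightPart_X_mul {w : Fin 2 → ℤ} (hv : IsReducedBasis I J S₀ v)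
    (hle : ∀ i, ∀ e : Fin 2 →₀ ℕ, e.degree < trunc I → coeff e (v i) ≠ 0 →
      wt w e ≤ wt w (S₀ i).1) (i : Fin 2) (k : Row I) {e : Fin 2 →₀ ℕ} (he : e.degree < trunc I) :
    coeff e (X i * weightPart w (trunc I) (wt w (S₀ k).1) (v k)) =
      ∑ l, coeff (S₀ l).1 (X i * weightPart w (trunc I) (wt w (S₀ k).1) (v k)) *
        coeff e (weightPart w (trunc I) (wt w (S₀ l).1) (v l)) := by
  set s := wt w (S₀ k).1 + w i with hs
  have hsub : ∀ d : Fin 2 →₀ ℕ, Finsupp.single i 1 ≤ d → d.degree < trunc I →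
      wt w d = wt w (d - Finsupp.single i 1) + w i ∧
        (d - Finsupp.single i 1).degree < trunc I := by
    intro d hd hdeg
    have h : d - Finsupp.single i 1 + Finsupp.single i 1 = d := tsub_add_cancel_of_le hd
    refine ⟨by conv_lhs => rw [← h, wt_add, wt_single], ?_⟩
    have h2 := congrArg Finsupp.degree h
    rw [map_add] at h2
    omega
  have hX : ∀ d : Fin 2 →₀ ℕ, d.degree < trunc I →
      coeff d (X i * weightPart w (trunc I) (wt w (S₀ k).1) (v k)) =
        if wt w d = s then coeff d (X i * v k) else 0 := by
    intro d hdeg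
    rw [coeff_X_mul, coeff_X_mul]
    by_cases hd : Finsupp.single i 1 ≤ d
    · obtain ⟨h1, h2⟩ := hsub d hd hdeg
      rw [if_pos hd, if_pos hd, coeff_weightPart h2]
      exact if_congr (by rw [h1, hs]; exact (add_left_inj _).symm) rfl rfl
    · rw [if_neg hd, if_neg hd, ite_self]
  have hXle : ∀ d : Fin 2 →₀ ℕ, d.degree < trunc I → coeff d (X i * v k) ≠ 0 → wt w d ≤ s := by
    intro d hdeg hne
    rw [coeff_X_mul] at hne
    by_cases hd : Finsupp.single i 1 ≤ d
    · obtain ⟨h1, h2⟩ := hsub d hd hdeg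
      rw [if_pos hd] at hne
      have := hle k _ h2 hne
      omega
    · rw [if_neg hd] at hne
      exact absurd rfl hne
  have hmem : X i * v k ∈ J := J.mul_mem_left _ (hv.mem k)
  rw [hX e he]
  have hterm : ∀ l, coeff (S₀ l).1 (X i * weightPart w (trunc I) (wt w (S₀ k).1) (v k)) *
      coeff e (weightPart w (trunc I) (wt w (S₀ l).1) (v l)) =
      if wt w e = s then coeff (S₀ l).1 (X i * v k) * coeff e (v l) else 0 := by
    intro l
    rw [hX _ (S₀ l).2, coeff_weightPart he]
    by_cases h1 : wt w (S₀ l).1 = s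
    · rw [if_pos h1, h1, mul_ite, mul_zero]
    · rw [if_neg h1, zero_mul]
      split_ifs with h2
      -- A basis vector whose leading weight differs from `s` contributes nothing in weight `s`: if
      -- it is larger, its coefficient in `X i * v k` is zero; if smaller, the vector has no term of
      -- weight `s`.
      · by_contra hne
        have h3 := hXle _ (S₀ l).2 (left_ne_zero_of_mul (Ne.symm hne))
        have h4 := hle l e he (right_ne_zero_of_mul (Ne.symm hne))
        omega
      · rfl
  rw [Finset.sum_congr rfl fun l _ => hterm l]
  split_ifs
  · exact hv.coeff_of_mem hmem he
  · rw [Finset.sum_const_zero]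

/-- The initial ideal with respect to a weight: its Plücker coordinates are those of largest
weight. -/
theorem IsPlucker.exists_initial [Nonempty (Row I)] (h : IsPlucker I J p) (w : Fin 2 → ℤ)
    (h0 : p S₀ ≠ 0) (hmax : ∀ S, p S ≠ 0 → colWt w S ≤ colWt w S₀) :
    ∃ J', IsPlucker I J' fun S => if colWt w S = colWt w S₀ then p S else 0 := by
  obtain ⟨v, hv, hp⟩ := h.exists_reduced h0
  have hle : ∀ i, ∀ e : Fin 2 →₀ ℕ, e.degree < trunc I → coeff e (v i) ≠ 0 →
      wt w e ≤ wt w (S₀ i).1 := fun i e he => wt_le_of_coeff_ne_zero hv hp h0 hmax he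
  set u : Row I → PS K := fun i => weightPart w (trunc I) (wt w (S₀ i).1) (v i) with hu
  have hred : minor u S₀ = 1 := by
    ext i j
    change coeff (S₀ j).1 (weightPart w (trunc I) (wt w (S₀ i).1) (v i)) = _
    rw [coeff_weightPart (S₀ j).2, hv.coeff_eq, Matrix.one_apply]
    by_cases hij : i = j
    · rw [hij, if_pos rfl]
    · rw [if_neg hij, ite_self]
  -- The span of the initial forms together with $(x,y)^N$, given by linear equations: the
  -- coefficients at `S₀` determine all others of degree below $N$.
  let T : Submodule K (PS K) :=
    { carrier := {f | ∀ e : Fin 2 →₀ ℕ, e.degree < trunc I →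
        coeff e f = ∑ i, coeff (S₀ i).1 f * coeff e (u i)}
      zero_mem' := by intro e _; simp
      add_mem' := by
        intro f g hf hg e he
        simp only [map_add, add_mul, Finset.sum_add_distrib]
        rw [hf e he, hg e he]
      smul_mem' := by
        intro c f hf e he
        simp only [coeff_smul, mul_assoc]
        rw [← Finset.mul_sum, ← hf e he] }
  have hTmem : ∀ f, f ∈ T ↔ ∀ e : Fin 2 →₀ ℕ, e.degree < trunc I →
        coeff e f = ∑ i, coeff (S₀ i).1 f * coeff e (u i) := fun f => Iff.rfl
  have hTsub : ∀ f, f ∈ T ↔ f - ∑ i, coeff (S₀ i).1 f • u i ∈ maxIdeal K ^ trunc I := by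
    intro f
    rw [hTmem, mem_maxIdeal_pow]
    refine forall₂_congr fun e he => ?_
    rw [map_sub, coeff_sum_smul, sub_eq_zero]
  have hTn : ∀ f ∈ maxIdeal K ^ trunc I, f ∈ T := by
    intro f hf e he
    rw [mem_maxIdeal_pow] at hf
    rw [hf e he, Finset.sum_eq_zero fun i _ => by rw [hf _ (S₀ i).2, zero_mul]]
  have huT : ∀ i, u i ∈ T := by
    intro i e he
    have : ∀ j, coeff (S₀ j).1 (u i) = if i = j then 1 else 0 := fun j => by
      have := congrFun (congrFun hred i) j
      rwa [minor_apply, Matrix.one_apply] at this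
    simp only [this, ite_mul, one_mul, zero_mul, Finset.sum_ite_eq, Finset.mem_univ, if_true]
  have hXT : ∀ i, ∀ f ∈ T, X i * f ∈ T := by
    intro i f hf
    rw [← sub_add_cancel f (∑ k, coeff (S₀ k).1 f • u k), mul_add, Finset.mul_sum]
    refine add_mem (hTn _ (Ideal.mul_mem_left _ _ ((hTsub f).1 hf))) (sum_mem fun k _ => ?_)
    rw [mul_smul_comm]
    exact T.smul_mem _ fun e he => weightPart_X_mul hv hle i k he
  let J' : Ideal (PS K) :=
    { carrier := T
      zero_mem' := T.zero_mem
      add_mem' := T.add_mem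
      smul_mem' := fun g f hf => mul_mem_of_X_mul_mem hTn hXT g hf }
  have hJ' : IsReducedBasis I J' S₀ u := ⟨huT, hred, fun f hf => (hTsub f).1 hf⟩
  refine ⟨J', ?_⟩
  convert (hJ'.isPlucker hTn).smul h0 using 2 with S
  rw [hu, det_weightPart hle S, mul_ite, mul_zero, ← hp]

end

section

variable {K : Type*} [Field K]

/-! ### The coordinate functions -/

/-- Only monomials with exponent vector `d` occur in `P`. -/
def HasExp (P : MvPolynomial (Fin 2) K) (d : Fin 2 → ℤ) : Prop :=
  ∀ e, P.coeff e ≠ 0 → ∀ k, (e k : ℤ) = d k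

namespace HasExp

variable {P Q : MvPolynomial (Fin 2) K} {d d' : Fin 2 → ℤ}

theorem zero : HasExp (0 : MvPolynomial (Fin 2) K) d := fun e he => absurd (by simp) he

theorem one : HasExp (1 : MvPolynomial (Fin 2) K) 0 := by
  intro e he k
  rw [MvPolynomial.coeff_one] at he
  have : 0 = e := by by_contra h; exact he (if_neg h)
  rw [← this]; rfl

theorem add (hP : HasExp P d) (hQ : HasExp Q d) : HasExp (P + Q) d := by
  intro e he
  by_cases h : P.coeff e = 0
  · exact hQ e (by rwa [MvPolynomial.coeff_add, h, zero_add] at he)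
  · exact hP e h

theorem sum {ι : Type*} {s : Finset ι} {f : ι → MvPolynomial (Fin 2) K}
    (h : ∀ i ∈ s, HasExp (f i) d) : HasExp (∑ i ∈ s, f i) d :=
  Finset.sum_induction f (fun P => HasExp P d) (fun _ _ h h' => h.add h') zero h

theorem mul (hP : HasExp P d) (hQ : HasExp Q d') : HasExp (P * Q) (d + d') := by
  intro e he k
  rw [MvPolynomial.coeff_mul] at he
  obtain ⟨x, hx, hne⟩ := Finset.exists_ne_zero_of_sum_ne_zero he
  have h : x.1 + x.2 = e := Finset.HasAntidiagonal.mem_antidiagonal.1 hx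
  rw [← h, Finsupp.add_apply, Nat.cast_add, hP _ (left_ne_zero_of_mul hne) k,
    hQ _ (right_ne_zero_of_mul hne) k, Pi.add_apply]

theorem prod {ι : Type*} {s : Finset ι} {f : ι → MvPolynomial (Fin 2) K} {d : ι → Fin 2 → ℤ}
    (h : ∀ i ∈ s, HasExp (f i) (d i)) : HasExp (∏ i ∈ s, f i) (∑ i ∈ s, d i) := by
  classical
  induction s using Finset.induction_on with
  | empty => rw [Finset.prod_empty, Finset.sum_empty]; exact one
  | insert a s ha ih =>
    rw [Finset.prod_insert ha, Finset.sum_insert ha]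
    exact (h a (Finset.mem_insert_self _ _)).mul (ih fun i hi => h i (Finset.mem_insert_of_mem hi))

theorem smul (u : ℤˣ) (hP : HasExp P d) : HasExp (u • P) d := by
  intro e he
  refine hP e fun h => he ?_
  rcases Int.units_eq_one_or u with rfl | rfl
  · rwa [one_smul]
  · rw [Units.neg_smul, one_smul, MvPolynomial.coeff_neg, h, neg_zero]

theorem X (l : Fin 2) :
    HasExp (MvPolynomial.X l : MvPolynomial (Fin 2) K) fun k => if l = k then 1 else 0 := by
  intro e he k
  rw [MvPolynomial.coeff_X] at he
  have : Finsupp.single l 1 = e := by by_contra h; exact he (if_neg h)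
  rw [← this, Finsupp.single_apply]
  split_ifs <;> simp [*]

/-- A polynomial with a single monomial has its coefficient as value at $(1,1)$. For the zero
polynomial the exponent is arbitrary, hence the condition `P ≠ 0`. -/
theorem eq_monomial (hP : HasExp P d) :
    ∃ e : Fin 2 →₀ ℕ, P = MvPolynomial.monomial e (MvPolynomial.eval ![1, 1] P) ∧
      (P ≠ 0 → ∀ k, (e k : ℤ) = d k) := by
  by_cases h0 : P = 0
  · exact ⟨0, by simp [h0], fun h => absurd h0 h⟩
  obtain ⟨e, he⟩ := MvPolynomial.ne_zero_iff.1 h0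
  have hPe : P = MvPolynomial.monomial e (P.coeff e) := by
    ext e'
    rw [MvPolynomial.coeff_monomial]
    split_ifs with h
    · rw [h]
    · by_contra hne
      refine h (Finsupp.ext fun k => ?_)
      have := (hP e he k).trans (hP e' hne k).symm
      exact_mod_cast this
  refine ⟨e, ?_, fun _ => hP e he⟩
  have hev : MvPolynomial.eval ![1, 1] P = P.coeff e := by
    conv_lhs => rw [hPe]
    rw [MvPolynomial.eval_monomial]
    simp [Finsupp.prod_fintype]
  rw [hev]
  exact hPe

end HasExp

/-- The weights of `x` and `y` whose change computes the exponents of `a` and `b`. -/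
def Kind.axis (c : Kind) : Fin 2 → Fin 2 → ℤ := ![c.weight 1 0, c.weight 0 1]

theorem Kind.wt_weight (c : Kind) (m n : ℤ) (e : Fin 2 →₀ ℕ) :
    wt (c.weight m n) e = m * wt (c.axis 0) e + n * wt (c.axis 1) e := by
  cases c <;> simp [wt, Kind.axis, Kind.weight] <;> ring

/-- The coefficient of `x ^ i y ^ j` involves only the monomials whose exponents are determined by
the change of weight. -/
def HasBiExp (c : Kind) (P : MvPolynomial (Fin 2) (MvPolynomial (Fin 2) K)) (d : Fin 2 → ℤ) :
    Prop :=
  ∀ j, HasExp (P.coeff j) fun k => wt (c.axis k) j - d k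

namespace HasBiExp

variable {c : Kind} {P Q : MvPolynomial (Fin 2) (MvPolynomial (Fin 2) K)} {d d' : Fin 2 → ℤ}

theorem add (hP : HasBiExp c P d) (hQ : HasBiExp c Q d) : HasBiExp c (P + Q) d := fun j => by
  rw [MvPolynomial.coeff_add]
  exact (hP j).add (hQ j)

theorem mul (hP : HasBiExp c P d) (hQ : HasBiExp c Q d') : HasBiExp c (P * Q) (d + d') := by
  intro j
  rw [MvPolynomial.coeff_mul]
  refine HasExp.sum fun x hx => ?_
  have h : x.1 + x.2 = j := Finset.HasAntidiagonal.mem_antidiagonal.1 hx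
  convert (hP x.1).mul (hQ x.2) using 1
  ext k
  rw [← h, wt_add, Pi.add_apply, Pi.add_apply]
  ring

theorem one : HasBiExp c (1 : MvPolynomial (Fin 2) (MvPolynomial (Fin 2) K)) 0 := by
  intro j
  rw [MvPolynomial.coeff_one]
  split_ifs with h
  · convert HasExp.one using 1
    ext k
    simp [← h, wt]
  · exact HasExp.zero

theorem pow (hP : HasBiExp c P d) (n : ℕ) : HasBiExp c (P ^ n) (n • d) := by
  induction n with
  | zero => rw [pow_zero, zero_smul]; exact one
  | succ n ih => rw [pow_succ, succ_nsmul]; exact ih.mul hP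

theorem X (i : Fin 2) :
    HasBiExp c (MvPolynomial.X i : MvPolynomial (Fin 2) (MvPolynomial (Fin 2) K))
      fun k => c.axis k i := by
  intro j
  rw [MvPolynomial.coeff_X]
  split_ifs with h
  · convert HasExp.one using 1
    ext k
    rw [← h, wt_single, sub_self]
    rfl
  · exact HasExp.zero

theorem C_X (l : Fin 2) :
    HasBiExp c (MvPolynomial.C (MvPolynomial.X l) :
      MvPolynomial (Fin 2) (MvPolynomial (Fin 2) K)) fun k => - if l = k then 1 else 0 := by
  intro j
  rw [MvPolynomial.coeff_C]
  split_ifs with h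
  · convert HasExp.X l using 1
    ext k
    simp [← h, wt]
  · exact HasExp.zero

/-- The weights are made for this: each of $x\mapsto ay^2$, and $x\mapsto by^3$ or $y\mapsto bx$,
raises by one the weight belonging to its parameter and keeps the other. -/
theorem images (c : Kind) (i : Fin 2) :
    HasBiExp c (c.images (MvPolynomial.X 0 : MvPolynomial (Fin 2) K) (MvPolynomial.X 1) i)
      fun k => c.axis k i := by
  have hterm : ∀ (l j : Fin 2) (n : ℕ), (∀ k, -(if l = k then 1 else 0) + n * c.axis k j =
      c.axis k i) → HasBiExp c (MvPolynomial.C (MvPolynomial.X l) * MvPolynomial.X j ^ n :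
        MvPolynomial (Fin 2) (MvPolynomial (Fin 2) K)) fun k => c.axis k i := by
    intro l j n h
    convert (C_X (c := c) (K := K) l).mul ((X (c := c) (K := K) j).pow n) using 1
    ext k
    rw [← h k]
    simp
  cases c <;> fin_cases i
  · exact ((X 0).add (hterm 0 1 2 (by decide))).add (hterm 1 1 3 (by decide))
  · exact X 1
  · exact (X 0).add (hterm 0 1 2 (by decide))
  · have := hterm 1 0 1 (by decide)
    rw [pow_one] at this
    exact (X 1).add this

end HasBiExp

variable {c : Kind} {I : Ideal (PS K)}

/-- The exponents of the monomial in `a, b` which is the coordinate function for the columns `S`. -/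
def expo (c : Kind) (S : Row I → Col I) (k : Fin 2) : ℤ :=
  colWt (c.axis k) S - ∑ i : Row I, wt (c.axis k) i.1

/-- Every Leibniz term has the same exponents: the sum of the weight changes does not depend on the
permutation pairing rows with columns. -/
theorem hasExp_coordFun (c : Kind) (S : Row I → Col I) : HasExp (coordFun c I S) (expo c S) := by
  rw [coordFun, Matrix.det_apply]
  refine HasExp.sum fun π _ => HasExp.smul _ ?_
  have hd : expo c S = ∑ i, fun k => wt (c.axis k) (S i).1 - wt (c.axis k) (π i).1 := by
    ext k
    rw [Finset.sum_apply, Finset.sum_sub_distrib, expo, colWt,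
      Equiv.sum_comp π fun i : Row I => wt (c.axis k) i.1]
  rw [hd]
  refine HasExp.prod fun i _ => ?_
  have h := ((HasBiExp.images (K := K) c 0).pow ((π i).1 0)).mul
    ((HasBiExp.images (K := K) c 1).pow ((π i).1 1)) (S i).1
  have e : (fun k => wt (c.axis k) (S i).1 - wt (c.axis k) (π i).1) = fun k =>
      wt (c.axis k) (S i).1 -
        (((π i).1 0 • fun k => c.axis k 0) + (π i).1 1 • fun k => c.axis k 1) k := by
    ext k
    simp [wt]
  rw [e]
  exact h

/-- The coefficient of the coordinate function for the columns `S`. -/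
def coordCoeff (c : Kind) (S : Row I → Col I) : K := MvPolynomial.eval ![1, 1] (coordFun c I S)

theorem exists_coordFun_eq (c : Kind) (S : Row I → Col I) :
    ∃ e : Fin 2 →₀ ℕ, coordFun c I S = MvPolynomial.monomial e (coordCoeff c S) ∧
      (coordCoeff c S ≠ 0 → ∀ k, (e k : ℤ) = expo c S k) := by
  obtain ⟨e, he, h⟩ := (hasExp_coordFun c S).eq_monomial
  refine ⟨e, he, fun h0 => h fun hz => h0 ?_⟩
  rw [coordCoeff, hz, map_zero]

theorem mem_support_coordFun {S : Row I → Col I} {e : Fin 2 →₀ ℕ} :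
    e ∈ (coordFun c I S).support ↔ coordCoeff c S ≠ 0 ∧ ∀ k, (e k : ℤ) = expo c S k := by
  obtain ⟨e', h, he'⟩ := exists_coordFun_eq c S
  rw [h, MvPolynomial.mem_support_iff, MvPolynomial.coeff_monomial]
  constructor
  · intro hne
    split_ifs at hne with h1
    · exact ⟨hne, h1 ▸ he' hne⟩
    · exact absurd rfl hne
  · rintro ⟨h0, h1⟩
    rw [if_pos]
    · exact h0
    · ext k
      have := (he' h0 k).trans (h1 k).symm
      exact_mod_cast this

theorem eval_coordFun (c : Kind) (S : Row I → Col I) (a b : Kˣ) :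
    MvPolynomial.eval ![(a : K), (b : K)] (coordFun c I S) =
      coordCoeff c S * ((a ^ expo c S 0 * b ^ expo c S 1 : Kˣ) : K) := by
  obtain ⟨e, h, he⟩ := exists_coordFun_eq c S
  rw [h, MvPolynomial.eval_monomial]
  by_cases h0 : coordCoeff c S = 0
  · rw [h0, zero_mul, zero_mul]
  · rw [← he h0, ← he h0]
    simp [Finsupp.prod_fintype]

/-- The monomials in `I` of degree below $N$ form a basis of $I/(x,y)^N$. The automorphism preserves
$(x,y)^N$, so it carries them to a basis of the image. -/
theorem isPlucker_map_aut (c : Kind) (hmon : IsMonomialIdeal I) [Module.Finite K (PS K ⧸ I)]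
    (a b : K) :
    IsPlucker I (I.map (c.aut a b)) fun S => MvPolynomial.eval ![a, b] (coordFun c I S) := by
  have hN := maxIdeal_pow_trunc_le hmon
  have hle : maxIdeal K ^ trunc I ≤ I.map (c.aut a b) := by
    rw [← algEquiv_map_maxIdeal_pow (c.equiv a b), ← Kind.map_equiv]
    exact Ideal.map_mono hN
  have himg : ∀ i, c.images a b i = MvPolynomial.map (MvPolynomial.eval ![a, b])
      (c.images (MvPolynomial.X 0 : MvPolynomial (Fin 2) K) (MvPolynomial.X 1) i) := by
    intro i
    cases c <;> fin_cases i <;> simp [Kind.images]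
  refine ⟨hle, fun i => c.aut a b (mon K i.1), fun i => Ideal.mem_map_of_mem _ i.2.2, ?_, ?_⟩
  · intro f hf
    obtain ⟨g, hg, rfl⟩ := (Ideal.mem_map_iff_of_surjective _ (c.aut_bijective a b).2).1 hf
    have hiff : ∀ d : Row I → K,
        c.aut a b g - ∑ i, d i • c.aut a b (mon K i.1) ∈ maxIdeal K ^ trunc I ↔
          ∀ i, d i = MvPowerSeries.coeff i.1 g := by
      intro d
      classical
      have h1 : c.aut a b g - ∑ i, d i • c.aut a b (mon K i.1) =
          c.equiv a b (g - ∑ i, d i • mon K i.1) := by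
        rw [Kind.equiv_apply, map_sub, map_sum]
        simp only [map_smul]
      have h2 : ∀ f, c.equiv a b f ∈ maxIdeal K ^ trunc I ↔ f ∈ maxIdeal K ^ trunc I :=
        fun f => ⟨fun h => by
          have := algEquiv_map_mem_pow (c.equiv a b).symm h
          rwa [AlgEquiv.symm_apply_apply] at this, algEquiv_map_mem_pow _⟩
      rw [h1, h2, mem_maxIdeal_pow]
      constructor
      · intro h i
        have := h i.1 i.2.1
        rw [map_sub, coeff_sum_smul, sub_eq_zero] at this
        simp only [coeff_mon, Subtype.coe_inj] at this
        simpa using this.symm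
      · intro h e he
        rw [map_sub, coeff_sum_smul, sub_eq_zero]
        simp only [coeff_mon]
        by_cases he' : mon K e ∈ I
        · rw [Finset.sum_eq_single ⟨e, he, he'⟩]
          · rw [h, if_pos rfl, mul_one]
          · intro i _ hi
            rw [if_neg, mul_zero]
            rintro rfl
            exact hi rfl
          · exact fun h => absurd (Finset.mem_univ _) h
        · rw [Finset.sum_eq_zero]
          · by_contra h0
            exact he' (hmon.mon_mem hg h0)
          · intro i _
            rw [if_neg, mul_zero]
            rintro rfl
            exact he' i.2.2
    refine ⟨fun i => MvPowerSeries.coeff i.1 g, (hiff _).2 fun _ => rfl, fun d hd => ?_⟩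
    ext i
    exact (hiff d).1 hd i
  · intro S
    beta_reduce
    rw [coordFun, RingHom.map_det]
    congr 1
    ext i j
    rw [RingHom.mapMatrix_apply, Matrix.map_apply, Matrix.of_apply, Matrix.of_apply, Kind.aut_mon,
      MvPolynomial.coeff_coe, himg, himg, ← map_pow, ← map_pow, ← map_mul, MvPolynomial.coeff_map]

theorem isPlucker_map_aut_units (c : Kind) (hmon : IsMonomialIdeal I)
    [Module.Finite K (PS K ⧸ I)] (a b : Kˣ) :
    IsPlucker I (I.map (c.aut (a : K) (b : K))) fun S =>
      coordCoeff c S * ((a ^ expo c S 0 * b ^ expo c S 1 : Kˣ) : K) := by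
  simpa only [eval_coordFun] using isPlucker_map_aut c hmon (a : K) (b : K)

theorem exists_coordCoeff_ne_zero (c : Kind) (hmon : IsMonomialIdeal I)
    [Module.Finite K (PS K ⧸ I)] : ∃ S : Row I → Col I, coordCoeff c S ≠ 0 :=
  (isPlucker_map_aut c hmon (1 : K) 1).exists_ne_zero

end

section

variable {K : Type*} [Field K] {c : Kind} {I : Ideal (PS K)}

/-! ### Limits -/

theorem eval_smul_of_isHomogeneous {τ : Type*} {Q : MvPolynomial τ K} {k : ℕ}
    (hQ : Q.IsHomogeneous k) (r : K) (x : τ → K) :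
    MvPolynomial.eval (fun i => r * x i) Q = r ^ k * MvPolynomial.eval x Q := by
  rw [MvPolynomial.eval_eq, MvPolynomial.eval_eq, Finset.mul_sum]
  refine Finset.sum_congr rfl fun e he => ?_
  have hdeg : ∑ i ∈ e.support, e i = k := by
    have := hQ (MvPolynomial.mem_support_iff.1 he)
    rw [← this, Finsupp.weight_apply, Finsupp.sum]
    simp
  rw [Finset.prod_congr rfl fun i _ => mul_pow r (x i) (e i), Finset.prod_mul_distrib,
    Finset.prod_pow_eq_pow_sum, hdeg]
  ring

theorem polynomial_eval_eval₂ {τ : Type*} (Q : MvPolynomial τ K) (R : τ → Polynomial K) (x : K) :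
    (MvPolynomial.eval₂ Polynomial.C R Q).eval x = MvPolynomial.eval (fun i => (R i).eval x) Q := by
  have h := MvPolynomial.eval₂_comp_left (Polynomial.evalRingHom x) Polynomial.C R Q
  have hC : (Polynomial.evalRingHom x).comp Polynomial.C = RingHom.id K := by
    ext y; simp
  rw [hC] at h
  exact h

theorem infinite_units_of_eventually [IsAlgClosed K] {P : Kˣ → Prop}
    (h : ∀ᶠ t : Kˣ in Filter.cofinite, P t) : {t : Kˣ | P t}.Infinite := by
  have : Infinite Kˣ := by
    have := IsAlgClosed.instInfinite (K := K)
    exact unitsEquivNeZero.infinite_iff.2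
      (Set.infinite_coe_iff.2 (Set.finite_singleton 0).infinite_compl)
  exact fun hf => Set.infinite_univ ((hf.union (Filter.eventually_cofinite.1 h)).subset
    fun t _ => em (P t))

theorem eq_zero_of_eventually_eval [IsAlgClosed K] {R : Polynomial K}
    (h : ∀ᶠ t : Kˣ in Filter.cofinite, R.eval (t : K) = 0) : R = 0 := by
  refine R.eq_zero_of_infinite_isRoot (((infinite_units_of_eventually h).image
    Units.val_injective.injOn).mono ?_)
  rintro _ ⟨t, ht, rfl⟩
  exact ht

/-- The leading coefficients are the values at $0$ of the reversed polynomials $t^dP(1/t)$. By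
homogeneity the relation holds for these at almost all $t\neq0$, hence identically, hence at $0$. -/
theorem eval_leading_eq_zero [IsAlgClosed K] {τ : Type*} {Q : MvPolynomial τ K} {k : ℕ}
    (hQ : Q.IsHomogeneous k) {P : τ → Polynomial K} {d : ℕ} (hd : ∀ i, (P i).natDegree ≤ d)
    (h : ∀ᶠ t : Kˣ in Filter.cofinite, MvPolynomial.eval (fun i => (P i).eval (t : K)) Q = 0) :
    MvPolynomial.eval (fun i => (P i).coeff d) Q = 0 := by
  have hR : MvPolynomial.eval₂ Polynomial.C (fun i => (P i).reflect d) Q = 0 := by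
    apply eq_zero_of_eventually_eval
    have hinv : Filter.Tendsto (fun t : Kˣ => t⁻¹) Filter.cofinite Filter.cofinite :=
      inv_injective.tendsto_cofinite
    refine (hinv.eventually h).mono fun t ht => ?_
    rw [polynomial_eval_eval₂]
    have hrefl : ∀ i, ((P i).reflect d).eval (t : K) =
        (t : K) ^ d * (P i).eval ((t⁻¹ : Kˣ) : K) := by
      intro i
      have : Invertible ((t⁻¹ : Kˣ) : K) := (t⁻¹).invertible
      have e := Polynomial.eval₂_reflect_mul_pow (RingHom.id K) ((t⁻¹ : Kˣ) : K) d (P i) (hd i)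
      rw [invOf_units, inv_inv] at e
      change ((P i).reflect d).eval (t : K) * _ = (P i).eval _ at e
      rw [← e, mul_left_comm, ← mul_pow, Units.mul_inv, one_pow, mul_one]
    simp only [hrefl]
    rw [eval_smul_of_isHomogeneous hQ, ht, mul_zero]
  have h0 := polynomial_eval_eval₂ Q (fun i => (P i).reflect d) 0
  rw [hR, Polynomial.eval_zero] at h0
  rw [h0]
  congr 2
  ext i
  rw [← Polynomial.coeff_zero_eq_eval_zero, Polynomial.coeff_reflect, Polynomial.revAt_le
    (Nat.zero_le _), Nat.sub_zero]

theorem eval_eq_zero_of_mem_orbitClosure {J : Ideal (PS K)} (hJ : J ∈ orbitClosure I)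
    {p : (Row I → Col I) → K} (hp : IsPlucker I J p) {Q : MvPolynomial (Row I → Col I) K} {k : ℕ}
    (hQ : Q.IsHomogeneous k)
    (h : ∀ J' ∈ orbit I, ∀ p', IsPlucker I J' p' → MvPolynomial.eval p' Q = 0) :
    MvPolynomial.eval p Q = 0 := by
  obtain ⟨q, hq, hq'⟩ := hJ
  obtain ⟨r, -, hr⟩ := hq.exists_smul hp
  rw [funext hr, eval_smul_of_isHomogeneous hQ, hq' Q k hQ h, mul_zero]

theorem mem_orbitClosure_of_mem_orbit {J : Ideal (PS K)} (hJ : J ∈ orbit I)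
    {p : (Row I → Col I) → K} (hp : IsPlucker I J p) : J ∈ orbitClosure I :=
  ⟨p, hp, fun _ _ _ h => h J hJ p hp⟩

theorem IsLimitAtInfinity.mem_orbitClosure [IsAlgClosed K] {F : Kˣ → Ideal (PS K)}
    {J : Ideal (PS K)} (h : IsLimitAtInfinity I F J) (hF : ∀ t, F t ∈ orbitClosure I) :
    J ∈ orbitClosure I := by
  obtain ⟨P, d, hd, hP, hJ⟩ := h
  exact ⟨_, hJ, fun Q k hQ hvan => eval_leading_eq_zero hQ hd
    (hP.mono fun t ht => eval_eq_zero_of_mem_orbitClosure (hF t) ht hQ hvan)⟩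

/-- Limits are unique. -/
theorem IsLimitAtInfinity.unique [IsAlgClosed K] {F : Kˣ → Ideal (PS K)}
    {J J' : Ideal (PS K)} (h : IsLimitAtInfinity I F J) (h' : IsLimitAtInfinity I F J') :
    J = J' := by
  obtain ⟨P, d, hd, hP, hJ⟩ := h
  obtain ⟨P', d', hd', hP', hJ'⟩ := h'
  -- Two Plücker vectors of one ideal are proportional, so $P_SP'_T=P_TP'_S$ as polynomials; compare
  -- coefficients in degree $d+d'$.
  have hprop : ∀ S T, (P S).coeff d * (P' T).coeff d' = (P T).coeff d * (P' S).coeff d' := by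
    intro S T
    have hz : P S * P' T - P T * P' S = 0 := by
      apply eq_zero_of_eventually_eval
      filter_upwards [hP, hP'] with t h1 h2
      obtain ⟨r, -, hr⟩ := h1.exists_smul h2
      rw [Polynomial.eval_sub, Polynomial.eval_mul, Polynomial.eval_mul, hr S, hr T]
      ring
    rw [← Polynomial.coeff_mul_add_eq_of_natDegree_le (hd S) (hd' T),
      ← Polynomial.coeff_mul_add_eq_of_natDegree_le (hd T) (hd' S), sub_eq_zero.1 hz]
  obtain ⟨S, hS⟩ := hJ.exists_ne_zero
  obtain ⟨T, hT⟩ := hJ'.exists_ne_zero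
  have hS' : (P' S).coeff d' ≠ 0 := by
    intro h0
    have := hprop S T
    rw [h0, mul_zero] at this
    exact mul_ne_zero hS hT this
  refine hJ.eq_of_smul hJ' (div_ne_zero hS' hS) fun T => ?_
  field_simp
  linear_combination hprop S T

/-! ### Ideals attached to faces -/

/-- The value at `(m, n)` of the exponent vector of the coordinate function for the columns `S`. -/
def lin (c : Kind) (m n : ℤ) (S : Row I → Col I) : ℤ := m * expo c S 0 + n * expo c S 1

/-- The constant is the total weight of the rows, so maximising $(m,n)$ on exponent vectors amounts
to maximising the weight of the columns. -/
theorem colWt_weight (c : Kind) (m n : ℤ) (S : Row I → Col I) :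
    colWt (c.weight m n) S = lin c m n S +
      (m * ∑ i : Row I, wt (c.axis 0) i.1 + n * ∑ i : Row I, wt (c.axis 1) i.1) := by
  simp only [colWt, Kind.wt_weight, Finset.sum_add_distrib, ← Finset.mul_sum, lin, expo]
  ring

open Classical in
/-- The coordinate functions for the columns in `B`, evaluated at `(a, b)`. -/
def facePoint (c : Kind) (B : Set (Row I → Col I)) (a b : Kˣ) (S : Row I → Col I) : K :=
  if S ∈ B then coordCoeff c S * ((a ^ expo c S 0 * b ^ expo c S 1 : Kˣ) : K) else 0

/-- The columns whose coordinate function does not vanish. -/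
def fullSet (c : Kind) (I : Ideal (PS K)) : Set (Row I → Col I) := {S | coordCoeff c S ≠ 0}

/-- The columns in `B` on which `(m, n)` is largest. -/
def maxIn (c : Kind) (B : Set (Row I → Col I)) (m n : ℤ) : Set (Row I → Col I) :=
  {S ∈ B | ∀ T ∈ B, lin c m n T ≤ lin c m n S}

theorem maxIn_subset (c : Kind) (B : Set (Row I → Col I)) (m n : ℤ) : maxIn c B m n ⊆ B :=
  fun _ h => h.1

theorem maxIn_nonempty (c : Kind) {B : Set (Row I → Col I)} (hB : B.Nonempty) (m n : ℤ) :
    (maxIn c B m n).Nonempty := by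
  obtain ⟨S, hS, h⟩ := B.toFinite.exists_maximalFor (lin c m n) B hB
  exact ⟨S, hS, fun T hT => (le_total _ _).elim id fun hle => h hT hle⟩

theorem mem_maxIn_iff {B : Set (Row I → Col I)} {m n : ℤ} {S₀ S : Row I → Col I}
    (h0 : S₀ ∈ maxIn c B m n) : S ∈ maxIn c B m n ↔ S ∈ B ∧ lin c m n S = lin c m n S₀ :=
  ⟨fun h => ⟨h.1, le_antisymm (h0.2 S h.1) (h.2 S₀ h0.1)⟩,
    fun h => ⟨h.1, fun T hT => (h0.2 T hT).trans h.2.ge⟩⟩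

theorem facePoint_ne_zero {B : Set (Row I → Col I)} (hB : B ⊆ fullSet c I) {a b : Kˣ}
    {S : Row I → Col I} : facePoint c B a b S ≠ 0 ↔ S ∈ B := by
  rw [facePoint]
  split_ifs with h
  · exact iff_of_true (mul_ne_zero (hB h) (Units.ne_zero _)) h
  · exact iff_of_false (fun h => h rfl) h

theorem facePoint_of_mem {B : Set (Row I → Col I)} {a b : Kˣ} {S : Row I → Col I} (h : S ∈ B) :
    facePoint c B a b S = coordCoeff c S * ((a ^ expo c S 0 * b ^ expo c S 1 : Kˣ) : K) :=
  if_pos h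

theorem facePoint_of_not_mem {B : Set (Row I → Col I)} {a b : Kˣ} {S : Row I → Col I}
    (h : S ∉ B) : facePoint c B a b S = 0 := if_neg h

theorem isPlucker_facePoint_fullSet (c : Kind) (hmon : IsMonomialIdeal I)
    [Module.Finite K (PS K ⧸ I)] (a b : Kˣ) :
    IsPlucker I (I.map (c.aut (a : K) (b : K))) (facePoint c (fullSet c I) a b) := by
  convert isPlucker_map_aut_units c hmon a b using 2 with S
  by_cases h : S ∈ fullSet c I
  · exact facePoint_of_mem h
  · have : coordCoeff c S = 0 := not_not.1 h
    rw [facePoint_of_not_mem h, this, zero_mul]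

/-- Restricting to the columns on which $(m,n)$ is largest is passing to the initial ideal for
`c.weight m n`. -/
theorem exists_isPlucker_maxIn [Nonempty (Row I)] {B : Set (Row I → Col I)}
    (hB : B ⊆ fullSet c I) (hne : B.Nonempty) {a b : Kˣ} {J : Ideal (PS K)}
    (hJ : IsPlucker I J (facePoint c B a b)) (m n : ℤ) :
    ∃ J', IsPlucker I J' (facePoint c (maxIn c B m n) a b) := by
  obtain ⟨S₀, h0⟩ := maxIn_nonempty c hne m n
  obtain ⟨J', h'⟩ := hJ.exists_initial (c.weight m n) ((facePoint_ne_zero hB).2 h0.1)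
    fun S hS => by
      rw [colWt_weight, colWt_weight]
      have := h0.2 S ((facePoint_ne_zero hB).1 hS)
      omega
  refine ⟨J', ?_⟩
  convert h' using 2 with S
  rw [colWt_weight, colWt_weight, if_congr (add_left_inj _) rfl rfl]
  by_cases hS : S ∈ B
  · by_cases hl : lin c m n S = lin c m n S₀
    · rw [if_pos hl, facePoint_of_mem hS, facePoint_of_mem ((mem_maxIn_iff h0).2 ⟨hS, hl⟩)]
    · rw [if_neg hl, facePoint_of_not_mem fun h => hl ((mem_maxIn_iff h0).1 h).2]
  · rw [facePoint_of_not_mem hS, ite_self, facePoint_of_not_mem fun h => hS h.1]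

theorem facePoint_mul_zpow (B : Set (Row I → Col I)) (a b t : Kˣ) (i j : ℤ) (S : Row I → Col I) :
    facePoint c B (a * t ^ i) (b * t ^ j) S =
      ((t ^ lin c i j S : Kˣ) : K) * facePoint c B a b S := by
  by_cases h : S ∈ B
  · rw [facePoint_of_mem h, facePoint_of_mem h, mul_left_comm, ← Units.val_mul]
    congr 2
    rw [mul_zpow, mul_zpow, ← zpow_mul, ← zpow_mul, lin, zpow_add]
    simp only [mul_assoc, mul_comm, mul_left_comm]
  · rw [facePoint_of_not_mem h, facePoint_of_not_mem h, mul_zero]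

theorem isLimitAtInfinity_maxIn [Nonempty (Row I)] {B : Set (Row I → Col I)} (hne : B.Nonempty)
    {a b : Kˣ} {i j : ℤ} {F : Kˣ → Ideal (PS K)} {J : Ideal (PS K)}
    (hF : ∀ t, IsPlucker I (F t) (facePoint c B (a * t ^ i) (b * t ^ j)))
    (hJ : IsPlucker I J (facePoint c (maxIn c B i j) a b)) : IsLimitAtInfinity I F J := by
  classical
  obtain ⟨S₀, h0⟩ := maxIn_nonempty c hne i j
  -- The exponents of $t$ may be negative; a common factor $t^s$ turns the coordinates into
  -- polynomials without changing the point.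
  obtain ⟨s, hs⟩ : ∃ s : ℤ, ∀ S : Row I → Col I, 0 ≤ lin c i j S + s := by
    obtain ⟨s, hs⟩ := (Set.finite_range fun S : Row I → Col I => lin c i j S).bddBelow
    exact ⟨-s, fun S => by have := hs ⟨S, rfl⟩; dsimp only at this; omega⟩
  refine ⟨fun S => Polynomial.monomial (lin c i j S + s).toNat (facePoint c B a b S),
    (lin c i j S₀ + s).toNat, fun S => ?_, Filter.Eventually.of_forall fun t => ?_, ?_⟩
  · by_cases h : S ∈ B
    · refine (Polynomial.natDegree_monomial_le _).trans (Int.toNat_le_toNat ?_)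
      have := h0.2 S h
      omega
    · simp [facePoint_of_not_mem h]
  · convert (hF t).smul (Units.ne_zero (t ^ s)) using 2 with S
    rw [facePoint_mul_zpow, Polynomial.eval_monomial, ← mul_assoc, ← Units.val_mul, ← zpow_add,
      mul_comm, ← Units.val_pow_eq_pow_val, ← zpow_natCast, Int.toNat_of_nonneg (hs S), add_comm]
  · convert hJ using 2 with S
    rw [Polynomial.coeff_monomial]
    by_cases h : S ∈ B
    · by_cases hl : lin c i j S = lin c i j S₀
      · rw [if_pos (by rw [hl]), facePoint_of_mem h,
          facePoint_of_mem ((mem_maxIn_iff h0).2 ⟨h, hl⟩)]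
      · rw [if_neg, facePoint_of_not_mem fun h' => hl ((mem_maxIn_iff h0).1 h').2]
        have h1 := hs S
        have h2 := hs S₀
        omega
    · rw [facePoint_of_not_mem h, ite_self, facePoint_of_not_mem fun h' => h h'.1]

end

section

variable {K : Type*} [Field K]

/-! ### Points of the closure of the orbit -/

/-- $K^*$ has all roots, so it is divisible, that is, an injective $\mathbb Z$-module. -/
theorem units_baer [IsAlgClosed K] : Module.Baer ℤ (Additive Kˣ) := by
  let _ : DivisibleBy (Additive Kˣ) ℕ := divisibleByOfSMulRightSurj _ _ fun {n} hn x => by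
    obtain ⟨z, hz⟩ := IsAlgClosed.exists_pow_nat_eq (x.toMul : K) (Nat.pos_of_ne_zero hn)
    have hz0 : z ≠ 0 := by
      rintro rfl
      rw [zero_pow hn] at hz
      exact x.toMul.ne_zero hz.symm
    exact ⟨Additive.ofMul (Units.mk0 z hz0), congrArg Additive.ofMul (Units.ext hz)⟩
  let _ : DivisibleBy (Additive Kˣ) ℤ := AddGroup.divisibleByIntOfDivisibleByNat _
  exact Module.Baer.of_divisible _

/-- A family of units that satisfies the multiplicative relations between integral vectors comes
from a character. -/
theorem exists_character [IsAlgClosed K] {ι κ : Type*} [Fintype ι] [Fintype κ] (q : ι → Kˣ)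
    (d : ι → κ → ℤ) (h : ∀ n : ι → ℤ, ∑ i, n i • d i = 0 → ∏ i, q i ^ n i = 1) :
    ∃ χ : κ → Kˣ, ∀ i, q i = ∏ k, χ k ^ d i k := by
  classical
  let E := Fintype.linearCombination ℤ d
  let Φ := Fintype.linearCombination ℤ fun i => Additive.ofMul (q i)
  have hker : LinearMap.ker E ≤ LinearMap.ker Φ := by
    intro n hn
    rw [LinearMap.mem_ker, Fintype.linearCombination_apply] at hn ⊢
    have h1 := congrArg Additive.ofMul (h n hn)
    rw [ofMul_prod, ofMul_one] at h1
    exact h1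
  have hinj : Function.Injective ((LinearMap.ker E).liftQ E le_rfl) := by
    rw [← LinearMap.ker_eq_bot, Submodule.ker_liftQ_eq_bot _ _ _ le_rfl]
  -- The relations make the $q_i$ a homomorphism on the sublattice spanned by the $d_i$; injectivity
  -- extends it to the whole lattice.
  obtain ⟨G, hG⟩ := units_baer.extension_property _ hinj ((LinearMap.ker E).liftQ Φ hker)
  refine ⟨fun k => (G (Pi.single k 1)).toMul, fun i => ?_⟩
  have h1 := LinearMap.congr_fun hG (Submodule.Quotient.mk (Pi.single i 1))
  rw [LinearMap.comp_apply, Submodule.liftQ_apply, Submodule.liftQ_apply,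
    Fintype.linearCombination_apply_single, Fintype.linearCombination_apply_single, one_smul,
    one_smul] at h1
  have h2 : d i = ∑ k, d i k • (Pi.single k 1 : κ → ℤ) := by
    ext k
    simp [Finset.sum_apply, Pi.single_apply]
  rw [h2, map_sum] at h1
  have h3 := congrArg Additive.toMul h1
  rw [toMul_sum, toMul_ofMul] at h3
  rw [← h3]
  refine Finset.prod_congr rfl fun k _ => ?_
  rw [map_zsmul, toMul_zsmul]

variable {c : Kind} {I : Ideal (PS K)}

/-- Splits an integral relation into its positive and negative parts, giving two monomials with
natural exponents. -/
theorem sum_toNat_eq {ι : Type*} [Fintype ι] {n d : ι → ℤ} {e : ι → ℕ} (he : ∀ i, (e i : ℤ) = d i)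
    (h : ∑ i, n i * d i = 0) : ∑ i, (n i).toNat * e i = ∑ i, (-n i).toNat * e i := by
  have : (∑ i, ((n i).toNat * e i : ℤ)) - ∑ i, ((-n i).toNat * e i : ℤ) = 0 := by
    rw [← Finset.sum_sub_distrib, ← h]
    refine Finset.sum_congr rfl fun i _ => ?_
    rw [← sub_mul, he]
    congr 1
    omega
  have := sub_eq_zero.1 this
  exact_mod_cast this

/-- A binomial relation satisfied by all points of the closure of the orbit. -/
theorem prod_div_zpow_eq_one (hmon : IsMonomialIdeal I)
    [Module.Finite K (PS K ⧸ I)] (hI : HasMeasuringSequence I c.fst c.snd)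
    {J : Ideal (PS K)} (hJ : J ∈ orbitClosure I) {p : (Row I → Col I) → K} (hp : IsPlucker I J p)
    {B : Set (Row I → Col I)} [Fintype B] (hB : B ⊆ fullSet c I) (hpB : ∀ S : B, p S.1 ≠ 0)
    (n : B → ℤ) (h0 : ∑ S, n S = 0) (h1 : ∀ k, ∑ S : B, n S * expo c S.1 k = 0) :
    ∏ S : B, (p S.1 / coordCoeff c S.1) ^ n S = 1 := by
  choose e he he' using fun S : Row I → Col I => exists_coordFun_eq c S
  set n₁ : B → ℕ := fun S => (n S).toNat with hn₁
  set n₂ : B → ℕ := fun S => (-n S).toNat with hn₂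
  have hκ : ∀ S : B, coordCoeff c S.1 ≠ 0 := fun S => hB S.2
  have hsum : ∑ S, n₁ S = ∑ S, n₂ S := by
    simpa using sum_toNat_eq (n := n) (d := fun _ => 1) (e := fun _ => 1) (by simp) (by simpa)
  have hexp : ∀ k, ∑ S : B, n₁ S * e S.1 k = ∑ S : B, n₂ S * e S.1 k := fun k =>
    sum_toNat_eq (fun S : B => he' S.1 (hκ S) k) (h1 k)
  let M : (B → ℕ) → MvPolynomial (Row I → Col I) K := fun n => ∏ S : B, MvPolynomial.X S.1 ^ n S
  have hM : ∀ n : B → ℕ, (M n).IsHomogeneous (∑ S, n S) := fun n =>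
    MvPolynomial.IsHomogeneous.prod _ _ _ fun S _ => by
      simpa using (MvPolynomial.isHomogeneous_X K S.1).pow (n S)
  let κ : (B → ℕ) → K := fun n => ∏ S : B, coordCoeff c S.1 ^ n S
  have hevM : ∀ (x : (Row I → Col I) → K) (n : B → ℕ),
      MvPolynomial.eval x (M n) = ∏ S : B, x S.1 ^ n S := by
    intro x n
    simp only [M, map_prod, map_pow, MvPolynomial.eval_X]
  -- The binomial attached to the relation `n`; it is homogeneous because the entries of `n` sum to
  -- zero.
  have hQ : (MvPolynomial.C (κ n₂) * M n₁ - MvPolynomial.C (κ n₁) * M n₂).IsHomogeneous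
      (∑ S, n₁ S) := by
    refine MvPolynomial.IsHomogeneous.sub ((hM n₁).C_mul _) ?_
    rw [hsum]
    exact (hM n₂).C_mul _
  have hvan := eval_eq_zero_of_mem_orbitClosure hJ hp hQ ?_
  · rw [map_sub, map_mul, map_mul, MvPolynomial.eval_C, MvPolynomial.eval_C, hevM, hevM] at hvan
    have hnn : ∀ S : B, (p S.1 / coordCoeff c S.1) ^ n S =
        (p S.1 ^ n₁ S * coordCoeff c S.1 ^ n₂ S) / (coordCoeff c S.1 ^ n₁ S * p S.1 ^ n₂ S) := by
      intro S
      have hn : n S = (n₁ S : ℤ) - (n₂ S : ℤ) := by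
        simp only [hn₁, hn₂]; omega
      have := hpB S
      have := hκ S
      rw [hn, zpow_sub₀ (div_ne_zero (hpB S) (hκ S)), zpow_natCast, zpow_natCast, div_pow, div_pow]
      field_simp
    rw [Finset.prod_congr rfl fun S _ => hnn S, Finset.prod_div_distrib, Finset.prod_mul_distrib,
      Finset.prod_mul_distrib, div_eq_one_iff_eq]
    · linear_combination hvan
    · exact mul_ne_zero (Finset.prod_ne_zero_iff.2 fun S _ => pow_ne_zero _ (hκ S))
        (Finset.prod_ne_zero_iff.2 fun S _ => pow_ne_zero _ (hpB S))
  · rintro J' ⟨σ, hσ, rfl⟩ p' hp'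
    -- The parameters may vanish here, so the computation uses natural exponents rather than integer
    -- powers of units.
    obtain ⟨a, b, hab⟩ := exists_map_eq_aut hI hσ
    rw [hab] at hp'
    obtain ⟨r, -, hr⟩ := (isPlucker_map_aut c hmon a b).exists_smul hp'
    have hprod : ∀ n : B → ℕ, ∏ S : B, p' S.1 ^ n S =
        r ^ (∑ S, n S) * κ n * (a ^ (∑ S : B, n S * e S.1 0) * b ^ (∑ S : B, n S * e S.1 1)) := by
      intro n
      have hterm : ∀ S : B, p' S.1 ^ n S = r ^ n S * coordCoeff c S.1 ^ n S *
          (a ^ (n S * e S.1 0) * b ^ (n S * e S.1 1)) := by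
        intro S
        rw [hr, he, MvPolynomial.eval_monomial, Finsupp.prod_fintype _ _ fun i => pow_zero _,
          Fin.prod_univ_two, mul_comm (n S), mul_comm (n S), pow_mul, pow_mul, mul_pow, mul_pow,
          mul_pow, mul_assoc]
        rfl
      rw [Finset.prod_congr rfl fun S _ => hterm S]
      simp only [Finset.prod_mul_distrib, Finset.prod_pow_eq_pow_sum, κ]
    rw [map_sub, map_mul, map_mul, MvPolynomial.eval_C, MvPolynomial.eval_C, hevM, hevM, hprod,
      hprod, hsum, hexp, hexp]
    ring

/-- A point of the closure of the orbit whose nonzero Plücker coordinates are those in `B` is given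
by the coordinate functions. -/
theorem exists_eq_facePoint [IsAlgClosed K] (hmon : IsMonomialIdeal I)
    [Module.Finite K (PS K ⧸ I)] [Nonempty (Row I)] (hI : HasMeasuringSequence I c.fst c.snd)
    {J : Ideal (PS K)} (hJ : J ∈ orbitClosure I) {p : (Row I → Col I) → K} (hp : IsPlucker I J p)
    {B : Set (Row I → Col I)} (hB : B ⊆ fullSet c I) (hpB : ∀ S, p S ≠ 0 ↔ S ∈ B) :
    ∃ a b : Kˣ, IsPlucker I J (facePoint c B a b) := by
  have := Fintype.ofFinite B
  have hp0 : ∀ S : B, p S.1 / coordCoeff c S.1 ≠ 0 := fun S =>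
    div_ne_zero ((hpB S).2 S.2) (hB S.2)
  -- The entry 1 encodes homogeneity: `χ 0` is the common projective factor, `χ 1` and `χ 2` are the
  -- parameters $a$ and $b$.
  obtain ⟨χ, hχ⟩ := exists_character (fun S : B => Units.mk0 _ (hp0 S))
    (fun S : B => ![1, expo c S.1 0, expo c S.1 1]) fun n hn => by
      have hn' : ∀ k : Fin 3, ∑ S : B, n S * (![1, expo c S.1 0, expo c S.1 1] : Fin 3 → ℤ) k = 0 :=
        fun k => by
          have := congrFun hn k
          rw [Finset.sum_apply] at this
          exact this
      have h := prod_div_zpow_eq_one hmon hI hJ hp hB (fun S => (hpB S).2 S.2) n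
        (by simpa using hn' 0) fun k => by
          fin_cases k
          · simpa using hn' 1
          · simpa using hn' 2
      apply Units.ext
      rw [Units.coe_prod]
      simpa using h
  refine ⟨χ 1, χ 2, ?_⟩
  convert hp.smul (Units.ne_zero (χ 0)⁻¹) using 2 with S
  by_cases hS : S ∈ B
  · have h := congrArg Units.val (hχ ⟨S, hS⟩)
    rw [Fin.prod_univ_three, mul_assoc] at h
    simp only [Units.val_mk0, Matrix.cons_val_zero, zpow_one, Units.val_mul (χ 0)] at h
    rw [div_eq_iff (hB hS)] at h
    rw [facePoint_of_mem hS, h, mul_assoc, Units.inv_mul_cancel_left, mul_comm]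
    rfl
  · rw [facePoint_of_not_mem hS, not_not.1 (mt (hpB S).1 hS), mul_zero]

end

section

variable {K : Type*} [Field K] {c : Kind} {I : Ideal (PS K)}

/-! ### The polygon and its faces -/

/-- The exponent vector of the coordinate function for the columns `S`, as a point of the plane. -/
def vec (c : Kind) (S : Row I → Col I) : ℝ × ℝ := ((expo c S 0 : ℝ), (expo c S 1 : ℝ))

theorem exists_support_iff {S : Row I → Col I} {X : Set (ℝ × ℝ)} :
    (∃ e ∈ (coordFun c I S).support, expVec e ∈ X) ↔ S ∈ fullSet c I ∧ vec c S ∈ X := by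
  have hvec : ∀ e : Fin 2 →₀ ℕ, (∀ k, (e k : ℤ) = expo c S k) → expVec e = vec c S := by
    intro e he
    rw [expVec, vec, ← he, ← he, Int.cast_natCast, Int.cast_natCast]
  constructor
  · rintro ⟨e, he, hX⟩
    rw [mem_support_coordFun] at he
    exact ⟨he.1, hvec e he.2 ▸ hX⟩
  · rintro ⟨hS, hX⟩
    obtain ⟨e, -, he⟩ := exists_coordFun_eq c S
    exact ⟨e, mem_support_coordFun.2 ⟨hS, he hS⟩, by rwa [hvec e (he hS)]⟩

theorem polygon_eq (c : Kind) (I : Ideal (PS K)) :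
    polygon c I = convexHull ℝ (vec c '' fullSet c I) := by
  rw [polygon]
  congr 1
  ext u
  constructor
  · rintro ⟨S, e, he, rfl⟩
    obtain ⟨h1, h2⟩ := exists_support_iff.1 ⟨e, he, Set.mem_singleton _⟩
    exact ⟨S, h1, h2⟩
  · rintro ⟨S, hS, rfl⟩
    obtain ⟨e, he, h⟩ := exists_support_iff.2 ⟨hS, Set.mem_singleton _⟩
    exact ⟨S, e, he, (Set.mem_singleton_iff.1 h).symm⟩

theorem vec_mem_polygon {S : Row I → Col I} (hS : S ∈ fullSet c I) : vec c S ∈ polygon c I := by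
  rw [polygon_eq]
  exact subset_convexHull ℝ _ ⟨S, hS, rfl⟩

theorem pair_combo (w u v : ℝ × ℝ) (r s : ℝ) :
    pair w (r • u + s • v) = r * pair w u + s * pair w v := by
  simp only [pair, Prod.fst_add, Prod.snd_add, Prod.smul_fst, Prod.smul_snd, smul_eq_mul]
  ring

theorem pair_le_of_mem_polygon {w : ℝ × ℝ} {r : ℝ}
    (h : ∀ S ∈ fullSet c I, pair w (vec c S) ≤ r) {u : ℝ × ℝ} (hu : u ∈ polygon c I) :
    pair w u ≤ r := by
  rw [polygon_eq] at hu
  refine convexHull_min (t := {u | pair w u ≤ r}) ?_ ?_ hu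
  · rintro _ ⟨S, hS, rfl⟩
    exact h S hS
  · intro x hx y hy a b ha hb hab
    have hx : pair w x ≤ r := hx
    have hy : pair w y ≤ r := hy
    change pair w (a • x + b • y) ≤ r
    rw [pair_combo]
    calc a * pair w x + b * pair w y ≤ a * r + b * r := by gcongr
      _ = r := by rw [← add_mul, hab, one_mul]

theorem vec_mem_face {w : ℝ × ℝ} {S : Row I → Col I} (hS : S ∈ fullSet c I) :
    vec c S ∈ face (polygon c I) w ↔ ∀ T ∈ fullSet c I, pair w (vec c T) ≤ pair w (vec c S) :=
  ⟨fun h _ hT => h.2 _ (vec_mem_polygon hT),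
    fun h => ⟨vec_mem_polygon hS, fun _ hv => pair_le_of_mem_polygon h hv⟩⟩

theorem pair_smul (r : ℝ) (w u : ℝ × ℝ) : pair (r • w) u = r * pair w u := by
  simp only [pair, Prod.smul_fst, Prod.smul_snd, smul_eq_mul]
  ring

theorem dualFace_ray (H : Set (ℝ × ℝ)) (w : ℝ × ℝ) : dualFace H (ray w) = face H w := by
  ext u
  constructor
  · exact fun h => h.2 w ⟨1, zero_le_one, (one_smul _ _).symm⟩
  · rintro ⟨hu, h⟩
    refine ⟨hu, ?_⟩
    rintro _ ⟨r, hr, rfl⟩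
    refine ⟨hu, fun v hv => ?_⟩
    rw [pair_smul, pair_smul]
    exact mul_le_mul_of_nonneg_left (h v hv) hr

theorem pair_vec (m n : ℤ) (S : Row I → Col I) :
    pair ((m : ℝ), (n : ℝ)) (vec c S) = (lin c m n S : ℝ) := by
  simp only [pair, vec, lin]
  push_cast
  rfl

theorem vec_mem_face_iff {m n : ℤ} {S : Row I → Col I} :
    S ∈ fullSet c I ∧ vec c S ∈ face (polygon c I) ((m : ℝ), (n : ℝ)) ↔
      S ∈ maxIn c (fullSet c I) m n := by
  refine and_congr_right fun hS => ?_
  rw [vec_mem_face hS]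
  simp only [pair_vec, Int.cast_le]

theorem mem_torusOrbit_iff {σ : Set (ℝ × ℝ)} {B : Set (Row I → Col I)}
    (hB : ∀ S, S ∈ fullSet c I ∧ vec c S ∈ dualFace (polygon c I) σ ↔ S ∈ B)
    {J : Ideal (PS K)} : J ∈ torusOrbit c I σ ↔
      J ∈ orbitClosure I ∧ ∃ p, IsPlucker I J p ∧ ∀ S, p S ≠ 0 ↔ S ∈ B := by
  simp only [torusOrbit, exists_support_iff, hB]
  rfl

theorem mem_torusOrbit_iff_facePoint [IsAlgClosed K] (hmon : IsMonomialIdeal I)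
    [Module.Finite K (PS K ⧸ I)] [Nonempty (Row I)] (hI : HasMeasuringSequence I c.fst c.snd)
    {σ : Set (ℝ × ℝ)} {B : Set (Row I → Col I)}
    (hB : ∀ S, S ∈ fullSet c I ∧ vec c S ∈ dualFace (polygon c I) σ ↔ S ∈ B)
    {J : Ideal (PS K)} : J ∈ torusOrbit c I σ ↔
      J ∈ orbitClosure I ∧ ∃ a b : Kˣ, IsPlucker I J (facePoint c B a b) := by
  have hBf : B ⊆ fullSet c I := fun S hS => ((hB S).2 hS).1
  rw [mem_torusOrbit_iff hB]
  refine and_congr_right fun hJ => ⟨?_, ?_⟩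
  · rintro ⟨p, hp, hpB⟩
    exact exists_eq_facePoint hmon hI hJ hp hBf hpB
  · rintro ⟨a, b, h⟩
    exact ⟨_, h, fun S => facePoint_ne_zero hBf⟩

/-! ### The two-dimensional cones -/

/-- The vertex `v` is the only point of the polygon on which `w` is largest. -/
def IsStrictMax (c : Kind) (I : Ideal (PS K)) (w v : ℝ × ℝ) : Prop :=
  v ∈ vec c '' fullSet c I ∧ ∀ S ∈ fullSet c I, vec c S ≠ v → pair w (vec c S) < pair w v

theorem IsStrictMax.face_eq {w v : ℝ × ℝ} (h : IsStrictMax c I w v) :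
    face (polygon c I) w = {v} := by
  obtain ⟨⟨S₀, h0, rfl⟩, h⟩ := h
  ext u
  rw [Set.mem_singleton_iff]
  constructor
  · rintro ⟨hu, hmax⟩
    -- The vertex together with the open half-plane below it is convex and contains all exponent
    -- vectors.
    have hsub : polygon c I ⊆ {u | u = vec c S₀ ∨ pair w u < pair w (vec c S₀)} := by
      rw [polygon_eq]
      refine convexHull_min ?_ ?_
      · rintro _ ⟨S, hS, rfl⟩
        by_cases he : vec c S = vec c S₀
        · exact Or.inl he
        · exact Or.inr (h S hS he)
      · intro x hx y hy a b ha hb hab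
        have hle : ∀ z, (z = vec c S₀ ∨ pair w z < pair w (vec c S₀)) →
            pair w z ≤ pair w (vec c S₀) := by
          rintro z (rfl | hz)
          exacts [le_rfl, hz.le]
        have hone : pair w (vec c S₀) = a * pair w (vec c S₀) + b * pair w (vec c S₀) := by
          rw [← add_mul, hab, one_mul]
        rcases ha.eq_or_lt with rfl | ha'
        · rw [zero_add] at hab
          rw [hab, zero_smul, zero_add, one_smul]
          exact hy
        rcases hb.eq_or_lt with rfl | hb'
        · rw [add_zero] at hab
          rw [hab, zero_smul, add_zero, one_smul]
          exact hx
        rcases hx with rfl | hx'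
        · rcases hy with rfl | hy'
          · left
            rw [← add_smul, hab, one_smul]
          · right
            rw [pair_combo]
            nlinarith [mul_lt_mul_of_pos_left hy' hb']
        · right
          rw [pair_combo]
          nlinarith [mul_lt_mul_of_pos_left hx' ha', mul_le_mul_of_nonneg_left (hle y hy) hb]
    rcases hsub hu with rfl | hlt
    · rfl
    · exact absurd (hmax _ (vec_mem_polygon h0)) (not_le.2 hlt)
  · rintro rfl
    refine (vec_mem_face h0).2 fun T hT => ?_
    by_cases he : vec c T = vec c S₀
    · rw [he]
    · exact (h T hT he).le

theorem continuous_pair (u : ℝ × ℝ) : Continuous fun w => pair w u := by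
  unfold pair
  fun_prop

theorem face_nonempty (hne : (fullSet c I).Nonempty) (w : ℝ × ℝ) :
    ∃ S ∈ fullSet c I, vec c S ∈ face (polygon c I) w := by
  obtain ⟨S, hS, h⟩ := (fullSet c I).toFinite.exists_maximalFor (fun S => pair w (vec c S)) _ hne
  exact ⟨S, hS, (vec_mem_face hS).2 fun T hT => (le_total _ _).elim id fun hle => h hT hle⟩

/-- A strict maximum over finitely many vectors persists for nearby directions. -/
theorem IsStrictMax.interior_nonempty {w v : ℝ × ℝ} (h : IsStrictMax c I w v) :
    (interior (normalCone (polygon c I) {v})).Nonempty := by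
  have hopen : IsOpen {w | ∀ S ∈ {S ∈ fullSet c I | vec c S ≠ v},
      pair w (vec c S) < pair w v} := by
    have : {w | ∀ S ∈ {S ∈ fullSet c I | vec c S ≠ v}, pair w (vec c S) < pair w v} =
        ⋂ S ∈ {S ∈ fullSet c I | vec c S ≠ v}, {w | pair w (vec c S) < pair w v} := by
      ext; simp
    rw [this]
    exact (Set.toFinite _).isOpen_biInter fun S _ =>
      isOpen_lt (continuous_pair _) (continuous_pair _)
  refine ⟨w, mem_interior.2 ⟨_, fun w' hw' => ?_, hopen, fun S hS => h.2 S hS.1 hS.2⟩⟩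
  have h' : IsStrictMax c I w' v := ⟨h.1, fun S hS hne => hw' S ⟨hS, hne⟩⟩
  exact h'.face_eq.ge

theorem dualFace_normalCone {w v : ℝ × ℝ} (h : IsStrictMax c I w v) :
    dualFace (polygon c I) (normalCone (polygon c I) {v}) = {v} := by
  ext u
  constructor
  · intro hu
    have := hu.2 w h.face_eq.ge
    rwa [h.face_eq] at this
  · rintro rfl
    obtain ⟨S, hS, hv⟩ := h.1
    exact ⟨hv ▸ vec_mem_polygon hS, fun w' hw' => hw' rfl⟩

/-- Directions close to `(m, n)` on one side have a unique maximum. -/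
theorem eventually_isStrictMax {m n u₀ u₁ : ℤ} (hdet : m * u₁ - n * u₀ ≠ 0)
    {S₀ : Row I → Col I} (h0 : S₀ ∈ maxIn c (maxIn c (fullSet c I) m n) u₀ u₁) :
    ∀ᶠ ε : ℝ in nhdsWithin 0 (Set.Ioi 0),
      IsStrictMax c I ((m : ℝ) + ε * u₀, (n : ℝ) + ε * u₁) (vec c S₀) := by
  have hfull : S₀ ∈ fullSet c I := h0.1.1
  have hpair : ∀ (ε : ℝ) (S : Row I → Col I),
      pair ((m : ℝ) + ε * u₀, (n : ℝ) + ε * u₁) (vec c S) =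
        (lin c m n S : ℝ) + ε * (lin c u₀ u₁ S : ℝ) := by
    intro ε S
    simp only [pair, vec, lin]
    push_cast
    ring
  have key : ∀ S : Row I → Col I, ∀ᶠ ε : ℝ in nhdsWithin 0 (Set.Ioi 0),
      S ∈ fullSet c I → vec c S ≠ vec c S₀ →
        pair ((m : ℝ) + ε * u₀, (n : ℝ) + ε * u₁) (vec c S) <
          pair ((m : ℝ) + ε * u₀, (n : ℝ) + ε * u₁) (vec c S₀) := by
    intro S
    simp only [hpair]
    rcases lt_trichotomy (lin c m n S) (lin c m n S₀) with hlt | heq | hgt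
    -- For small `ε` the comparison is lexicographic: a difference in the $(m,n)$-value dominates,
    -- and ties are decided by $(u_0,u_1)$.
    · have hc : Filter.Tendsto (fun ε : ℝ => (lin c m n S : ℝ) + ε * (lin c u₀ u₁ S : ℝ)
          - ((lin c m n S₀ : ℝ) + ε * (lin c u₀ u₁ S₀ : ℝ))) (nhdsWithin 0 (Set.Ioi 0))
          (nhds ((lin c m n S : ℝ) - (lin c m n S₀ : ℝ))) := by
        have : Continuous fun ε : ℝ => (lin c m n S : ℝ) + ε * (lin c u₀ u₁ S : ℝ)
          - ((lin c m n S₀ : ℝ) + ε * (lin c u₀ u₁ S₀ : ℝ)) := by fun_prop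
        have h2 := this.tendsto 0
        simp only [zero_mul, add_zero] at h2
        exact h2.mono_left nhdsWithin_le_nhds
      have hneg : (lin c m n S : ℝ) - (lin c m n S₀ : ℝ) < 0 := by
        rw [sub_neg]; exact_mod_cast hlt
      filter_upwards [hc.eventually (gt_mem_nhds hneg)] with ε hε _ _
      linarith
    · filter_upwards [self_mem_nhdsWithin] with ε (hε : 0 < ε) hS hne
      have hS1 : S ∈ maxIn c (fullSet c I) m n := (mem_maxIn_iff h0.1).2 ⟨hS, heq⟩
      have hle := h0.2 S hS1
      have hlt : lin c u₀ u₁ S < lin c u₀ u₁ S₀ := by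
        -- Equality for both functionals would force equal exponent vectors, as the functionals are
        -- independent.
        refine lt_of_le_of_ne hle fun he => hne ?_
        simp only [lin] at he heq
        have e0 : (m * u₁ - n * u₀) * (expo c S 0 - expo c S₀ 0) = 0 := by
          linear_combination u₁ * heq - n * he
        have e1 : (m * u₁ - n * u₀) * (expo c S 1 - expo c S₀ 1) = 0 := by
          linear_combination m * he - u₀ * heq
        rw [vec, vec, sub_eq_zero.1 ((mul_eq_zero.1 e0).resolve_left hdet),
          sub_eq_zero.1 ((mul_eq_zero.1 e1).resolve_left hdet)]
      rw [heq]
      have : (lin c u₀ u₁ S : ℝ) < (lin c u₀ u₁ S₀ : ℝ) := by exact_mod_cast hlt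
      have := mul_lt_mul_of_pos_left this hε
      linarith
    · exact Filter.Eventually.of_forall fun ε hS => absurd (h0.1.2 S hS) (not_le.2 hgt)
  filter_upwards [Filter.eventually_all.2 key] with ε hε
  exact ⟨⟨S₀, hfull, rfl⟩, fun S hS hne => hε S hS hne⟩

/-- On the columns of a vertex the exponents are constant. -/
theorem expo_eq_of_mem {m n u₀ u₁ : ℤ} (hdet : m * u₁ - n * u₀ ≠ 0) {S T : Row I → Col I}
    (hS : S ∈ maxIn c (maxIn c (fullSet c I) m n) u₀ u₁)
    (hT : T ∈ maxIn c (maxIn c (fullSet c I) m n) u₀ u₁) (k : Fin 2) :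
    expo c T k = expo c S k := by
  have he := ((mem_maxIn_iff hS).1 hT).2
  have heq := ((mem_maxIn_iff hS.1).1 hT.1).2
  simp only [lin] at he heq
  have e0 : (m * u₁ - n * u₀) * (expo c T 0 - expo c S 0) = 0 := by
    linear_combination u₁ * heq - n * he
  have e1 : (m * u₁ - n * u₀) * (expo c T 1 - expo c S 1) = 0 := by
    linear_combination m * he - u₀ * heq
  fin_cases k
  · exact sub_eq_zero.1 ((mul_eq_zero.1 e0).resolve_left hdet)
  · exact sub_eq_zero.1 ((mul_eq_zero.1 e1).resolve_left hdet)

/-- At a vertex the exponents are constant, so the parameters enter only through a common factor: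
the orbit is one point. -/
theorem facePoint_vertex {m n u₀ u₁ : ℤ} (hdet : m * u₁ - n * u₀ ≠ 0) {S₀ : Row I → Col I}
    (h0 : S₀ ∈ maxIn c (maxIn c (fullSet c I) m n) u₀ u₁) (a b : Kˣ) (S : Row I → Col I) :
    facePoint c (maxIn c (maxIn c (fullSet c I) m n) u₀ u₁) a b S =
      ((a ^ expo c S₀ 0 * b ^ expo c S₀ 1 : Kˣ) : K) *
        facePoint c (maxIn c (maxIn c (fullSet c I) m n) u₀ u₁) 1 1 S := by
  by_cases hS : S ∈ maxIn c (maxIn c (fullSet c I) m n) u₀ u₁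
  · rw [facePoint_of_mem hS, facePoint_of_mem hS, expo_eq_of_mem hdet h0 hS,
      expo_eq_of_mem hdet h0 hS, one_zpow, one_zpow, mul_one, Units.val_one, mul_one, mul_comm]
  · rw [facePoint_of_not_mem hS, facePoint_of_not_mem hS, mul_zero]

/-- The ideal of the two-dimensional cone next to `(m, n)` on the side of `(u₀, u₁)`. -/
theorem cone_iff [IsAlgClosed K] (hmon : IsMonomialIdeal I)
    [Module.Finite K (PS K ⧸ I)] [Nonempty (Row I)] (hI : HasMeasuringSequence I c.fst c.snd)
    {m n u₀ u₁ : ℤ} (hdet : m * u₁ - n * u₀ ≠ 0) {V : Ideal (PS K)}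
    (hV : IsPlucker I V (facePoint c (maxIn c (maxIn c (fullSet c I) m n) u₀ u₁) 1 1))
    (hVc : V ∈ orbitClosure I) (J : Ideal (PS K)) :
    (∃ σ ∈ standardFan c I, (interior σ).Nonempty ∧
      (∀ᶠ ε : ℝ in nhdsWithin 0 (Set.Ioi 0), ((m : ℝ) + ε * u₀, (n : ℝ) + ε * u₁) ∈ σ) ∧
      J ∈ torusOrbit c I σ) ↔ J = V := by
  set B := maxIn c (maxIn c (fullSet c I) m n) u₀ u₁ with hBdef
  have hfull : (fullSet c I).Nonempty := exists_coordCoeff_ne_zero c hmon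
  obtain ⟨S₀, h0⟩ : B.Nonempty := maxIn_nonempty c (maxIn_nonempty c hfull m n) u₀ u₁
  have hev := eventually_isStrictMax hdet h0
  set v := vec c S₀ with hv
  have hB : ∀ S, S ∈ fullSet c I ∧ vec c S ∈ ({v} : Set (ℝ × ℝ)) ↔ S ∈ B := by
    intro S
    constructor
    · rintro ⟨hS, hSv⟩
      have hSv : vec c S = v := hSv
      have e0 : expo c S 0 = expo c S₀ 0 := by
        have := congrArg Prod.fst hSv; simpa [vec, hv] using this
      have e1 : expo c S 1 = expo c S₀ 1 := by
        have := congrArg Prod.snd hSv; simpa [vec, hv] using this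
      have hlin : ∀ i j, lin c i j S = lin c i j S₀ := fun i j => by rw [lin, lin, e0, e1]
      exact (mem_maxIn_iff h0).2 ⟨(mem_maxIn_iff h0.1).2 ⟨hS, hlin _ _⟩, hlin _ _⟩
    · intro hS
      refine ⟨hS.1.1, ?_⟩
      rw [Set.mem_singleton_iff, hv, vec, vec, expo_eq_of_mem hdet h0 hS,
        expo_eq_of_mem hdet h0 hS]
  obtain ⟨ε₀, hε₀⟩ := hev.exists
  have hmem : J ∈ torusOrbit c I (normalCone (polygon c I) {v}) ↔ J = V := by
    rw [mem_torusOrbit_iff_facePoint hmon hI (B := B) (by rwa [dualFace_normalCone hε₀])]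
    constructor
    · rintro ⟨-, a, b, hJ⟩
      exact (hV.eq_of_smul hJ (Units.ne_zero _) fun S => facePoint_vertex hdet h0 a b S).symm
    · rintro rfl
      exact ⟨hVc, 1, 1, hV⟩
  rw [← hmem]
  constructor
  -- A cone of the fan containing nearby directions is the normal cone of a nonempty face contained
  -- in $\{v\}$, hence of the vertex itself.
  · rintro ⟨_, ⟨w, rfl⟩, -, hσ, hJ⟩
    obtain ⟨ε, hε, hεσ⟩ := (hev.and hσ).exists
    obtain ⟨S, hS, hSw⟩ := face_nonempty hfull w
    have hsub : face (polygon c I) w ⊆ {v} := by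
      rw [← hε.face_eq]; exact hεσ
    have hSv : vec c S = v := hsub hSw
    have hface : face (polygon c I) w = {v} :=
      hsub.antisymm (by rintro _ rfl; rwa [← hSv])
    rwa [hface] at hJ
  · intro hJ
    refine ⟨_, ⟨_, by rw [hε₀.face_eq]⟩, hε₀.interior_nonempty, ?_, hJ⟩
    filter_upwards [hev] with ε hε
    exact hε.face_eq.ge

end

section

open MvPowerSeries

variable {K : Type*} [Field K] {c : Kind} {I J : Ideal (PS K)} {S₀ : Row I → Col I}
  {v : Row I → PS K} {p : (Row I → Col I) → K}

/-! ### Graded pieces -/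

/-- In both cases the two weights form a matrix of determinant $-1$. -/
theorem Kind.eq_of_wt_axis (c : Kind) {e d : Fin 2 →₀ ℕ}
    (h : ∀ k, wt (c.axis k) e = wt (c.axis k) d) : e = d := by
  have h0 := h 0
  have h1 := h 1
  ext i
  cases c <;> fin_cases i <;> simp [wt, Kind.axis, Kind.weight] at h0 h1 ⊢ <;> omega

theorem IsReducedBasis.injective (hv : IsReducedBasis I J S₀ v) :
    Function.Injective fun i => (S₀ i).1 := by
  intro i j hij
  have h1 := hv.coeff_eq i i
  have h2 := hv.coeff_eq i j
  dsimp only at hij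
  rw [if_pos rfl, hij, h2] at h1
  by_contra hne
  rw [if_neg hne] at h1
  exact zero_ne_one h1

/-- `J` is spanned, modulo `(x, y) ^ N`, by the monomials in `D`. -/
def SpannedBy (n : ℕ) (J : Ideal (PS K)) (D : Set (Fin 2 →₀ ℕ)) : Prop :=
  ∀ f, f ∈ J ↔ ∀ e : Fin 2 →₀ ℕ, e.degree < n → coeff e f ≠ 0 → e ∈ D

theorem SpannedBy.isMonomialIdeal {n : ℕ} {D : Set (Fin 2 →₀ ℕ)} (h : SpannedBy n J D) :
    IsMonomialIdeal J := by
  classical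
  refine isMonomialIdeal_of_mon_mem (n := n) (fun f hf => (h f).2 fun e he hne =>
    absurd (mem_maxIdeal_pow.1 hf e he) hne) fun f hf e he hne => (h _).2 fun d _ hd => ?_
  rw [coeff_mon] at hd
  have : d = e := by by_contra hde; exact hd (if_neg hde)
  rw [this]
  exact (h f).1 hf e he hne

/-- A term `e` of the `i`-th reduced basis vector may replace the `i`-th column of `S₀`. Constant
exponents then force `e` to have the biweight of that column, so to equal it; the basis consists of
monomials modulo $(x,y)^N$. -/
theorem spannedBy_of_expo_eq (hJ : IsPlucker I J p) (h0 : p S₀ ≠ 0)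
    (hexp : ∀ S, p S ≠ 0 → ∀ k, expo c S k = expo c S₀ k) :
    SpannedBy (trunc I) J (Set.range fun i => (S₀ i).1) := by
  classical
  obtain ⟨v, hv, hp⟩ := hJ.exists_reduced h0
  have hcoeff : ∀ i, ∀ e : Fin 2 →₀ ℕ, e.degree < trunc I → coeff e (v i) ≠ 0 →
      (S₀ i).1 = e := by
    intro i e he hne
    rw [IsPlucker.coeff_eq_div hv hp h0 i ⟨e, he⟩] at hne
    have h1 := hexp _ (div_ne_zero_iff.1 hne).1
    refine c.eq_of_wt_axis fun k => ?_
    have h2 := h1 k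
    rw [expo, expo, colWt_update] at h2
    change _ - _ + wt (c.axis k) e - _ = _ at h2
    omega
  intro f
  constructor
  · intro hf e he hne
    rw [hv.coeff_of_mem hf he] at hne
    obtain ⟨i, -, hi⟩ := Finset.exists_ne_zero_of_sum_ne_zero hne
    exact ⟨i, hcoeff i e he (right_ne_zero_of_mul hi)⟩
  · intro h
    refine mem_of_forall_mon_mem hJ.1 fun e he hne => ?_
    obtain ⟨i, rfl⟩ := h e he hne
    rw [← sub_sub_self (v i) (mon K (S₀ i).1)]
    refine sub_mem (hv.mem i) (hJ.1 (mem_maxIdeal_pow.2 fun d hd => ?_))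
    rw [map_sub, sub_eq_zero, coeff_mon]
    split_ifs with hde
    · rw [hde, hv.coeff_eq, if_pos rfl]
    · by_contra hne'
      exact hde (hcoeff i d hd hne').symm

/-- The truncations of the elements of `J` without terms of weight `> k`. -/
def lowPart (I J : Ideal (PS K)) (w : Fin 2 → ℤ) (k : ℤ) : Submodule K (Col I → K) where
  carrier := {x | ∃ f ∈ J, (∀ j, x j = coeff j.1 f) ∧ ∀ j, x j ≠ 0 → wt w j.1 ≤ k}
  zero_mem' := ⟨0, J.zero_mem, fun j => by simp, fun j hj => absurd rfl hj⟩
  add_mem' := by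
    rintro x y ⟨f, hf, hxf, hx⟩ ⟨g, hg, hyg, hy⟩
    refine ⟨f + g, J.add_mem hf hg, fun j => by rw [Pi.add_apply, hxf, hyg, map_add],
      fun j hj => ?_⟩
    by_cases h : x j = 0
    · exact hy j fun h' => hj (by rw [Pi.add_apply, h, h', add_zero])
    · exact hx j h
  smul_mem' := by
    rintro a x ⟨f, hf, hxf, hx⟩
    refine ⟨a • f, smul_mem_ideal a hf, fun j => by rw [Pi.smul_apply, hxf]; rfl, fun j hj => ?_⟩
    exact hx j fun h => hj (by rw [Pi.smul_apply, h, smul_zero])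

/-- The leading weight of the `i`-th reduced basis vector is that of the `i`-th column, so the
vectors of leading weight at most `k` give a basis. The left side does not involve `S₀`, which
allows two maximal choices to be compared. -/
theorem finrank_lowPart (hJ : IsPlucker I J p) (h0 : p S₀ ≠ 0) {w : Fin 2 → ℤ}
    (hmax : ∀ S, p S ≠ 0 → colWt w S ≤ colWt w S₀) (k : ℤ) :
    Module.finrank K (lowPart I J w k) = Nat.card {i // wt w (S₀ i).1 ≤ k} := by
  classical
  obtain ⟨v, hv, hp⟩ := hJ.exists_reduced h0
  have := Fintype.ofFinite {i // wt w (S₀ i).1 ≤ k}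
  let φ : lowPart I J w k →ₗ[K] ({i // wt w (S₀ i).1 ≤ k} → K) :=
    { toFun := fun x i => x.1 (S₀ i.1)
      map_add' := fun _ _ => rfl
      map_smul' := fun _ _ => rfl }
  have hinj : Function.Injective φ := by
    rw [injective_iff_map_eq_zero]
    rintro ⟨x, f, hf, hxf, hx⟩ hφ
    have hz : ∀ i, x (S₀ i) = 0 := by
      intro i
      by_cases hi : wt w (S₀ i).1 ≤ k
      · exact congrFun hφ ⟨i, hi⟩
      · by_contra hne
        exact hi (hx _ hne)
    apply Subtype.ext
    ext j
    change x j = 0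
    rw [hxf, hv.coeff_of_mem hf j.2]
    refine Finset.sum_eq_zero fun i _ => ?_
    rw [← hxf, hz, zero_mul]
  have hsurj : Function.Surjective φ := by
    intro y
    let g : PS K := ∑ i, y i • v i.1
    refine ⟨⟨fun j => coeff j.1 g, g, sum_mem fun i _ => smul_mem_ideal _ (hv.mem _),
      fun j => rfl, fun j hj => ?_⟩, ?_⟩
    · beta_reduce at hj
      rw [coeff_sum_smul] at hj
      obtain ⟨i, -, hi⟩ := Finset.exists_ne_zero_of_sum_ne_zero hj
      exact (wt_le_of_coeff_ne_zero hv hp h0 hmax j.2 (right_ne_zero_of_mul hi)).trans i.2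
    · ext i
      change coeff (S₀ i.1).1 g = y i
      rw [coeff_sum_smul]
      simp [hv.coeff_eq, Subtype.coe_inj]
  rw [(LinearEquiv.ofBijective φ ⟨hinj, hsurj⟩).finrank_eq, Module.finrank_fintype_fun_eq_card,
    Nat.card_eq_fintype_card]

/-- Subtract the counts for the bounds `k` and `k - 1`. -/
theorem card_weight_eq {ι : Type*} [Finite ι] (f g : ι → ℤ)
    (h : ∀ k, Nat.card {i // f i ≤ k} = Nat.card {i // g i ≤ k}) (k : ℤ) :
    Nat.card {i // f i = k} = Nat.card {i // g i = k} := by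
  have key : ∀ f : ι → ℤ, Nat.card {i // f i = k} + Nat.card {i // f i ≤ k - 1} =
      Nat.card {i // f i ≤ k} := by
    intro f
    rw [← Nat.card_sum]
    refine Nat.card_congr (Equiv.trans (Equiv.sumCompl
      (fun i : {i // f i ≤ k} => f i.1 = k)).symm (Equiv.sumCongr ?_ ?_)).symm
    · exact Equiv.subtypeSubtypeEquivSubtype fun h => le_of_eq h
    · exact (Equiv.subtypeEquivRight fun i => by have := i.2; omega).trans
        (Equiv.subtypeSubtypeEquivSubtype fun {x} (h : f x ≤ k - 1) => by omega)
  have h1 := key f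
  have h2 := key g
  rw [h, h k] at h1
  omega

/-- The power series whose monomials lie in `T`. -/
def suppModule (K : Type*) [Field K] (T : Set (Fin 2 →₀ ℕ)) : Submodule K (PS K) where
  carrier := {f | ∀ e, coeff e f ≠ 0 → e ∈ T}
  zero_mem' := fun e he => absurd (by simp) he
  add_mem' := by
    intro f g hf hg e he
    by_cases h : coeff e f = 0
    · exact hg e fun h' => he (by rw [map_add, h, h', add_zero])
    · exact hf e h
  smul_mem' := by
    intro a f hf e he
    exact hf e fun h => he (by rw [coeff_smul, h, mul_zero])

theorem mem_suppModule {T : Set (Fin 2 →₀ ℕ)} {f : PS K} :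
    f ∈ suppModule K T ↔ ∀ e, coeff e f ≠ 0 → e ∈ T := Iff.rfl

open Classical in
/-- Coefficients of a power series in the monomials of `T'`, for `T' ⊆ T`. -/
def coeffMap (K : Type*) [Field K] (T T' : Set (Fin 2 →₀ ℕ)) :
    suppModule K T →ₗ[K] (T' → K) where
  toFun f e := coeff e.1 f.1
  map_add' _ _ := rfl
  map_smul' _ _ := rfl

theorem coeffMap_surjective {T T' : Set (Fin 2 →₀ ℕ)} (h : T' ⊆ T) :
    Function.Surjective (coeffMap K T T') := by
  classical
  intro y
  refine ⟨⟨ofCoeff fun e => if he : e ∈ T' then y ⟨e, he⟩ else 0, fun e he => ?_⟩, ?_⟩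
  · rw [coeff_ofCoeff] at he
    by_contra hT
    exact he (dif_neg fun h' => hT (h h'))
  · ext e
    change (if he : e.1 ∈ T' then y ⟨e.1, he⟩ else 0) = y e
    rw [dif_pos e.2]

/-- Such a space is the full space of functions on its set of monomials, so a bijection of the sets
suffices even when they are infinite. -/
theorem rank_suppModule {T T' : Set (Fin 2 →₀ ℕ)} (e : Nonempty (T ≃ T')) :
    Module.rank K (suppModule K T) = Module.rank K (suppModule K T') := by
  have key : ∀ T, Nonempty (suppModule K T ≃ₗ[K] (T → K)) := fun T =>
    ⟨LinearEquiv.ofBijective (coeffMap K T T) ⟨by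
      rw [injective_iff_map_eq_zero]
      rintro ⟨f, hf⟩ hz
      apply Subtype.ext
      ext e
      by_contra hne
      exact hne (congrFun hz ⟨e, hf e hne⟩), coeffMap_surjective le_rfl⟩⟩
  obtain ⟨e⟩ := e
  obtain ⟨e₁⟩ := key T
  obtain ⟨e₂⟩ := key T'
  exact (e₁.trans ((LinearEquiv.funCongrLeft K K e.symm).trans e₂.symm)).rank_eq

theorem rank_quotient_suppModule (T T' : Set (Fin 2 →₀ ℕ)) :
    Module.rank K (suppModule K T ⧸ (suppModule K T').comap (suppModule K T).subtype) =
      Module.rank K (↥(T \ T') → K) := by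
  have hker : LinearMap.ker (coeffMap K T (T \ T')) =
      (suppModule K T').comap (suppModule K T).subtype := by
    ext f
    rw [LinearMap.mem_ker, Submodule.mem_comap, mem_suppModule]
    constructor
    · intro hz e he
      by_contra hT'
      exact he (congrFun hz ⟨e, f.2 e he, hT'⟩)
    · intro h
      ext e
      by_contra hne
      exact e.2.2 (h e.1 hne)
  exact ((Submodule.quotEquivOfEq _ _ hker.symm).trans
    ((coeffMap K T (T \ T')).quotKerEquivOfSurjective
      (coeffMap_surjective Set.sdiff_subset))).rank_eq

theorem weightPiece_eq (w : Fin 2 → ℤ) (k : ℤ) :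
    weightPiece K w k = suppModule K {e | wt w e = k} := by
  ext f
  simp only [weightPiece, Submodule.mem_iInf, LinearMap.mem_ker]
  exact forall_congr' fun e => not_imp_comm

theorem SpannedBy.gradedPiece_eq {n : ℕ} {D : Set (Fin 2 →₀ ℕ)} (h : SpannedBy n J D)
    (w : Fin 2 → ℤ) (k : ℤ) :
    gradedPiece J w k = suppModule K {e | wt w e = k ∧ (e.degree < n → e ∈ D)} := by
  ext f
  rw [gradedPiece, weightPiece_eq, Submodule.mem_inf, Submodule.restrictScalars_mem, h f,
    mem_suppModule, mem_suppModule]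
  constructor
  · exact fun hf e he => ⟨hf.2 e he, fun hd => hf.1 e hd he⟩
  · exact fun hf => ⟨fun e hd he => (hf e he).2 hd, fun e he => (hf e he).1⟩

/-- Ideals spanned by equally many monomials of each weight have graded pieces of the same
dimension. -/
theorem rank_eq_of_spannedBy {n : ℕ} {ι : Type*} [Finite ι] {s s' : ι → Fin 2 →₀ ℕ}
    (hs : Function.Injective s) (hs' : Function.Injective s') (hsn : ∀ i, (s i).degree < n)
    (hsn' : ∀ i, (s' i).degree < n) {J J' : Ideal (PS K)} (hJ : SpannedBy n J (Set.range s))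
    (hJ' : SpannedBy n J' (Set.range s')) (w : Fin 2 → ℤ) (k : ℤ)
    (hcard : Nat.card {i // wt w (s i) = k} = Nat.card {i // wt w (s' i) = k}) :
    Module.rank K (gradedPiece J w k) = Module.rank K (gradedPiece J' w k) ∧
      Module.rank K (quotPiece J w k) = Module.rank K (quotPiece J' w k) := by
  -- Monomials of degree at least `n` lie in both ideals; only the finite set `lo` can tell the two
  -- apart.
  set lo : Set (Fin 2 →₀ ℕ) := {e | wt w e = k ∧ e.degree < n} with hlo
  set hi : Set (Fin 2 →₀ ℕ) := {e | wt w e = k ∧ n ≤ e.degree} with hhi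
  have hlofin : lo.Finite := (Finsupp.finite_of_degree_le (σ := Fin 2) n).subset
    fun e he => le_of_lt he.2
  have hsub : ∀ {s : ι → Fin 2 →₀ ℕ}, (∀ i, (s i).degree < n) → lo ∩ Set.range s ⊆ lo :=
    fun _ => Set.inter_subset_left
  have hnc : ∀ {s : ι → Fin 2 →₀ ℕ}, Function.Injective s → (∀ i, (s i).degree < n) →
      (lo ∩ Set.range s).ncard = Nat.card {i // wt w (s i) = k} := by
    intro s hs hsn
    have : lo ∩ Set.range s = Set.range fun i : {i // wt w (s i) = k} => s i.1 := by
      ext e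
      constructor
      · rintro ⟨he, i, rfl⟩
        exact ⟨⟨i, he.1⟩, rfl⟩
      · rintro ⟨i, rfl⟩
        exact ⟨⟨i.2, hsn _⟩, i.1, rfl⟩
    rw [this, ← Nat.card_coe_set_eq]
    exact Nat.card_range_of_injective (hs.comp Subtype.val_injective)
  have hnceq : (lo ∩ Set.range s).ncard = (lo ∩ Set.range s').ncard := by
    rw [hnc hs hsn, hnc hs' hsn', hcard]
  have hequiv : ∀ {A B : Set (Fin 2 →₀ ℕ)}, A ⊆ lo → B ⊆ lo → A.ncard = B.ncard →
      Nonempty (A ≃ B) := by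
    intro A B hA hB h
    have := (hlofin.subset hA).to_subtype
    have := (hlofin.subset hB).to_subtype
    exact Finite.card_eq.1 h
  have hset : ∀ s : ι → Fin 2 →₀ ℕ, {e | wt w e = k ∧ (e.degree < n → e ∈ Set.range s)} =
      (lo ∩ Set.range s) ∪ hi := by
    intro s
    ext e
    by_cases h : e.degree < n
    · simp [hlo, hhi, h, not_le.2 h]
    · simp [hlo, hhi, h, not_lt.1 h]
  have hdisj : ∀ s : ι → Fin 2 →₀ ℕ, Disjoint (lo ∩ Set.range s) hi := fun s =>
    Set.disjoint_left.2 fun e he he' => absurd he.1.2 (not_lt.2 he'.2)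
  constructor
  · rw [hJ.gradedPiece_eq, hJ'.gradedPiece_eq, hset, hset]
    apply rank_suppModule
    classical
    obtain ⟨e⟩ := hequiv (hsub hsn) (hsub hsn') hnceq
    exact ⟨(Equiv.Set.union (hdisj s)).trans ((Equiv.sumCongr e (Equiv.refl _)).trans
      (Equiv.Set.union (hdisj s')).symm)⟩
  -- The quotient sees only the monomials of `lo` outside the ideal, and the complements in `lo` are
  -- equinumerous.
  · have hdiff : ∀ s : ι → Fin 2 →₀ ℕ, {e | wt w e = k} \
        {e | wt w e = k ∧ (e.degree < n → e ∈ Set.range s)} = lo \ (lo ∩ Set.range s) := by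
      intro s
      ext e
      simp only [Set.mem_sdiff, hlo, Set.mem_inter_iff]
      change (wt w e = k ∧ ¬ (wt w e = k ∧ (e.degree < n → e ∈ Set.range s))) ↔
        (wt w e = k ∧ e.degree < n) ∧ ¬ ((wt w e = k ∧ e.degree < n) ∧ e ∈ Set.range s)
      tauto
    have hrank : ∀ {J : Ideal (PS K)} {s : ι → Fin 2 →₀ ℕ}, SpannedBy n J (Set.range s) →
        Module.rank K (quotPiece J w k) = Module.rank K (↥(lo \ (lo ∩ Set.range s)) → K) := by
      intro J s hJ
      have : ∀ (A B : Submodule K (PS K)) (T T' : Set (Fin 2 →₀ ℕ)), A = suppModule K T →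
          B = suppModule K T' →
          Module.rank K (A ⧸ B.comap A.subtype) = Module.rank K (↥(T \ T') → K) := by
        rintro _ _ T T' rfl rfl
        exact rank_quotient_suppModule T T'
      rw [this _ _ _ _ (weightPiece_eq w k) (hJ.gradedPiece_eq w k), hdiff]
    rw [hrank hJ, hrank hJ']
    obtain ⟨e⟩ := hequiv (A := lo \ (lo ∩ Set.range s)) (B := lo \ (lo ∩ Set.range s'))
      Set.sdiff_subset Set.sdiff_subset (by
        rw [Set.ncard_sdiff (hsub hsn) (hlofin.subset (hsub hsn)),
          Set.ncard_sdiff (hsub hsn') (hlofin.subset (hsub hsn')), hnceq])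
    exact (LinearEquiv.funCongrLeft K K e.symm).rank_eq

end

section

open MvPowerSeries

variable {K : Type*} [Field K] {c : Kind} {I J : Ideal (PS K)} {p : (Row I → Col I) → K}

/-! ### Scaling the variables -/

/-- The value of the monomial with exponent vector `e` at `s`. -/
def monVal (s : Fin 2 → Kˣ) (e : Fin 2 →₀ ℕ) : Kˣ := s 0 ^ e 0 * s 1 ^ e 1

theorem coeff_rescale_units (s : Fin 2 → Kˣ) (f : PS K) (e : Fin 2 →₀ ℕ) :
    coeff e (rescale (fun i => (s i : K)) f) = monVal s e * coeff e f := by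
  rw [coeff_rescale, Finsupp.prod_fintype _ _ fun i => pow_zero _, Fin.prod_univ_two, monVal]
  push_cast
  rfl

theorem rescale_rescale_inv (s : Fin 2 → Kˣ) (f : PS K) :
    rescale (fun i => (s i : K)) (rescale (fun i => (s⁻¹ i : Kˣ).val) f) = f := by
  ext e
  rw [coeff_rescale_units, coeff_rescale_units, ← mul_assoc, ← Units.val_mul]
  simp only [monVal, Pi.inv_apply, inv_pow]
  rw [← mul_inv, mul_inv_cancel, Units.val_one, one_mul]

theorem mem_map_rescale {s : Fin 2 → Kˣ} {f : PS K} :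
    f ∈ J.map (rescale fun i => (s i : K)) ↔ ∃ g ∈ J, rescale (fun i => (s i : K)) g = f :=
  Ideal.mem_map_iff_of_surjective _ fun f => ⟨_, rescale_rescale_inv s f⟩

theorem rescale_mem_maxIdeal_pow (s : Fin 2 → Kˣ) {n : ℕ} {f : PS K}
    (hf : f ∈ maxIdeal K ^ n) : rescale (fun i => (s i : K)) f ∈ maxIdeal K ^ n := by
  rw [mem_maxIdeal_pow] at *
  intro e he
  rw [coeff_rescale_units, hf e he, mul_zero]

theorem rescale_mem_maxIdeal_pow_iff (s : Fin 2 → Kˣ) {n : ℕ} {f : PS K} :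
    rescale (fun i => (s i : K)) f ∈ maxIdeal K ^ n ↔ f ∈ maxIdeal K ^ n := by
  refine ⟨fun h => ?_, rescale_mem_maxIdeal_pow s⟩
  have := rescale_mem_maxIdeal_pow s⁻¹ h
  have h2 := rescale_rescale_inv s⁻¹ f
  rw [inv_inv] at h2
  rwa [h2] at this

theorem IsPlucker.rescale (h : IsPlucker I J p) (s : Fin 2 → Kˣ) :
    IsPlucker I (J.map (rescale fun i => (s i : K)))
      fun S => ((∏ i, monVal s (S i).1 : Kˣ) : K) * p S := by
  obtain ⟨hJ, v, hv, hspan, hp⟩ := h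
  refine ⟨fun f hf => mem_map_rescale.2 ⟨_, hJ (rescale_mem_maxIdeal_pow s⁻¹ hf),
    rescale_rescale_inv s f⟩, fun i => MvPowerSeries.rescale (fun i => (s i : K)) (v i),
    fun i => Ideal.mem_map_of_mem _ (hv i), fun f hf => ?_, fun S => ?_⟩
  · obtain ⟨g, hg, rfl⟩ := mem_map_rescale.1 hf
    have hiff : ∀ d : Row I → K, MvPowerSeries.rescale (fun i => (s i : K)) g -
        ∑ i, d i • MvPowerSeries.rescale (fun i => (s i : K)) (v i) ∈ maxIdeal K ^ trunc I ↔
        g - ∑ i, d i • v i ∈ maxIdeal K ^ trunc I := by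
      intro d
      have : ∀ i, MvPowerSeries.rescale (fun i => (s i : K)) (d i • v i) =
          d i • MvPowerSeries.rescale (fun i => (s i : K)) (v i) := by
        intro i
        ext e
        rw [coeff_rescale_units, coeff_smul, coeff_smul, coeff_rescale_units]
        ring
      have e : MvPowerSeries.rescale (fun i => (s i : K)) g -
          ∑ i, d i • MvPowerSeries.rescale (fun i => (s i : K)) (v i) =
          MvPowerSeries.rescale (fun i => (s i : K)) (g - ∑ i, d i • v i) := by
        rw [map_sub, map_sum]
        congr 1
        exact Finset.sum_congr rfl fun i _ => (this i).symm
      rw [e, rescale_mem_maxIdeal_pow_iff]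
    obtain ⟨d, hd, hu⟩ := hspan g hg
    exact ⟨d, (hiff d).2 hd, fun d' hd' => hu d' ((hiff d').1 hd')⟩
  · beta_reduce
    rw [hp, Units.coe_prod, ← Matrix.det_mul_row]
    congr 1
    ext i j
    exact (coeff_rescale_units s (v i) _).symm

theorem prod_monVal (c : Kind) (α β : Kˣ) (S : Row I → Col I) :
    ∏ i, monVal (fun k => α ^ c.axis 0 k * β ^ c.axis 1 k) (S i).1 =
      α ^ colWt (c.axis 0) S * β ^ colWt (c.axis 1) S := by
  have hterm : ∀ e : Fin 2 →₀ ℕ, monVal (fun k => α ^ c.axis 0 k * β ^ c.axis 1 k) e =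
      α ^ wt (c.axis 0) e * β ^ wt (c.axis 1) e := by
    intro e
    rw [monVal, mul_pow, mul_pow, ← zpow_natCast, ← zpow_natCast, ← zpow_natCast, ← zpow_natCast,
      ← zpow_mul, ← zpow_mul, ← zpow_mul, ← zpow_mul, mul_mul_mul_comm, ← zpow_add, ← zpow_add,
      wt, wt, mul_comm (e 0 : ℤ), mul_comm (e 1 : ℤ), mul_comm (e 0 : ℤ), mul_comm (e 1 : ℤ)]
  have hz : ∀ (x : Kˣ) (f : Row I → ℤ), ∏ i, x ^ f i = x ^ ∑ i, f i := fun x f => by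
    induction (Finset.univ : Finset (Row I)) using Finset.induction_on with
    | empty => simp
    | insert a s ha ih => rw [Finset.prod_insert ha, Finset.sum_insert ha, zpow_add, ih]
  simp only [hterm, Finset.prod_mul_distrib, hz]
  rfl

/-- The unimodular matrix of weights is inverted, so every scaling of $x,y$ comes from a unique-form
pair of multipliers for $a$ and $b$. -/
theorem Kind.exists_units (c : Kind) (s : Fin 2 → Kˣ) :
    ∃ α β : Kˣ, s = fun k => α ^ c.axis 0 k * β ^ c.axis 1 k := by
  cases c
  · refine ⟨s 1 ^ 2 / s 0, s 1 ^ 3 / s 0, ?_⟩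
    ext k
    fin_cases k <;> simp [Kind.axis, Kind.weight, zpow_neg] <;> field_simp
  · refine ⟨s 1 ^ 2 / s 0, s 0 / s 1, ?_⟩
    ext k
    fin_cases k <;> simp [Kind.axis, Kind.weight] <;> field_simp

/-- Scaling multiplies the coordinate `S` by a monomial in its biweight, which differs from its
exponent vector by a constant; this is $(a,b)\mapsto(a\alpha,b\beta)$ up to a common factor. -/
theorem map_rescale_eq {B : Set (Row I → Col I)} {a b α β : Kˣ} {J' : Ideal (PS K)}
    (hJ : IsPlucker I J (facePoint c B a b))
    (hJ' : IsPlucker I J' (facePoint c B (a * α) (b * β))) :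
    J.map (rescale fun k => ((α ^ c.axis 0 k * β ^ c.axis 1 k : Kˣ) : K)) = J' := by
  refine (hJ'.eq_of_smul (hJ.rescale fun k => α ^ c.axis 0 k * β ^ c.axis 1 k)
    (Units.ne_zero (α ^ (∑ i : Row I, wt (c.axis 0) i.1) * β ^ (∑ i : Row I, wt (c.axis 1) i.1)))
    fun S => ?_).symm
  by_cases hS : S ∈ B
  · rw [facePoint_of_mem hS, facePoint_of_mem hS, prod_monVal, mul_left_comm, mul_left_comm
      (Units.val _), ← Units.val_mul, ← Units.val_mul]
    congr 2
    have h0 : colWt (c.axis 0) S = ∑ i : Row I, wt (c.axis 0) i.1 + expo c S 0 := by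
      rw [expo]; ring
    have h1 : colWt (c.axis 1) S = ∑ i : Row I, wt (c.axis 1) i.1 + expo c S 1 := by
      rw [expo]; ring
    rw [h0, h1, zpow_add, zpow_add, mul_zpow, mul_zpow]
    simp only [mul_assoc, mul_comm, mul_left_comm]
  · rw [facePoint_of_not_mem hS, facePoint_of_not_mem hS, mul_zero, mul_zero]

/-- The function `(i, j)` and the function `r (n, -m)` have the same maxima on a face where
`(m, n)` is constant. -/
theorem maxIn_maxIn_eq {m n i j r : ℤ} (hmn : (m, n) ≠ (0, 0)) (hr : r ^ 2 = 1)
    (h : 0 < r * (n * i - m * j)) (B : Set (Row I → Col I)) :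
    maxIn c (maxIn c B m n) i j = maxIn c (maxIn c B m n) (r * n) (-(r * m)) := by
  have hpos : 0 < m ^ 2 + n ^ 2 := by
    have : m ≠ 0 ∨ n ≠ 0 := by
      by_contra! h0
      exact hmn (by rw [h0.1, h0.2])
    rcases this with h0 | h0
    · have := pow_pos (abs_pos.2 h0) 2
      rw [sq_abs] at this
      nlinarith [sq_nonneg n]
    · have := pow_pos (abs_pos.2 h0) 2
      rw [sq_abs] at this
      nlinarith [sq_nonneg m]
  ext S
  refine and_congr_right fun hS => forall₂_congr fun T hT => ?_
  have heq := ((mem_maxIn_iff hS).1 hT).2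
  simp only [lin] at heq ⊢
  -- Decompose $(m^2+n^2)(i,j)=(mi+nj)(m,n)+(ni-mj)(n,-m)$; the first summand is constant on the
  -- face.
  have e : (m ^ 2 + n ^ 2) * (i * expo c S 0 + j * expo c S 1 -
      (i * expo c T 0 + j * expo c T 1)) =
      (r * (n * i - m * j)) * (r * n * expo c S 0 + -(r * m) * expo c S 1 -
        (r * n * expo c T 0 + -(r * m) * expo c T 1)) := by
    linear_combination -(m * i + n * j) * heq - (n * i - m * j) * (n * (expo c S 0 - expo c T 0)
      - m * (expo c S 1 - expo c T 1)) * hr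
  rw [← sub_nonneg, ← mul_nonneg_iff_of_pos_left hpos, e, mul_nonneg_iff_of_pos_left h, sub_nonneg]

/-! ### Dependence on $a^n/b^m$ and the ideals next to a direction -/

theorem exists_eq_mul_zpow {m n : ℤ} (h : IsCoprime m n) {a b a' b' : Kˣ}
    (hab : a ^ n / b ^ m = a' ^ n / b' ^ m) : ∃ t : Kˣ, a' = a * t ^ m ∧ b' = b * t ^ n := by
  obtain ⟨x, y, hxy⟩ := h
  have hαβ : (a' / a) ^ n = (b' / b) ^ m := by
    rw [div_zpow, div_zpow, div_eq_div_iff_mul_eq_mul]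
    rw [div_eq_div_iff_mul_eq_mul] at hab
    rw [mul_comm (b' ^ m), hab]
  -- The exponents are Bézout coefficients: $xm+yn=1$, combined with $(a'/a)^n=(b'/b)^m$.
  refine ⟨(a' / a) ^ x * (b' / b) ^ y, ?_, ?_⟩
  · have : ((a' / a) ^ x * (b' / b) ^ y) ^ m = a' / a := by
      rw [mul_zpow, ← zpow_mul, ← zpow_mul, mul_comm y m, zpow_mul _ m y, ← hαβ, ← zpow_mul,
        ← zpow_add, mul_comm n y, hxy, zpow_one]
    rw [this, mul_div_cancel]
  · have : ((a' / a) ^ x * (b' / b) ^ y) ^ n = b' / b := by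
      rw [mul_zpow, ← zpow_mul, ← zpow_mul, mul_comm x n, zpow_mul _ n x, hαβ, ← zpow_mul,
        ← zpow_add, mul_comm m x, hxy, zpow_one]
    rw [this, mul_div_cancel]

/-- On the face where $(m,n)$ is largest all coordinates acquire the same power of $t$. -/
theorem eq_of_facePoint_mul_zpow {B : Set (Row I → Col I)} {m n : ℤ} (hne : B.Nonempty)
    {a b t : Kˣ} {J' : Ideal (PS K)} (hJ : IsPlucker I J (facePoint c (maxIn c B m n) a b))
    (hJ' : IsPlucker I J' (facePoint c (maxIn c B m n) (a * t ^ m) (b * t ^ n))) : J = J' := by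
  obtain ⟨S₀, h0⟩ := maxIn_nonempty c hne m n
  refine hJ.eq_of_smul hJ' (Units.ne_zero (t ^ lin c m n S₀)) fun S => ?_
  rw [facePoint_mul_zpow]
  by_cases hS : S ∈ maxIn c B m n
  · rw [((mem_maxIn_iff h0).1 hS).2]
  · rw [facePoint_of_not_mem hS, mul_zero, mul_zero]

/-- The properties of the ideal attached to a two-dimensional cone. -/
theorem exists_vertex_ideal [IsAlgClosed K] (hmon : IsMonomialIdeal I)
    [Module.Finite K (PS K ⧸ I)] [Nonempty (Row I)] (hI : HasMeasuringSequence I c.fst c.snd)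
    {m n : ℤ} (hmn : (m, n) ≠ (0, 0)) {L : Kˣ → Kˣ → Ideal (PS K)}
    (hL : ∀ a b, IsPlucker I (L a b) (facePoint c (maxIn c (fullSet c I) m n) a b))
    (hLc : ∀ a b, L a b ∈ orbitClosure I) {r : ℤ} (hr : r ^ 2 = 1) :
    ∃ V : Ideal (PS K), (∀ J, (∃ σ ∈ standardFan c I, (interior σ).Nonempty ∧
      (∀ᶠ ε : ℝ in nhdsWithin 0 (Set.Ioi 0),
        ((m : ℝ) + ε * (r * n : ℤ), (n : ℝ) + ε * (-(r * m) : ℤ)) ∈ σ) ∧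
      J ∈ torusOrbit c I σ) ↔ J = V) ∧
      (∀ (a b : Kˣ) (i j : ℤ), 0 < r * (n * i - m * j) →
        IsLimitAtInfinity I (fun s => L (a * s ^ i) (b * s ^ j)) V) ∧
      ∃ S₀ ∈ maxIn c (fullSet c I) m n,
        Function.Injective (fun i => (S₀ i).1) ∧
        SpannedBy (trunc I) V (Set.range fun i => (S₀ i).1) := by
  set F := maxIn c (fullSet c I) m n with hF
  -- The sign `r` picks the side: $(n,-m)$ is the clockwise normal to $(m,n)$, and $(-n,m)$ the
  -- counterclockwise one.
  set B := maxIn c F (r * n) (-(r * m)) with hB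
  have hfull : (fullSet c I).Nonempty := exists_coordCoeff_ne_zero c hmon
  have hFne : F.Nonempty := maxIn_nonempty c hfull m n
  have hFsub : F ⊆ fullSet c I := maxIn_subset c _ m n
  have hBsub : B ⊆ fullSet c I := (maxIn_subset c _ _ _).trans hFsub
  obtain ⟨S₀, h0⟩ : B.Nonempty := maxIn_nonempty c hFne _ _
  have hsq : m ^ 2 + n ^ 2 ≠ 0 := by
    intro h
    refine hmn ?_
    have h1 : m ^ 2 = 0 := by nlinarith [sq_nonneg m, sq_nonneg n]
    have h2 : n ^ 2 = 0 := by nlinarith [sq_nonneg m, sq_nonneg n]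
    rw [pow_eq_zero_iff two_ne_zero] at h1 h2
    rw [h1, h2]
  have hr0 : r ≠ 0 := by rintro rfl; norm_num at hr
  have hdet : m * (-(r * m)) - n * (r * n) ≠ 0 := by
    have : m * (-(r * m)) - n * (r * n) = -(r * (m ^ 2 + n ^ 2)) := by ring
    rw [this]
    exact neg_ne_zero.2 (mul_ne_zero hr0 hsq)
  obtain ⟨V, hV⟩ := exists_isPlucker_maxIn hFsub hFne (hL 1 1) (r * n) (-(r * m))
  have hlim : ∀ (a b : Kˣ) (i j : ℤ), 0 < r * (n * i - m * j) →
      IsLimitAtInfinity I (fun s => L (a * s ^ i) (b * s ^ j)) V := by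
    intro a b i j hij
    refine isLimitAtInfinity_maxIn (c := c) hFne (fun t => hL _ _) ?_
    rw [maxIn_maxIn_eq hmn hr hij]
    convert hV.smul (Units.ne_zero (a ^ expo c S₀ 0 * b ^ expo c S₀ 1)) using 2 with S
    exact facePoint_vertex hdet h0 a b S
  have hVc : V ∈ orbitClosure I := by
    refine (hlim 1 1 (r * n) (-(r * m)) ?_).mem_orbitClosure fun t => hLc _ _
    have : r * (n * (r * n) - m * (-(r * m))) = m ^ 2 + n ^ 2 := by
      linear_combination (m ^ 2 + n ^ 2) * hr
    rw [this]
    exact lt_of_le_of_ne (by positivity) hsq.symm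
  refine ⟨V, fun J => cone_iff hmon hI hdet hV hVc J, hlim, S₀, h0.1, ?_, ?_⟩
  · obtain ⟨v, hv, -⟩ := hV.exists_reduced ((facePoint_ne_zero hBsub).2 h0)
    exact hv.injective
  · exact spannedBy_of_expo_eq (c := c) hV ((facePoint_ne_zero hBsub).2 h0) fun S hS k =>
      expo_eq_of_mem hdet h0 ((facePoint_ne_zero hBsub).1 hS) k

end

end HilbToric

end

/-! ### The proposition for both kinds of automorphisms -/

open HilbToric in
theorem proposition3p2 {K : Type*} [Field K] [IsAlgClosed K] (c : Kind)
    (I : Ideal (PS K)) (hmon : IsMonomialIdeal I) (hfin : Module.Finite K (PS K ⧸ I))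
    (hI : HasMeasuringSequence I c.fst c.snd) (m n : ℤ) (hmn : (m, n) ≠ (0, 0)) :
    ∃ (L : Kˣ → Kˣ → Ideal (PS K)) (Ip Im : Ideal (PS K)),
      -- `L a b` is the limit of `g(a t^m, b t^n)(I)`, resp. `h(a t^m, b t^n)(I)`, as `t → ∞`
      (∀ (a b : Kˣ) (J : Ideal (PS K)),
        IsLimitAtInfinity I
          (fun t => I.map (c.aut ((a * t ^ m : Kˣ) : K) ((b * t ^ n : Kˣ) : K))) J ↔ J = L a b) ∧
      -- for primitive `(m, n)` it depends only on the ratio `a^n / b^m`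
      (IsCoprime m n → ∀ a b a' b' : Kˣ, a ^ n / b ^ m = a' ^ n / b' ^ m → L a b = L a' b') ∧
      -- it sweeps out the torus orbit attached to the ray through `(m, n)`
      (ray ((m : ℝ), (n : ℝ)) ∈ standardFan c I →
        (Set.range fun s : Kˣ × Kˣ => L s.1 s.2) = torusOrbit c I (ray ((m : ℝ), (n : ℝ))) ∧
        ∀ J ∈ torusOrbit c I (ray ((m : ℝ), (n : ℝ))),
          torusOrbit c I (ray ((m : ℝ), (n : ℝ))) = scalingOrbit J) ∧
      -- `Ip` and `Im` are the ideals of the adjacent two-dimensional cones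
      (∀ J, IsPlus c I m n J ↔ J = Ip) ∧ (∀ J, IsMinus c I m n J ↔ J = Im) ∧
      IsMonomialIdeal Ip ∧ IsMonomialIdeal Im ∧
      -- for `m, n > 0` they are the limits as `b → 0` and as `a → 0`
      (0 < m → 0 < n →
        (∀ a : Kˣ, IsLimitAtZero I (fun b => L a b) Ip) ∧
        (∀ b : Kˣ, IsLimitAtZero I (fun a => L a b) Im)) ∧
      -- in general they are the limits as `a^n / b^m → ∞` and as `a^n / b^m → 0`
      (∀ (a b : Kˣ) (i j : ℤ),
        (0 < n * i - m * j → IsLimitAtInfinity I (fun s => L (a * s ^ i) (b * s ^ j)) Ip) ∧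
        (n * i - m * j < 0 → IsLimitAtInfinity I (fun s => L (a * s ^ i) (b * s ^ j)) Im)) ∧
      -- their graded pieces have the same dimensions
      (∀ k : ℤ,
        Module.rank K (gradedPiece Ip (c.weight m n) k)
          = Module.rank K (gradedPiece Im (c.weight m n) k) ∧
        Module.rank K (quotPiece Ip (c.weight m n) k)
          = Module.rank K (quotPiece Im (c.weight m n) k)) := by
  have : Nonempty (Row I) := nonempty_row hmon hI
  have hfull : (fullSet c I).Nonempty := exists_coordCoeff_ne_zero c hmon
  -- The limit is the initial ideal of the transform for the weights attached to $(m,n)$.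
  choose L hL using fun a b : Kˣ => exists_isPlucker_maxIn le_rfl hfull
    (isPlucker_facePoint_fullSet c hmon a b) m n
  have hlim : ∀ a b : Kˣ, IsLimitAtInfinity I
      (fun t => I.map (c.aut ((a * t ^ m : Kˣ) : K) ((b * t ^ n : Kˣ) : K))) (L a b) := fun a b =>
    isLimitAtInfinity_maxIn (c := c) hfull
      (fun t => isPlucker_facePoint_fullSet c hmon _ _) (hL a b)
  have hLc : ∀ a b, L a b ∈ orbitClosure I := fun a b => (hlim a b).mem_orbitClosure fun t =>
    mem_orbitClosure_of_mem_orbit (map_aut_mem_orbit c I _ _) (isPlucker_map_aut c hmon _ _)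
  have hray : ∀ J, J ∈ torusOrbit c I (ray ((m : ℝ), (n : ℝ))) ↔ ∃ a b, J = L a b := by
    intro J
    rw [mem_torusOrbit_iff_facePoint hmon hI (B := maxIn c (fullSet c I) m n)
      (by simpa only [dualFace_ray] using fun S => vec_mem_face_iff)]
    constructor
    · rintro ⟨-, a, b, h⟩
      exact ⟨a, b, h.eq_of_smul (hL a b) one_ne_zero fun S => (one_mul _).symm⟩
    · rintro ⟨a, b, rfl⟩
      exact ⟨hLc a b, a, b, hL a b⟩
  obtain ⟨Ip, hIp, hIplim, S₁, hS₁, hinj₁, hsp₁⟩ :=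
    exists_vertex_ideal hmon hI hmn hL hLc (r := 1) (by norm_num)
  obtain ⟨Im, hIm, hImlim, S₂, hS₂, hinj₂, hsp₂⟩ :=
    exists_vertex_ideal hmon hI hmn hL hLc (r := -1) (by norm_num)
  simp only [one_mul, neg_one_mul, neg_neg] at hIp hIm hIplim hImlim
  refine ⟨L, Ip, Im, fun a b J => ⟨fun h => h.unique (hlim a b), by rintro rfl; exact hlim a b⟩,
    ?_, fun _ => ⟨?_, ?_⟩, fun J => ?_, fun J => ?_, hsp₁.isMonomialIdeal, hsp₂.isMonomialIdeal,
    fun hm hn => ⟨fun a => ?_, fun b => ?_⟩, fun a b i j => ⟨hIplim a b i j, fun h =>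
      hImlim a b i j (by omega)⟩, fun k => ?_⟩
  · intro hcop a b a' b' hab
    obtain ⟨t, rfl, rfl⟩ := exists_eq_mul_zpow hcop hab
    exact eq_of_facePoint_mul_zpow hfull (hL _ _) (hL _ _)
  · ext J
    rw [hray]
    exact ⟨fun ⟨s, hs⟩ => ⟨s.1, s.2, hs.symm⟩, fun ⟨a, b, h⟩ => ⟨(a, b), h.symm⟩⟩
  · intro J hJ
    obtain ⟨a, b, rfl⟩ := (hray J).1 hJ
    ext J'
    rw [hray]
    constructor
    · rintro ⟨a', b', rfl⟩
      refine ⟨fun k => (a' / a) ^ c.axis 0 k * (b' / b) ^ c.axis 1 k,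
        map_rescale_eq (c := c) (hL a b) ?_⟩
      rw [mul_div_cancel, mul_div_cancel]
      exact hL a' b'
    · rintro ⟨s, rfl⟩
      obtain ⟨α, β, rfl⟩ := c.exists_units s
      exact ⟨a * α, b * β, map_rescale_eq (hL a b) (hL _ _)⟩
  · rw [← hIp J, IsPlus]
    simp only [Int.cast_neg, mul_neg, sub_eq_add_neg]
  · rw [← hIm J, IsMinus]
    simp only [Int.cast_neg, mul_neg, sub_eq_add_neg]
  -- Letting $b\to0$ is the curve $(a,s^{-1})$, for which $ni-mj=m>0$.
  · have := hIplim a 1 0 (-1) (by omega)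
    simpa only [IsLimitAtZero, zpow_zero, mul_one, zpow_neg, zpow_one, one_mul] using this
  -- Letting $a\to0$ is the curve $(s^{-1},b)$, for which $ni-mj=-n<0$.
  · have := hImlim 1 b (-1) 0 (by omega)
    simpa only [IsLimitAtZero, zpow_zero, mul_one, zpow_neg, zpow_one, one_mul] using this
  · refine rank_eq_of_spannedBy hinj₁ hinj₂ (fun i => (S₁ i).2) (fun i => (S₂ i).2) hsp₁ hsp₂ _ k ?_
    -- Both vertices lie on the face of largest weight for the transform with $a=b=1$, so both
    -- counts equal the dimension of the same filtered piece of that one ideal.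
    refine card_weight_eq _ _ (fun k => ?_) k
    have hmax : ∀ S₀ ∈ maxIn c (fullSet c I) m n, ∀ S, facePoint c (fullSet c I) 1 1 S ≠ 0 →
        colWt (c.weight m n) S ≤ colWt (c.weight m n) S₀ := by
      intro S₀ h0 S hS
      rw [colWt_weight, colWt_weight]
      have := h0.2 S ((facePoint_ne_zero le_rfl).1 hS)
      omega
    have hp := isPlucker_facePoint_fullSet c hmon 1 1
    rw [← finrank_lowPart hp ((facePoint_ne_zero le_rfl).2 hS₁.1) (hmax S₁ hS₁) k,
      ← finrank_lowPart hp ((facePoint_ne_zero le_rfl).2 hS₂.1) (hmax S₂ hS₂) k]
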